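/- **Setting.** Let $(\tilde M,g)$ be a 4-dimensional spacetime with a $C^2$ Lorentzian metric of signature $(+,-,-,-)$, time oriented by a continuous timelike field $T$; we work in an open coordinate neighbourhood $U\subset\mathbb R^4$ of a point $i^+$. (In the application, $\tilde M$ extends the conformal compactification $(\hat M,\hat g)$ of an asymptotically simple spacetime of Chruściel–Delay/Corvino–Schoen type beyond $i^+$.) Let $I$ be the chronological past of $i^+$ in $U$. Let $\mathscr I^+$ be the past light cone of $i^+$ in $U$, with an affine parameter $r$ vanishing at $i^+$: for an orthonormal frame $(e_0,\dots,e_3)$ at $i^+$ with $e_0$ future directed and a positive $C^1$ function $a$ on $\mathbb S^2$, let $\Psi(\cdot,\omega):[0,R_1)\to U$ be the null geodesic with $\Psi(0,\omega)=i^+$ and $\partial_r\Psi(0,\omega)=a(\omega)\,(-e_0+\sum_{i=1}^3\omega_i e_i)$, and $\mathscr I^+=\{\Psi(r,\omega):0<r<R_1,\ \omega\in\mathbb S^2\}$. Assume that $\mathscr I^+$ is an embedded $C^1$ hypersurface and does not meet its interior $I$. Let $0<R<R_1$ and let $(\Sigma_r)_{r\in[0,R]}$ be a uniformly spacelike foliation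 of the interior of $\mathscr I^+$ near $i^+$ whose leaves meet $\mathscr I^+$ in the level sets of $r$. That is, $\Sigma_r=\{x\in I:\tau(x)=r\}$ for $0<r\le R$ and $\Sigma_0=\{i^+\}$, where $\tau$ is $C^1$ on $U\setminus\{i^+\}$, continuous on $I\cup\mathscr I^+\cup\{i^+\}$, positive on $I$, with $\tau(i^+)=0$ and $\tau(\Psi(r,\omega))=r$ for all $0<r<R_1$, $\omega\in\mathbb S^2$; the region $\{x\in I\cup\mathscr I^+\cup\{i^+\}:\tau(x)\le R\}$ is compact; and there is $\delta>0$ such that $$-g_x(v,v)\ \ge\ \delta\,|v|^2\qquad\text{for all } r\in(0,R],\ x\in\Sigma_r,\ v\in\ker d\tau_x=T_x\Sigma_r ,$$ $|\cdot|$ being the Euclidean norm of the coordinates. Equip $\Sigma_r$ with the Riemannian metric $-g|_{\Sigma_r}$, its volume measure $\mu_r$ and gradient $\nabla$. Let $H^1(\Sigma_r)$ be the completion of $\{u\in C^1(\Sigma_r):\int_{\Sigma_r}(\|\nabla u\|^2+u^2)\,d\mu_r<\infty\}$ in the norm $\big(\int_{\Sigma_r}(\|\nabla u\|^2+u^2)\,d\mu_r\big)^{1/2}$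 (for smooth $\Sigma_r$, the $C^\infty$ functions give the same space). **Proposition.** There is a constant $C$ such that for every $r\in(0,R]$ and every $u\in H^1(\Sigma_r)$, $$\Big(\int_{\Sigma_r}u^6\,d\mu_r\Big)^{1/3}\ \le\ C\Big(\int_{\Sigma_r}\|\nabla u\|^2\,d\mu_r+\frac1{r^2}\int_{\Sigma_r}u^2\,d\mu_r\Big).$$ In particular $u\in L^6(\Sigma_r)$. -/

import Mathlib

open MeasureTheory Set Filter Topology
open scoped ENNReal NNReal

/-- The coordinate space `ℝ⁴` (a coordinate neighbourhood of `i⁺` in the extended unphysical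
space-time is an open subset of it). -/
abbrev R4 := EuclideanSpace ℝ (Fin 4)

/-- `ℝ³`: its unit sphere is the sphere of null directions, and its open subsets are the parameter
domains of hypersurfaces. -/
abbrev R3 := EuclideanSpace ℝ (Fin 3)

/-- A field of bilinear forms on the tangent spaces of `ℝ⁴`. -/
abbrev BilinField := R4 → R4 →L[ℝ] R4 →L[ℝ] ℝ

/-- `e` is an orthonormal frame for a bilinear form of signature `(+,-,-,-)`. -/
def IsLorentzFrame (B : R4 →L[ℝ] R4 →L[ℝ] ℝ) (e : Fin 4 → R4) : Prop :=
  ∀ i j, B (e i) (e j) = if i = j then (if i = 0 then 1 else -1) else 0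

/-- `g` is a `C²` Lorentzian metric, of signature `(+,-,-,-)`, on the open set `U`, time oriented by
the continuous timelike vector field `T`. -/
structure IsSpacetime (U : Set R4) (g : BilinField) (T : R4 → R4) : Prop where
  isOpen : IsOpen U
  contDiffOn : ContDiffOn ℝ 2 g U
  symm : ∀ x ∈ U, ∀ v w, g x v w = g x w v
  lorentz : ∀ x ∈ U, ∃ e, IsLorentzFrame (g x) e
  continuousOn_T : ContinuousOn T U
  timelike_T : ∀ x ∈ U, 0 < g x (T x) (T x)

/-- `y` is reached from `x` by a past directed timelike `C¹` curve that stays in `U`. -/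
def PastTimelikeStep (U : Set R4) (g : BilinField) (T : R4 → R4) (x y : R4) : Prop :=
  ∃ c c' : ℝ → R4, c 0 = x ∧ c 1 = y ∧ ContinuousOn c' (Icc 0 1) ∧
    ∀ s ∈ Icc (0 : ℝ) 1, c s ∈ U ∧ HasDerivWithinAt c (c' s) (Icc 0 1) s ∧
      0 < g (c s) (c' s) (c' s) ∧ g (c s) (T (c s)) (c' s) < 0

/-- The chronological past of `p` in `U`: the points reached from `p` by past directed, piecewise
`C¹`, timelike curves in `U`. -/
def chronPast (U : Set R4) (g : BilinField) (T : R4 → R4) (p : R4) : Set R4 :=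
  {q | Relation.TransGen (PastTimelikeStep U g T) p q}

/-- `c : [0, R₁) → U` is an affinely parametrised geodesic of `g` with `c 0 = p` and initial velocity
`n`. The geodesic equation is written with the index lowered:
`g_{kl} c''^l + (∂_i g_{jk} - ½ ∂_k g_{ij}) c'^i c'^j = 0`. -/
def IsGeodesicFrom (U : Set R4) (g : BilinField) (p n : R4) (R₁ : ℝ) (c : ℝ → R4) : Prop :=
  ∃ c' c'' : ℝ → R4, c 0 = p ∧ c' 0 = n ∧
    ∀ s ∈ Ico 0 R₁, c s ∈ U ∧ HasDerivWithinAt c (c' s) (Ico 0 R₁) s ∧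
      HasDerivWithinAt c' (c'' s) (Ico 0 R₁) s ∧
      ∀ w : R4, g (c s) (c'' s) w + fderiv ℝ g (c s) (c' s) (c' s) w
        - 1 / 2 * fderiv ℝ g (c s) w (c' s) (c' s) = 0

/-- The set `{Ψ(r, ω) : ω ∈ S², 0 < r < R₁}`: the past light cone of its vertex, when `r ↦ Ψ(r, ω)`
are the past null geodesics from the vertex. -/
def lightCone (Ψ : ℝ → R3 → R4) (R₁ : ℝ) : Set R4 :=
  {x | ∃ r ∈ Ioo 0 R₁, ∃ ω ∈ Metric.sphere (0 : R3) 1, x = Ψ r ω}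

/-- `H` is an embedded hypersurface of class `C¹`. -/
def IsHypersurface (H : Set R4) : Prop :=
  ∀ x ∈ H, ∃ O : Set R4, IsOpen O ∧ x ∈ O ∧ ∃ f : R4 → ℝ, ContDiffOn ℝ 1 f O ∧
    fderiv ℝ f x ≠ 0 ∧ H ∩ O = {y ∈ O | f y = 0}

/-- `lightCone Ψ R₁` is future null infinity `𝓘⁺` near `p = i⁺`, and `r` is an affine parameter on it
with `r = 0` at `p`. The curves `r ↦ Ψ(r, ω)`, `ω ∈ S²`, are the null geodesics issued from `p` with
initial velocities `n(ω) = a(ω) (-e₀ + ω₁ e₁ + ω₂ e₂ + ω₃ e₃)`, where `e` is an orthonormal frame at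
`p` with `e₀` future directed. So `n(ω)` runs over the past null directions, once each, and the
positive function `a` is the freedom in the choice of the null generator. The cone is an embedded
hypersurface which bounds the interior, so that it does not meet the chronological past of `p`. -/
structure IsPastLightCone (U : Set R4) (g : BilinField) (T : R4 → R4) (p : R4)
    (Ψ : ℝ → R3 → R4) (R₁ : ℝ) : Prop where
  mem : p ∈ U
  generators : ∃ (e : Fin 4 → R4) (a : R3 → ℝ), IsLorentzFrame (g p) e ∧ 0 < g p (T p) (e 0) ∧
    ContDiffOn ℝ 1 a {0}ᶜ ∧ ∀ ω ∈ Metric.sphere (0 : R3) 1, 0 < a ω ∧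
      IsGeodesicFrom U g p (a ω • (-e 0 + ω 0 • e 1 + ω 1 • e 2 + ω 2 • e 3)) R₁ (fun r => Ψ r ω)
  hypersurface : IsHypersurface (lightCone Ψ R₁)
  disjoint : Disjoint (lightCone Ψ R₁) (chronPast U g T p)

/-- The leaf `Σ_r` of the foliation of the interior of the light cone of `p` by the level sets
of `τ`. Its tangent space at `x` is the kernel of `fderiv ℝ τ x`. -/
def leaf (U : Set R4) (g : BilinField) (T : R4 → R4) (p : R4) (τ : R4 → ℝ) (r : ℝ) : Set R4 :=
  {x ∈ chronPast U g T p | τ x = r}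

/-- The leaves `Σ_r = {τ = r}`, `0 < r ≤ R`, are a uniformly spacelike foliation of the interior of
the light cone near its vertex `p`, with `Σ_0 = {p}`, which meets the light cone in the level sets
of the affine parameter `r`.

* `τ` is `C¹` up to the light cone (and across it) away from `p`, is continuous at `p` from the inside
  of the cone, and is positive on the interior and zero at `p`;
* on the light cone, `τ` is the affine parameter;
* the region `{τ ≤ R}` of the interior together with the cone and its vertex is compact;
* uniformly spacelike: `-g` is bounded below on the tangent spaces of all leaves by one positive
  multiple of the Euclidean metric of the coordinates. -/
structure IsUniformlySpacelikeFoliation (U : Set R4) (g : BilinField) (T : R4 → R4) (p : R4)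
    (Ψ : ℝ → R3 → R4) (R₁ R : ℝ) (τ : R4 → ℝ) : Prop where
  pos : 0 < R
  lt : R < R₁
  contDiffOn : ContDiffOn ℝ 1 τ (U \ {p})
  continuousOn : ContinuousOn τ (insert p (chronPast U g T p ∪ lightCone Ψ R₁))
  vertex : τ p = 0
  interior_pos : ∀ x ∈ chronPast U g T p, 0 < τ x
  cone : ∀ r ∈ Ioo 0 R₁, ∀ ω ∈ Metric.sphere (0 : R3) 1, τ (Ψ r ω) = r
  compact : IsCompact {x ∈ insert p (chronPast U g T p ∪ lightCone Ψ R₁) | τ x ≤ R}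
  spacelike : ∃ δ > 0, ∀ r ∈ Ioc 0 R, ∀ x ∈ leaf U g T p τ r, ∀ v : R4,
    fderiv ℝ τ x v = 0 → δ * ‖v‖ ^ 2 ≤ -(g x v v)

/-- `φ : V → S`, with `V` open in `ℝ³`, is a local `C¹` parametrisation of the hypersurface `S`. -/
def IsLocalParam (S : Set R4) (V : Set R3) (φ : R3 → R4) : Prop :=
  IsOpen V ∧ ContDiffOn ℝ 1 φ V ∧ InjOn φ V ∧
    (∀ y ∈ V, Function.Injective (fderiv ℝ φ y)) ∧ MapsTo φ V S

/-- The volume density `√(det φ^*(-g))` of the metric induced by `-g` in the parametrisation `φ`. -/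
noncomputable def volDensity (g : BilinField) (φ : R3 → R4) (y : R3) : ℝ :=
  Real.sqrt (Matrix.det (Matrix.of fun i j : Fin 3 =>
    -(g (φ y) (fderiv ℝ φ y (EuclideanSpace.single i 1))
      (fderiv ℝ φ y (EuclideanSpace.single j 1)))))

/-- The Riemannian measure of a spacelike hypersurface `S` for the metric induced by `-g`, as a
measure on `ℝ⁴` carried by `S`. It is the smallest measure that dominates, for each local
parametrisation `(V, φ)` of `S`, the image under `φ` of `√(det φ^*(-g)) dy` on `V`; it coincides with
that image on `φ(V)`. -/
noncomputable def surfMeasure (g : BilinField) (S : Set R4) : Measure R4 :=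
  ⨆ P : {P : Set R3 × (R3 → R4) // IsLocalParam S P.1 P.2},
    Measure.map P.1.2 ((volume.restrict P.1.1).withDensity
      fun y => ENNReal.ofReal (volDensity g P.1.2 y))

/-- On the piece `S` of a level set of `τ`, the tangent vector field `X` is the gradient of the
function `u`, for the metric induced by `-g`. -/
def IsGradientOn (g : BilinField) (τ : R4 → ℝ) (S : Set R4) (u : R4 → ℝ) (X : R4 → R4) : Prop :=
  ∀ x ∈ S, fderiv ℝ τ x (X x) = 0 ∧
    ∀ v : R4, fderiv ℝ τ x v = 0 → -(g x (X x) v) = fderiv ℝ u x v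

/-- `∫_S ‖X‖² dμ`, for `X` tangent to `S` and the metric induced by `-g`. -/
noncomputable def gradEnergy (g : BilinField) (S : Set R4) (X : R4 → R4) : ℝ≥0∞ :=
  ∫⁻ x, ENNReal.ofReal (-(g x (X x) (X x))) ∂(surfMeasure g S)

/-- `∫_S u² dμ` for the metric induced by `-g`. -/
noncomputable def massSq (g : BilinField) (S : Set R4) (u : R4 → ℝ) : ℝ≥0∞ :=
  ∫⁻ x, ENNReal.ofReal (u x ^ 2) ∂(surfMeasure g S)

/-- `u ∈ H¹(S)` with gradient `X = ∇u`, for a piece `S` of a spacelike level set of `τ` with the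
metric induced by `-g`. `H¹(S)` is the completion of the space of (restrictions to `S` of)
continuously differentiable functions with `∫_S (‖∇u‖² + u²) dμ < ∞`, and the elements of the
completion are given as pairs of an `L²` function and an `L²` tangent vector field. (On a smooth `S`,
the `C^∞` functions have the same completion.) -/
structure MemH1 (g : BilinField) (τ : R4 → ℝ) (S : Set R4) (u : R4 → ℝ) (X : R4 → R4) : Prop where
  aemeasurable_fun : AEMeasurable u (surfMeasure g S)
  aemeasurable_grad : AEMeasurable X (surfMeasure g S)
  tangent : ∀ᵐ x ∂(surfMeasure g S), fderiv ℝ τ x (X x) = 0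
  approx : ∃ (w : ℕ → R4 → ℝ) (Y : ℕ → R4 → R4),
    (∀ k, ∃ O : Set R4, IsOpen O ∧ S ⊆ O ∧ ContDiffOn ℝ 1 (w k) O) ∧
    (∀ k, IsGradientOn g τ S (w k) (Y k)) ∧
    (∀ k, gradEnergy g S (Y k) + massSq g S (w k) < ∞) ∧
    Tendsto (fun k => gradEnergy g S (X - Y k) + massSq g S (u - w k)) atTop (𝓝 0)

/-! Everything rests on a Euclidean inequality with an explicit length scale. Let every point of an
open D in ℝ³ be an end point of segments of D, of parameter length L, in three independent
directions taken up to sign from finitely many fixed triples. Averaging the fundamental theorem of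
calculus along these segments bounds |v(x)| by integrals of |v|/L + B|∇v| over three lines through
x. Gagliardo's argument turns this into an L^{3/2} bound, and its application to v⁴ gives ‖v‖₆² ≤
c(‖∇v‖₂² + L⁻²‖v‖₂²), with c depending on the triples only (`sobolev_segmentCover`). A
parametrisation with two-sided bounds on the metric carries this to a piece of hypersurface
(`sobolev_chart`). What remains is geometry: uniformly in r, segments of length comparable to r must
fit into the parameter domains of the leaf Σ_r.

Away from the vertex, compactness suffices. Near a point of the interior or of the cone, the inverse
function theorem makes τ a coordinate and, at a point of the cone, also a local defining function f
of the cone. The two differentials are independent there because τ grows at unit rate along the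
generators while f is constant on them. A leaf is then locally a whole cube or made of sides of the
plane f = 0, and finitely many such neighbourhoods cover the region r₀ ≤ τ ≤ R
(`sobolevOn_leaf_of_ge`).

Near the vertex the leaf is a graph, over a domain D of ℝ³, in the components of a Lorentz frame at
i⁺; uniform spacelikeness bounds its slope by some κ < 1. The shape of D is not known, but segments
of length c·r pointing towards the axis stay in D. If one left D after time s, its exit point would
lie under a point Ψ(r,ω) of the cone. Following that generator until it has moved outwards by s
undoes the inward displacement, while time has dropped by at least about (1 − κ)s. So a later point
of the generator would lie in the timelike past of a point of the leaf, hence in I, which the cone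
does not meet (`IsNearVertex.segment_subset`). The constant is uniform since only the length c·r
depends on r.

Fatou's lemma extends the inequality from C¹ functions to H¹ (`SobolevOn.memH1`). -/

/-! ### The Euclidean Sobolev inequality on domains with the segment property -/

/-- Gagliardo's inequality: a function bounded by the integrals of `F` along all lines in three
independent directions has its `L^{3/2}` norm bounded by the integral of `F`. -/
theorem gagliardo_lines (e : Fin 3 → R3) (he : LinearIndependent ℝ e) :
    ∃ c : ℝ≥0, ∀ F h : R3 → ℝ≥0∞, Measurable F →
      (∀ x i, h x ≤ ∫⁻ t : ℝ, F (x + t • e i)) →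
      ∫⁻ x, h x ^ (3 / 2 : ℝ) ≤ c * (∫⁻ x, F x) ^ (3 / 2 : ℝ) := by
  let b := basisOfLinearIndependentOfCardEqFinrank he (by simp)
  have hb : ∀ i, b i = e i := fun i => by simp [b]
  let M : (Fin 3 → ℝ) ≃L[ℝ] R3 := b.equivFunL.symm
  have hM : ∀ (x : Fin 3 → ℝ) (i : Fin 3) (t : ℝ),
      M (Function.update x i t) = M x + (t - x i) • e i := by
    intro x i t
    have h1 : Function.update x i t = x + (t - x i) • Pi.single i (1 : ℝ) := by
      ext j
      by_cases hj : j = i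
      · subst hj; simp
      · simp [hj]
    rw [h1, map_add, map_smul]
    congr 2
    have : M (Pi.single i 1) = b i := by
      change b.equivFun.symm (Pi.single i 1) = b i
      simp [Module.Basis.equivFun_symm_apply, Pi.single_apply]
    rw [this, hb]
  let Me : (Fin 3 → ℝ) ≃ᵐ R3 := M.toHomeomorph.toMeasurableEquiv
  have hMe : ∀ x, Me x = M x := fun x => rfl
  have hmap : (Measure.map M (volume : Measure (Fin 3 → ℝ))).IsAddHaarMeasure :=
    M.isAddHaarMeasure_map volume
  obtain ⟨c, hc0, hct, hc⟩ : ∃ c : ℝ≥0∞, c ≠ 0 ∧ c ≠ ∞ ∧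
      Measure.map Me (volume : Measure (Fin 3 → ℝ)) = c • (volume : Measure R3) :=
    ⟨Measure.addHaarScalarFactor (Measure.map M (volume : Measure (Fin 3 → ℝ))) volume,
      ENNReal.coe_ne_zero.2 (Measure.addHaarScalarFactor_pos_of_isAddHaarMeasure _ _).ne',
      ENNReal.coe_ne_top, 
      Measure.isAddLeftInvariant_eq_smul (Measure.map M (volume : Measure (Fin 3 → ℝ))) volume⟩
  have hint : ∀ G : R3 → ℝ≥0∞, ∫⁻ x, G (M x) = c * ∫⁻ y, G y := by
    intro G
    rw [← smul_eq_mul, ← lintegral_smul_measure, ← hc, lintegral_map_equiv]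
    rfl
  refine ⟨(c⁻¹ * c ^ (3 / 2 : ℝ)).toNNReal, fun F h hF hh => ?_⟩
  have hfin : c⁻¹ * c ^ (3 / 2 : ℝ) ≠ ∞ :=
    ENNReal.mul_ne_top (ENNReal.inv_ne_top.2 hc0) (ENNReal.rpow_ne_top_of_nonneg (by norm_num) hct)
  rw [ENNReal.coe_toNNReal hfin]
  have hp : Real.HolderConjugate (Fintype.card (Fin 3)) (3 / 2 : ℝ) := by
    rw [Real.holderConjugate_iff]; norm_num
  -- The grid-lines inequality in the linear coordinates adapted to the three directions. Each
  -- direction contributes the power 1/(3 - 1) of `h`, so the three factors make up the exponent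
  -- 3/2.
  have key := lintegral_prod_lintegral_pow_le (fun _ : Fin 3 => (volume : Measure ℝ)) hp
    (f := fun x => F (M x)) (hF.comp M.continuous.measurable)
  have h1 : ∫⁻ x : Fin 3 → ℝ, h (M x) ^ (3 / 2 : ℝ) ≤ (∫⁻ x : Fin 3 → ℝ, F (M x)) ^ (3 / 2 : ℝ) := by
    refine le_trans (lintegral_mono fun x => ?_) key
    have h2 : ∀ i, h (M x) ≤ ∫⁻ t, F (M (Function.update x i t)) := by
      intro i
      simp_rw [hM]
      rw [lintegral_sub_right_eq_self (fun t => F (M x + t • e i)) (x i)]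
      exact hh _ _
    calc h (M x) ^ (3 / 2 : ℝ) = ∏ _i : Fin 3, h (M x) ^ ((1 : ℝ) / (Fintype.card (Fin 3) - 1 : ℝ)) := by
          rw [Finset.prod_const, ← ENNReal.rpow_mul_natCast]
          congr 1
          simp
          norm_num
      _ ≤ _ := Finset.prod_le_prod' fun i _ => ENNReal.rpow_le_rpow (h2 i) (by norm_num)
  rw [hint F, hint (fun y => h y ^ (3 / 2 : ℝ)), ENNReal.mul_rpow_of_nonneg _ _ (by norm_num)] at h1
  calc ∫⁻ x, h x ^ (3 / 2 : ℝ) = c⁻¹ * (c * ∫⁻ x, h x ^ (3 / 2 : ℝ)) := by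
        rw [← mul_assoc, ENNReal.inv_mul_cancel hc0 hct, one_mul]
    _ ≤ c⁻¹ * (c ^ (3 / 2 : ℝ) * (∫⁻ x, F x) ^ (3 / 2 : ℝ)) := by gcongr
    _ = _ := by rw [mul_assoc]

/-- The value of a `C¹` function at an end point of an interval, in terms of the averages of the
function and of its derivative. -/
theorem abs_le_integral_of_hasDerivAt {f f' b : ℝ → ℝ} {L : ℝ} (hL : 0 < L)
    (hf : ∀ s ∈ Icc 0 L, HasDerivAt f (f' s) s) (hf' : ContinuousOn f' (Icc 0 L))
    (hb : ContinuousOn b (Icc 0 L)) (hfb : ∀ s ∈ Icc 0 L, |f' s| ≤ b s) :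
    |f 0| ≤ ∫ s in (0 : ℝ)..L, (|f s| / L + b s) := by
  have hfc : ContinuousOn f (Icc 0 L) := fun s hs => (hf s hs).continuousAt.continuousWithinAt
  have hu : uIcc 0 L = Icc 0 L := uIcc_of_le hL.le
  have ib : IntervalIntegrable b volume 0 L := ContinuousOn.intervalIntegrable (by rwa [hu])
  have ifa : IntervalIntegrable (fun s => |f s|) volume 0 L :=
    ContinuousOn.intervalIntegrable (by rw [hu]; exact hfc.abs)
  have h0 : ∀ s ∈ Icc 0 L, |f 0| ≤ |f s| + ∫ t in (0 : ℝ)..L, b t := by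
    intro s hs
    have hsub : uIcc 0 s ⊆ Icc 0 L := by rw [uIcc_of_le hs.1]; exact Icc_subset_Icc_right hs.2
    have h1 : ∫ t in (0 : ℝ)..s, f' t = f s - f 0 :=
      intervalIntegral.integral_eq_sub_of_hasDerivAt (fun t ht => hf t (hsub ht))
        (hf'.mono hsub).intervalIntegrable
    have h2 : |∫ t in (0 : ℝ)..s, f' t| ≤ ∫ t in (0 : ℝ)..s, b t := by
      have hbs : IntervalIntegrable b volume 0 s := (hb.mono hsub).intervalIntegrable
      rw [← Real.norm_eq_abs]
      refine intervalIntegral.norm_integral_le_of_norm_le hs.1 ?_ hbs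
      refine Filter.Eventually.of_forall fun t ht => hfb t (hsub ?_)
      rw [uIcc_of_le hs.1]; exact Ioc_subset_Icc_self ht
    have h3 : ∫ t in (0 : ℝ)..s, b t ≤ ∫ t in (0 : ℝ)..L, b t := by
      refine intervalIntegral.integral_mono_interval le_rfl hs.1 hs.2 ?_ ib
      refine (ae_restrict_iff' measurableSet_Ioc).2 (Filter.Eventually.of_forall fun t ht => ?_)
      exact (abs_nonneg _).trans (hfb t (Ioc_subset_Icc_self ht))
    have h4 : |f 0| ≤ |f s| + |f s - f 0| := by
      have := abs_sub_abs_le_abs_sub (f 0) (f s)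
      rw [abs_sub_comm] at this
      linarith
    rw [h1] at h2
    linarith
  -- Integration over the other end point s replaces the value of f there by its average over [0,
  -- L].
  have h5 : ∫ _s in (0 : ℝ)..L, |f 0| ≤ ∫ s in (0 : ℝ)..L, (|f s| + ∫ t in (0 : ℝ)..L, b t) :=
    intervalIntegral.integral_mono_on (μ := volume) hL.le (_root_.intervalIntegrable_const)
      (ifa.add (_root_.intervalIntegrable_const)) h0
  rw [intervalIntegral.integral_add ifa intervalIntegrable_const] at h5
  simp only [intervalIntegral.integral_const, sub_zero, smul_eq_mul] at h5
  rw [intervalIntegral.integral_add (ifa.div_const L) ib, intervalIntegral.integral_div]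
  rw [div_add' _ _ _ hL.ne', le_div_iff₀ hL]
  linarith

/-- `D` is a union of pieces such that each point of the `j`-th piece is an end point of segments of
`D` in the directions `± e j i`, with parameter length `L`. -/
def SegmentCover {N : ℕ} (e : Fin N → Fin 3 → R3) (L : ℝ) (D : Set R3) : Prop :=
  ∃ A : Fin N → Set R3, (∀ j, MeasurableSet (A j)) ∧ D ⊆ ⋃ j, A j ∧
    ∀ j, ∀ x ∈ D, x ∈ A j → ∀ i,
      (∀ s ∈ Icc 0 L, x + s • e j i ∈ D) ∨ (∀ s ∈ Icc 0 L, x + s • (-e j i) ∈ D)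

/-- The averaged bound on a segment of D. The integrand is nonnegative, so extension by zero outside
D and integration over the full line only enlarge it; this is the form needed for Gagliardo's
inequality. -/
theorem le_lintegral_segment {D : Set R3} (hD : IsOpen D) {v : R3 → ℝ} (hv : ContDiffOn ℝ 1 v D)
    {L : ℝ} (hL : 0 < L) {x e : R3} {B : ℝ} (hB : ‖e‖ ≤ B) (h : ∀ s ∈ Icc 0 L, x + s • e ∈ D) :
    ENNReal.ofReal |v x| ≤ ∫⁻ t : ℝ, D.indicator
      (fun y => ENNReal.ofReal (|v y| / L + ‖fderiv ℝ v y‖ * B)) (x + t • e) := by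
  have hB0 : 0 ≤ B := (norm_nonneg e).trans hB
  have hline : ContinuousOn (fun s : ℝ => x + s • e) (Icc 0 L) := by fun_prop
  have hDv : ContinuousOn (fun s : ℝ => fderiv ℝ v (x + s • e)) (Icc 0 L) :=
    (hv.continuousOn_fderiv_of_isOpen hD le_rfl).comp hline h
  have hvc : ContinuousOn (fun s : ℝ => v (x + s • e)) (Icc 0 L) := hv.continuousOn.comp hline h
  have key := abs_le_integral_of_hasDerivAt (f := fun s => v (x + s • e))
    (f' := fun s => fderiv ℝ v (x + s • e) e) (b := fun s => ‖fderiv ℝ v (x + s • e)‖ * B) hL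
    (fun s hs => by
      have h1 : HasFDerivAt v (fderiv ℝ v (x + s • e)) (x + s • e) :=
        ((hv.differentiableOn one_ne_zero).differentiableAt (hD.mem_nhds (h s hs))).hasFDerivAt
      have h2 : HasDerivAt (fun s : ℝ => x + s • e) e s := by
        simpa using ((hasDerivAt_id s).smul_const e).const_add x
      exact h1.comp_hasDerivAt s h2)
    (hDv.clm_apply continuousOn_const) (hDv.norm.mul continuousOn_const)
    (fun s hs => by
      rw [← Real.norm_eq_abs]
      exact ((fderiv ℝ v (x + s • e)).le_opNorm e).trans (by gcongr))
  have hcont : ContinuousOn (fun s : ℝ => |v (x + s • e)| / L + ‖fderiv ℝ v (x + s • e)‖ * B)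
      (Icc 0 L) := (hvc.abs.div_const L).add (hDv.norm.mul continuousOn_const)
  have hnn : ∀ s : ℝ, 0 ≤ |v (x + s • e)| / L + ‖fderiv ℝ v (x + s • e)‖ * B := fun s => by positivity
  simp only [zero_smul, add_zero] at key
  calc ENNReal.ofReal |v x| ≤ _ := ENNReal.ofReal_le_ofReal key
    _ = ∫⁻ s in Ioc 0 L, ENNReal.ofReal (|v (x + s • e)| / L + ‖fderiv ℝ v (x + s • e)‖ * B) := by
        rw [intervalIntegral.integral_of_le hL.le, ofReal_integral_eq_lintegral_ofReal]
        · exact (hcont.integrableOn_Icc).mono_set Ioc_subset_Icc_self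
        · exact Filter.Eventually.of_forall hnn
    _ = ∫⁻ s in Ioc 0 L, D.indicator
          (fun y => ENNReal.ofReal (|v y| / L + ‖fderiv ℝ v y‖ * B)) (x + s • e) := by
        refine setLIntegral_congr_fun measurableSet_Ioc fun s hs => ?_
        rw [indicator_of_mem (h s (Ioc_subset_Icc_self hs))]
    _ ≤ _ := setLIntegral_le_lintegral _ _

theorem measurable_indicator_of_continuousOn {D : Set R3} (hD : IsOpen D) {G : R3 → ℝ≥0∞}
    (hG : ContinuousOn G D) : Measurable (D.indicator G) := by
  classical
  have : D.indicator G = D.piecewise G 0 := by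
    ext x; by_cases hx : x ∈ D <;> simp [hx]
  rw [this]
  exact hG.measurable_piecewise continuousOn_const hD.measurableSet

/-- The `W^{1,1} ⊂ L^{3/2}` inequality on a domain with the segment property. -/
theorem sobolev_one {N : ℕ} (e : Fin N → Fin 3 → R3) (he : ∀ j, LinearIndependent ℝ (e j)) :
    ∃ c : ℝ≥0, ∀ L > 0, ∀ D : Set R3, IsOpen D → SegmentCover e L D → ∀ v : R3 → ℝ,
      ContDiffOn ℝ 1 v D → ∫⁻ x in D, ENNReal.ofReal |v x| ^ (3 / 2 : ℝ) ≤
        c * (∫⁻ x in D, ENNReal.ofReal (|v x| / L + ‖fderiv ℝ v x‖)) ^ (3 / 2 : ℝ) := by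
  choose c hc using fun j => gagliardo_lines (e j) (he j)
  -- B ≥ 1 lets one factor B be taken out of both terms, |v|/L as well as B‖∇v‖.
  obtain ⟨B, hB1, hB⟩ : ∃ B : ℝ, 1 ≤ B ∧ ∀ j i, ‖e j i‖ ≤ B := by
    refine ⟨1 + ∑ j, ∑ i, ‖e j i‖, le_add_of_nonneg_right (by positivity), fun j i => ?_⟩
    have h1 := Finset.single_le_sum (f := fun i => ‖e j i‖) (fun i _ => norm_nonneg _)
      (Finset.mem_univ i)
    have h2 := Finset.single_le_sum (f := fun j => ∑ i, ‖e j i‖)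
      (fun j _ => Finset.sum_nonneg fun i _ => norm_nonneg _) (Finset.mem_univ j)
    linarith
  refine ⟨(∑ j, c j) * B.toNNReal ^ (3 / 2 : ℝ), fun L hL D hD hcov v hv => ?_⟩
  obtain ⟨A, hAm, hDA, hA⟩ := hcov
  set F : R3 → ℝ≥0∞ := D.indicator
    (fun y => ENNReal.ofReal (|v y| / L + ‖fderiv ℝ v y‖ * B)) with hF
  have hFm : Measurable F := by
    refine measurable_indicator_of_continuousOn hD (ENNReal.continuous_ofReal.comp_continuousOn ?_)
    exact (hv.continuousOn.abs.div_const L).add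
      ((hv.continuousOn_fderiv_of_isOpen hD le_rfl).norm.mul continuousOn_const)
  set h : Fin N → R3 → ℝ≥0∞ := fun j => (D ∩ A j).indicator fun x => ENNReal.ofReal |v x| with hh
  have hle : ∀ j x i, h j x ≤ ∫⁻ t : ℝ, F (x + t • e j i) := by
    intro j x i
    by_cases hx : x ∈ D ∩ A j
    · simp only [hh, indicator_of_mem hx]
      rcases hA j x hx.1 hx.2 i with hs | hs
      · exact le_lintegral_segment hD hv hL (hB j i) hs
      · refine (le_lintegral_segment hD hv hL (B := B) (by rw [norm_neg]; exact hB j i) hs).trans_eq ?_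
        -- The full line is the same for a direction and its opposite, so the sign chosen by the
        -- segment property does not matter.
        rw [← lintegral_neg_eq_self (fun t : ℝ => F (x + t • e j i))]
        simp [hF]
    · simp [hh, indicator_of_notMem hx]
  have hj : ∀ j, ∫⁻ x in D ∩ A j, ENNReal.ofReal |v x| ^ (3 / 2 : ℝ) ≤
      c j * (∫⁻ x, F x) ^ (3 / 2 : ℝ) := by
    intro j
    refine le_trans (le_of_eq ?_) (hc j F (h j) hFm (hle j))
    rw [← lintegral_indicator (hD.measurableSet.inter (hAm j))]
    congr 1 with x
    by_cases hx : x ∈ D ∩ A j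
    · simp [hh, indicator_of_mem hx]
    · simp [hh, indicator_of_notMem hx]
  have hFle : ∫⁻ x, F x ≤ ENNReal.ofReal B *
      ∫⁻ x in D, ENNReal.ofReal (|v x| / L + ‖fderiv ℝ v x‖) := by
    rw [hF, lintegral_indicator hD.measurableSet, ← lintegral_const_mul' _ _ ENNReal.ofReal_ne_top]
    refine lintegral_mono fun x => ?_
    rw [← ENNReal.ofReal_mul (by linarith)]
    refine ENNReal.ofReal_le_ofReal ?_
    have h1 : 0 ≤ |v x| / L := by positivity
    nlinarith
  calc ∫⁻ x in D, ENNReal.ofReal |v x| ^ (3 / 2 : ℝ)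
      ≤ ∫⁻ x in ⋃ j, D ∩ A j, ENNReal.ofReal |v x| ^ (3 / 2 : ℝ) := by
        refine lintegral_mono_set fun x hx => ?_
        obtain ⟨j, hj⟩ := mem_iUnion.1 (hDA hx)
        exact mem_iUnion.2 ⟨j, hx, hj⟩
    _ ≤ ∑ j, ∫⁻ x in D ∩ A j, ENNReal.ofReal |v x| ^ (3 / 2 : ℝ) := by
        refine (lintegral_iUnion_le _ _).trans_eq (tsum_fintype _)
    _ ≤ ∑ j, c j * (∫⁻ x, F x) ^ (3 / 2 : ℝ) := Finset.sum_le_sum fun j _ => hj j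
    _ = (∑ j, (c j : ℝ≥0∞)) * (∫⁻ x, F x) ^ (3 / 2 : ℝ) := by rw [Finset.sum_mul]
    _ ≤ (∑ j, (c j : ℝ≥0∞)) * (ENNReal.ofReal B *
          ∫⁻ x in D, ENNReal.ofReal (|v x| / L + ‖fderiv ℝ v x‖)) ^ (3 / 2 : ℝ) := by
        gcongr
    _ = _ := by
        rw [ENNReal.mul_rpow_of_nonneg _ _ (by norm_num), ← mul_assoc]
        congr 1
        push_cast
        rw [ENNReal.coe_rpow_of_nonneg _ (by norm_num)]
        rfl

/-- The L^{3/2} inequality for v⁴ has ∫v⁶ on the left and ∫|v|³(|v|/L + 4‖∇v‖) on the right. By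
Cauchy–Schwarz, with B = ∫v⁶ and G the energy, B ≤ c(32·B·G)^{3/4}. The fourth power of this is
divided by B³, which requires B to be finite; `sobolev_segmentCover` removes that assumption. -/
theorem sobolev_of_finite {N : ℕ} (e : Fin N → Fin 3 → R3) (he : ∀ j, LinearIndependent ℝ (e j)) :
    ∃ c : ℝ≥0, ∀ L > 0, ∀ D : Set R3, IsOpen D → SegmentCover e L D → ∀ v : R3 → ℝ,
      ContDiffOn ℝ 1 v D → ∫⁻ x in D, ENNReal.ofReal (v x ^ 6) < ∞ →
        ∫⁻ x in D, ENNReal.ofReal (v x ^ 6) ≤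
          c * (∫⁻ x in D, ENNReal.ofReal (‖fderiv ℝ v x‖ ^ 2 + v x ^ 2 / L ^ 2)) ^ 3 := by
  obtain ⟨c, hc⟩ := sobolev_one e he
  refine ⟨c ^ 4 * 32 ^ 3, fun L hL D hD hcov v hv hfin => ?_⟩
  have h1 := hc L hL D hD hcov (fun x => v x ^ 4) (hv.pow 4)
  set B := ∫⁻ x in D, ENNReal.ofReal (v x ^ 6) with hB
  set G := ∫⁻ x in D, ENNReal.ofReal (‖fderiv ℝ v x‖ ^ 2 + v x ^ 2 / L ^ 2) with hG
  have hDvc : ContinuousOn (fun x => ‖fderiv ℝ v x‖) D :=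
    (hv.continuousOn_fderiv_of_isOpen hD le_rfl).norm
  have e1 : ∫⁻ x in D, ENNReal.ofReal |v x ^ 4| ^ (3 / 2 : ℝ) = B := by
    refine lintegral_congr fun x => ?_
    rw [ENNReal.ofReal_rpow_of_nonneg (abs_nonneg _) (by norm_num)]
    congr 1
    have : |v x ^ 4| = |v x| ^ (4 : ℝ) := by rw [abs_pow]; norm_cast
    rw [this, ← Real.rpow_mul (abs_nonneg _)]
    have : (4 * (3 / 2) : ℝ) = (6 : ℕ) := by norm_num
    rw [this, Real.rpow_natCast, Even.pow_abs (by decide)]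
  have e2 : ∫⁻ x in D, ENNReal.ofReal (|v x ^ 4| / L + ‖fderiv ℝ (fun x => v x ^ 4) x‖) ≤
      B ^ (1 / 2 : ℝ) * (32 * G) ^ (1 / 2 : ℝ) := by
    have h2 : ∫⁻ x in D, ENNReal.ofReal (|v x ^ 4| / L + ‖fderiv ℝ (fun x => v x ^ 4) x‖) =
        ∫⁻ x in D, ((fun x => ENNReal.ofReal (|v x| ^ 3)) *
          fun x => ENNReal.ofReal (|v x| / L + 4 * ‖fderiv ℝ v x‖)) x := by
      refine setLIntegral_congr_fun hD.measurableSet fun x hx => ?_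
      have hd : DifferentiableAt ℝ v x :=
        (hv.differentiableOn one_ne_zero).differentiableAt (hD.mem_nhds hx)
      rw [Pi.mul_apply, ← ENNReal.ofReal_mul (by positivity)]
      congr 1
      rw [fderiv_fun_pow 4 hd, norm_smul, abs_pow]
      simp only [norm_mul, norm_pow, Real.norm_eq_abs, nsmul_eq_mul]
      norm_num
      ring
    rw [h2]
    refine (ENNReal.lintegral_mul_le_Lp_mul_Lq (p := 2) (q := 2) _ Real.HolderConjugate.two_two
      ?_ ?_).trans ?_
    · exact (ENNReal.continuous_ofReal.comp_continuousOn
        (hv.continuousOn.abs.pow 3)).aemeasurable hD.measurableSet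
    · exact (ENNReal.continuous_ofReal.comp_continuousOn ((hv.continuousOn.abs.div_const L).add
        (continuousOn_const.mul hDvc))).aemeasurable hD.measurableSet
    · gcongr
      · refine lintegral_mono fun x => ?_
        rw [ENNReal.ofReal_rpow_of_nonneg (by positivity) (by norm_num)]
        refine ENNReal.ofReal_le_ofReal (le_of_eq ?_)
        rw [Real.rpow_two, ← pow_mul, Even.pow_abs (by decide)]
      · rw [hG, ← lintegral_const_mul' _ _ (by norm_num)]
        refine lintegral_mono fun x => ?_
        simp only
        rw [ENNReal.ofReal_rpow_of_nonneg (by positivity) (by norm_num),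
          show (32 : ℝ≥0∞) = ENNReal.ofReal 32 by norm_num, ← ENNReal.ofReal_mul (by norm_num)]
        refine ENNReal.ofReal_le_ofReal ?_
        rw [Real.rpow_two, ← div_pow, ← sq_abs (v x / L), abs_div, abs_of_pos hL]
        nlinarith [sq_nonneg (4 * (|v x| / L) - ‖fderiv ℝ v x‖), sq_nonneg (|v x| / L)]
  rw [e1] at h1
  rcases eq_or_ne B 0 with h0 | h0
  · rw [h0]; exact zero_le
  have h3 : B ≤ c * (B ^ (1 / 2 : ℝ) * (32 * G) ^ (1 / 2 : ℝ)) ^ (3 / 2 : ℝ) :=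
    h1.trans (by gcongr)
  -- The fourth power clears the exponent 3/4 and prepares the cancellation of B³.
  have h4 : B ^ 3 * B ≤ B ^ 3 * ((c ^ 4 * 32 ^ 3) * G ^ 3) := by
    calc B ^ 3 * B = B ^ 4 := by ring
      _ ≤ (c * (B ^ (1 / 2 : ℝ) * (32 * G) ^ (1 / 2 : ℝ)) ^ (3 / 2 : ℝ)) ^ 4 := by gcongr
      _ = c ^ 4 * (B * (32 * G)) ^ 3 := by
          rw [mul_pow, ← ENNReal.mul_rpow_of_nonneg _ _ (by norm_num), ← ENNReal.rpow_mul,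
            ← ENNReal.rpow_mul_natCast]
          norm_num
      _ = _ := by ring
  have h5 : B ≤ (c ^ 4 * 32 ^ 3) * G ^ 3 :=
    (ENNReal.mul_le_mul_iff_right (pow_ne_zero 3 h0) (ENNReal.pow_ne_top hfin.ne)).1 h4
  exact_mod_cast h5

/-- The Sobolev inequality `H¹ ⊂ L⁶` on a three-dimensional domain with the segment property, with
its dependence on the length scale. -/
theorem sobolev_segmentCover {N : ℕ} (e : Fin N → Fin 3 → R3)
    (he : ∀ j, LinearIndependent ℝ (e j)) :
    ∃ c : ℝ≥0, ∀ L > 0, ∀ D : Set R3, IsOpen D → SegmentCover e L D → ∀ v : R3 → ℝ,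
      ContDiffOn ℝ 1 v D → (∫⁻ x in D, ENNReal.ofReal (v x ^ 6)) ^ (1 / 3 : ℝ) ≤
        c * ((∫⁻ x in D, ENNReal.ofReal (‖fderiv ℝ v x‖ ^ 2)) +
          ENNReal.ofReal (1 / L ^ 2) * ∫⁻ x in D, ENNReal.ofReal (v x ^ 2)) := by
  obtain ⟨c, hc⟩ := sobolev_of_finite e he
  -- The summand 1 keeps the constant nonzero, so that the right side is infinite when v is not in
  -- L².
  refine ⟨c ^ (1 / 3 : ℝ) + 1, fun L hL D hD hcov v hv => ?_⟩
  have hL2 : ENNReal.ofReal (1 / L ^ 2) ≠ 0 := by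
    rw [Ne, ENNReal.ofReal_eq_zero, not_le]; positivity
  rcases eq_or_ne (∫⁻ x in D, ENNReal.ofReal (v x ^ 2)) ∞ with htop | htop
  · rw [htop, ENNReal.mul_top hL2, add_top, ENNReal.mul_top (by simp)]
    exact le_top
  set G := ∫⁻ x in D, ENNReal.ofReal (‖fderiv ℝ v x‖ ^ 2 + v x ^ 2 / L ^ 2) with hG
  have hGeq : G = (∫⁻ x in D, ENNReal.ofReal (‖fderiv ℝ v x‖ ^ 2)) +
      ENNReal.ofReal (1 / L ^ 2) * ∫⁻ x in D, ENNReal.ofReal (v x ^ 2) := by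
    rw [← lintegral_const_mul' _ _ ENNReal.ofReal_ne_top, hG, ← lintegral_add_left']
    · refine lintegral_congr fun x => ?_
      rw [← ENNReal.ofReal_mul (by positivity), ← ENNReal.ofReal_add (by positivity) (by positivity)]
      congr 2; ring
    · exact (ENNReal.continuous_ofReal.comp_continuousOn
        ((hv.continuousOn_fderiv_of_isOpen hD le_rfl).norm.pow 2)).aemeasurable hD.measurableSet
  -- A C¹ truncation: t/(1 + εt²) is bounded, is at most |t| in absolute value and has slope at most
  -- 1. So w n is bounded and in L², hence in L⁶, with no more energy than v; it tends to v as ε →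
  -- 0, and Fatou's lemma applies.
  let w : ℕ → R3 → ℝ := fun n x => v x / (1 + (1 / ((n : ℝ) + 1)) * v x ^ 2)
  have hpos : ∀ (n : ℕ) x, 0 < 1 + (1 / ((n : ℝ) + 1)) * v x ^ 2 := fun n x => by positivity
  have hw : ∀ n, ContDiffOn ℝ 1 (w n) D := fun n =>
    hv.div (contDiffOn_const.add (contDiffOn_const.mul (hv.pow 2))) fun x _ => (hpos n x).ne'
  have hwle : ∀ n x, w n x ^ 2 ≤ v x ^ 2 := by
    intro n x
    simp only [w, div_pow]
    apply div_le_self (sq_nonneg _)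
    have : 0 ≤ (1 / ((n : ℝ) + 1)) * v x ^ 2 := by positivity
    nlinarith
  have hwn : ∀ (n : ℕ) x, w n x ^ 2 ≤ (n : ℝ) + 1 := by
    intro n x
    have hn : (0 : ℝ) < (n : ℝ) + 1 := by positivity
    simp only [w, div_pow]
    rw [div_le_iff₀ (by positivity)]
    have h1 : v x ^ 2 = ((n : ℝ) + 1) * ((1 / ((n : ℝ) + 1)) * v x ^ 2) := by field_simp
    set t := (1 / ((n : ℝ) + 1)) * v x ^ 2
    have ht : 0 ≤ t := by positivity
    rw [h1]
    gcongr
    nlinarith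
  have hDw : ∀ n, ∀ x ∈ D, ‖fderiv ℝ (w n) x‖ ≤ ‖fderiv ℝ v x‖ := by
    intro n x hx
    have hd : HasFDerivAt v (fderiv ℝ v x) x :=
      ((hv.differentiableOn one_ne_zero).differentiableAt (hD.mem_nhds hx)).hasFDerivAt
    set ε : ℝ := 1 / ((n : ℝ) + 1) with hε
    have hε0 : 0 ≤ ε := by positivity
    have hp := hpos n x
    have h1 : HasDerivAt (fun t : ℝ => t / (1 + ε * t ^ 2))
        ((1 * (1 + ε * v x ^ 2) - v x * (ε * (2 * v x))) / (1 + ε * v x ^ 2) ^ 2) (v x) := by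
      refine (hasDerivAt_id (v x)).div ?_ hp.ne'
      simpa using (((hasDerivAt_id (v x)).pow 2).const_mul ε).const_add 1
    have h2 : HasFDerivAt (w n) _ x := h1.comp_hasFDerivAt x hd
    rw [h2.fderiv, norm_smul]
    refine mul_le_of_le_one_left (norm_nonneg _) ?_
    rw [Real.norm_eq_abs, abs_div, abs_of_pos (pow_pos hp 2), div_le_one (pow_pos hp 2), abs_le]
    have : 0 ≤ ε * v x ^ 2 := by positivity
    constructor <;> nlinarith
  have hbound : ∀ n, ∫⁻ x in D, ENNReal.ofReal (w n x ^ 6) ≤ c * G ^ 3 := by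
    intro n
    have hfin : ∫⁻ x in D, ENNReal.ofReal (w n x ^ 6) < ∞ := by
      calc ∫⁻ x in D, ENNReal.ofReal (w n x ^ 6)
          ≤ ∫⁻ x in D, ENNReal.ofReal (((n : ℝ) + 1) ^ 2) * ENNReal.ofReal (v x ^ 2) := by
            refine lintegral_mono fun x => ?_
            rw [← ENNReal.ofReal_mul (by positivity)]
            refine ENNReal.ofReal_le_ofReal ?_
            calc w n x ^ 6 = (w n x ^ 2) ^ 2 * w n x ^ 2 := by ring
              _ ≤ _ := mul_le_mul (pow_le_pow_left₀ (sq_nonneg _) (hwn n x) 2) (hwle n x)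
                  (sq_nonneg _) (by positivity)
        _ < ∞ := by
            rw [lintegral_const_mul' _ _ ENNReal.ofReal_ne_top]
            exact ENNReal.mul_lt_top ENNReal.ofReal_lt_top (lt_top_iff_ne_top.2 htop)
    refine (hc L hL D hD hcov (w n) (hw n) hfin).trans ?_
    gcongr
    refine setLIntegral_mono' hD.measurableSet fun x hx => ENNReal.ofReal_le_ofReal ?_
    exact add_le_add (pow_le_pow_left₀ (norm_nonneg _) (hDw n x hx) 2)
      (div_le_div_of_nonneg_right (hwle n x) (by positivity))
  have hlim : ∫⁻ x in D, ENNReal.ofReal (v x ^ 6) ≤ c * G ^ 3 := by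
    calc ∫⁻ x in D, ENNReal.ofReal (v x ^ 6)
        = ∫⁻ x in D, liminf (fun n => ENNReal.ofReal (w n x ^ 6)) atTop := by
          refine lintegral_congr fun x => (Tendsto.liminf_eq ?_).symm
          refine (ENNReal.continuous_ofReal.tendsto _).comp (Tendsto.pow ?_ 6)
          have h1 : Tendsto (fun n : ℕ => 1 + (1 / ((n : ℝ) + 1)) * v x ^ 2) atTop (𝓝 (1 + 0 * v x ^ 2)) :=
            (tendsto_one_div_add_atTop_nhds_zero_nat.mul_const _).const_add 1
          have h2 := (tendsto_const_nhds (x := v x)).div h1 (by simp)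
          rw [zero_mul, add_zero, div_one] at h2
          exact h2
      _ ≤ liminf (fun n => ∫⁻ x in D, ENNReal.ofReal (w n x ^ 6)) atTop :=
          lintegral_liminf_le' fun n => ContinuousOn.aemeasurable
            (ENNReal.continuous_ofReal.comp_continuousOn ((hw n).continuousOn.pow 6))
            hD.measurableSet
      _ ≤ c * G ^ 3 := by
          refine liminf_le_of_le (by isBoundedDefault) fun b hb => ?_
          obtain ⟨n, hn⟩ := hb.exists
          exact hn.trans (hbound n)
  rw [← hGeq]
  calc (∫⁻ x in D, ENNReal.ofReal (v x ^ 6)) ^ (1 / 3 : ℝ) ≤ (c * G ^ 3) ^ (1 / 3 : ℝ) := by gcongr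
    _ = (c : ℝ≥0∞) ^ (1 / 3 : ℝ) * G := by
        rw [ENNReal.mul_rpow_of_nonneg _ _ (by norm_num), ← ENNReal.rpow_natCast, ← ENNReal.rpow_mul]
        norm_num
    _ ≤ _ := by
        gcongr
        rw [ENNReal.coe_add, ENNReal.coe_rpow_of_nonneg _ (by norm_num)]
        exact le_self_add

/-! ### The measure of a hypersurface in charts -/

/-- The image under `φ` of the volume of `V` for the metric induced by `-g`. -/
noncomputable def chartMeasure (g : BilinField) (V : Set R3) (φ : R3 → R4) : Measure R4 :=
  Measure.map φ ((volume.restrict V).withDensity fun y => ENNReal.ofReal (volDensity g φ y))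

/-- `φ : V → S ∩ O` is a `C¹` parametrisation of the open piece `S ∩ O` of `S`, whose inverse is the
restriction of a `C¹` map `π` defined on `O`. -/
structure IsChart (S O : Set R4) (V : Set R3) (φ : R3 → R4) (π : R4 → R3) : Prop where
  isOpen_source : IsOpen O
  isOpen_target : IsOpen V
  contDiffOn_param : ContDiffOn ℝ 1 φ V
  contDiffOn_proj : ContDiffOn ℝ 1 π O
  mapsTo_param : MapsTo φ V (S ∩ O)
  mapsTo_proj : MapsTo π (S ∩ O) V
  proj_param : ∀ y ∈ V, π (φ y) = y
  param_proj : ∀ x ∈ S ∩ O, φ (π x) = x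

theorem IsChart.isLocalParam {S O : Set R4} {V : Set R3} {φ : R3 → R4} {π : R4 → R3}
    (h : IsChart S O V φ π) : IsLocalParam S V φ := by
  refine ⟨h.isOpen_target, h.contDiffOn_param, fun y hy y' hy' heq => ?_, fun y hy => ?_,
    fun y hy => (h.mapsTo_param hy).1⟩
  · rw [← h.proj_param y hy, heq, h.proj_param y' hy']
  · have h1 : HasFDerivAt φ (fderiv ℝ φ y) y :=
      ((h.contDiffOn_param.differentiableOn one_ne_zero).differentiableAt
        (h.isOpen_target.mem_nhds hy)).hasFDerivAt
    have h2 : HasFDerivAt π (fderiv ℝ π (φ y)) (φ y) :=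
      ((h.contDiffOn_proj.differentiableOn one_ne_zero).differentiableAt
        (h.isOpen_source.mem_nhds (h.mapsTo_param hy).2)).hasFDerivAt
    have h3 : HasFDerivAt id ((fderiv ℝ π (φ y)).comp (fderiv ℝ φ y)) y := by
      refine (h2.comp y h1).congr_of_eventuallyEq ?_
      filter_upwards [h.isOpen_target.mem_nhds hy] with z hz
      exact (h.proj_param z hz).symm
    have h4 := h3.unique (hasFDerivAt_id y)
    intro v w hvw
    have : ∀ v, fderiv ℝ π (φ y) (fderiv ℝ φ y v) = v := fun v => by
      simpa using DFunLike.congr_fun h4 v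
    rw [← this v, hvw, this w]

theorem continuousOn_volDensity {U : Set R4} {g : BilinField} (hg : ContinuousOn g U) {S : Set R4}
    (hS : S ⊆ U) {V : Set R3} {φ : R3 → R4} (h : IsLocalParam S V φ) :
    ContinuousOn (volDensity g φ) V := by
  obtain ⟨hV, hφ, -, -, hm⟩ := h
  have h1 : ContinuousOn (fun y => g (φ y)) V :=
    hg.comp hφ.continuousOn fun y hy => hS (hm hy)
  have h2 : ContinuousOn (fderiv ℝ φ) V := hφ.continuousOn_fderiv_of_isOpen hV le_rfl
  unfold volDensity
  refine Real.continuous_sqrt.comp_continuousOn ?_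
  have h3 : ContinuousOn (fun y => (Matrix.of fun i j : Fin 3 =>
    -(g (φ y) (fderiv ℝ φ y (EuclideanSpace.single i 1))
      (fderiv ℝ φ y (EuclideanSpace.single j 1))))) V := by
    refine continuousOn_pi.2 fun i => continuousOn_pi.2 fun j => ?_
    exact ((h1.clm_apply (h2.clm_apply continuousOn_const)).clm_apply
      (h2.clm_apply continuousOn_const)).neg
  exact (Continuous.matrix_det continuous_id).comp_continuousOn h3

/-- An injective continuous map on a Polish space is a measurable embedding (Lusin–Souslin), so the
formula holds for every f and later applications need no measurability of the integrand. -/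
theorem lintegral_map_of_injOn {V : Set R3} (hV : IsOpen V) {φ : R3 → R4} (hφ : ContinuousOn φ V)
    (hinj : InjOn φ V) {ν : Measure R3} (hν : ν.restrict V = ν) (f : R4 → ℝ≥0∞) :
    ∫⁻ x, f x ∂(Measure.map φ ν) = ∫⁻ y, f (φ y) ∂ν := by
  have hval : MeasurableEmbedding ((↑) : V → R3) := MeasurableEmbedding.subtype_coe hV.measurableSet
  have hmap : Measure.map ((↑) : V → R3) (Measure.comap (↑) ν) = ν := by
    rw [map_comap_subtype_coe hV.measurableSet, hν]
  have hae : AEMeasurable φ ν := by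
    rw [← hν]; exact hφ.aemeasurable hV.measurableSet
  have : PolishSpace V := hV.polishSpace
  have hemb : MeasurableEmbedding (fun y : V => φ y) :=
    Continuous.measurableEmbedding (continuousOn_iff_continuous_domRestrict.1 hφ)
      fun a b hab => Subtype.ext (hinj a.2 b.2 hab)
  have h1 : Measure.map φ ν = Measure.map (fun y : V => φ y) (Measure.comap (↑) ν) := by
    conv_lhs => rw [← hmap]
    rw [AEMeasurable.map_map_of_aemeasurable (by rwa [hmap]) hval.measurable.aemeasurable]
    rfl
  rw [h1, hemb.lintegral_map]
  conv_rhs => rw [← hmap, hval.lintegral_map]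

theorem lintegral_chartMeasure {U : Set R4} {g : BilinField} (hg : ContinuousOn g U) {S : Set R4}
    (hS : S ⊆ U) {V : Set R3} {φ : R3 → R4} (h : IsLocalParam S V φ) (f : R4 → ℝ≥0∞) :
    ∫⁻ x, f x ∂(chartMeasure g V φ) =
      ∫⁻ y in V, ENNReal.ofReal (volDensity g φ y) * f (φ y) := by
  have hρ : AEMeasurable (fun y => ENNReal.ofReal (volDensity g φ y)) (volume.restrict V) :=
    (ENNReal.continuous_ofReal.comp_continuousOn
      (continuousOn_volDensity hg hS h)).aemeasurable h.1.measurableSet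
  rw [chartMeasure, lintegral_map_of_injOn h.1 h.2.1.continuousOn h.2.2.1,
    lintegral_withDensity_eq_lintegral_mul_non_measurable₀ _ hρ
      (Filter.Eventually.of_forall fun _ => ENNReal.ofReal_lt_top)]
  · rfl
  · rw [restrict_withDensity h.1.measurableSet, Measure.restrict_restrict h.1.measurableSet,
      inter_self]

/-- The bilinear form induced by `-b` through a linear map. -/
noncomputable def pullbackForm (b : R4 →L[ℝ] R4 →L[ℝ] ℝ) (A : R3 →L[ℝ] R4) :
    LinearMap.BilinForm ℝ R3 :=
  LinearMap.mk₂ ℝ (fun v w => -(b (A v) (A w))) (by intros; simp; ring) (by intros; simp)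
    (by intros; simp; ring) (by intros; simp)

theorem volDensity_eq (g : BilinField) (φ : R3 → R4) (y : R3) :
    volDensity g φ y = Real.sqrt (LinearMap.BilinForm.toMatrix
      (EuclideanSpace.basisFun (Fin 3) ℝ).toBasis (pullbackForm (g (φ y)) (fderiv ℝ φ y))).det := by
  unfold volDensity
  congr 2

/-- Under a change of parameters the Gram matrix G becomes PᵀGP, so the square root of its
determinant picks up |det P|. -/
theorem volDensity_transition {g : BilinField} {φ φ' : R3 → R4} {h : R3 → R3} {y : R3}
    {h' : R3 →L[ℝ] R3} (hy : φ (h y) = φ' y)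
    (hd : fderiv ℝ φ' y = (fderiv ℝ φ (h y)).comp h') :
    volDensity g φ' y = |h'.det| * volDensity g φ (h y) := by
  rw [volDensity_eq, volDensity_eq, hy, hd]
  set b := (EuclideanSpace.basisFun (Fin 3) ℝ).toBasis
  have h1 : pullbackForm (g (φ' y)) ((fderiv ℝ φ (h y)).comp h') =
      (pullbackForm (g (φ' y)) (fderiv ℝ φ (h y))).comp (h' : R3 →ₗ[ℝ] R3) (h' : R3 →ₗ[ℝ] R3) := by
    ext v w; rfl
  rw [h1, LinearMap.BilinForm.toMatrix_comp b b, Matrix.det_mul, Matrix.det_mul,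
    Matrix.det_transpose, LinearMap.det_toMatrix]
  have h2 : ∀ d D : ℝ, d * D * d = d ^ 2 * D := fun d D => by ring
  rw [h2, Real.sqrt_mul (sq_nonneg _), Real.sqrt_sq_eq_abs]

/-- Change of variables along the transition map π ∘ φ'. It is C¹ because π is defined and C¹ on an
open set of ℝ⁴, and injective because φ' is. -/
theorem setLIntegral_chartMeasure_le {U : Set R4} {g : BilinField} (hg : ContinuousOn g U)
    {S : Set R4} (hS : S ⊆ U) {O : Set R4} {V V' : Set R3} {φ φ' : R3 → R4} {π : R4 → R3}
    (h : IsChart S O V φ π) (h' : IsLocalParam S V' φ') (f : R4 → ℝ≥0∞) :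
    ∫⁻ x, (S ∩ O).indicator f x ∂(chartMeasure g V' φ') ≤ ∫⁻ x, f x ∂(chartMeasure g V φ) := by
  rw [lintegral_chartMeasure hg hS h', lintegral_chartMeasure hg hS h.isLocalParam]
  obtain ⟨hV', hφ', hinj', -, hm'⟩ := h'
  set W := V' ∩ φ' ⁻¹' O with hW
  have hWo : IsOpen W := hφ'.continuousOn.isOpen_inter_preimage hV' h.isOpen_source
  have hSO : ∀ y ∈ W, φ' y ∈ S ∩ O := fun y hy => ⟨hm' hy.1, hy.2⟩
  let k : R3 → R3 := fun y => π (φ' y)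
  have hk : ∀ y ∈ W, HasFDerivAt k ((fderiv ℝ π (φ' y)).comp (fderiv ℝ φ' y)) y := fun y hy =>
    (((h.contDiffOn_proj.differentiableOn one_ne_zero).differentiableAt
      (h.isOpen_source.mem_nhds hy.2)).hasFDerivAt).comp y
      (((hφ'.differentiableOn one_ne_zero).differentiableAt (hV'.mem_nhds hy.1)).hasFDerivAt)
  have hφk : ∀ y ∈ W, φ (k y) = φ' y := fun y hy => h.param_proj _ (hSO y hy)
  have hkV : ∀ y ∈ W, k y ∈ V := fun y hy => h.mapsTo_proj (hSO y hy)
  have hkinj : InjOn k W := fun y hy z hz hyz => by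
    apply hinj' hy.1 hz.1
    rw [← hφk y hy, hyz, hφk z hz]
  have hvd : ∀ y ∈ W, volDensity g φ' y =
      |((fderiv ℝ π (φ' y)).comp (fderiv ℝ φ' y)).det| * volDensity g φ (k y) := by
    intro y hy
    refine volDensity_transition (hφk y hy) ?_
    have h1 : HasFDerivAt φ (fderiv ℝ φ (k y)) (k y) :=
      ((h.contDiffOn_param.differentiableOn one_ne_zero).differentiableAt
        (h.isOpen_target.mem_nhds (hkV y hy))).hasFDerivAt
    have h2 := h1.comp y (hk y hy)
    refine HasFDerivAt.fderiv (h2.congr_of_eventuallyEq ?_)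
    filter_upwards [hWo.mem_nhds hy] with z hz
    exact (hφk z hz).symm
  calc ∫⁻ y in V', ENNReal.ofReal (volDensity g φ' y) * (S ∩ O).indicator f (φ' y)
      = ∫⁻ y in W, ENNReal.ofReal (volDensity g φ' y) * f (φ' y) := by
        rw [← lintegral_indicator hV'.measurableSet, ← lintegral_indicator hWo.measurableSet]
        refine lintegral_congr fun y => ?_
        by_cases hy : y ∈ W
        · rw [indicator_of_mem hy, indicator_of_mem hy.1, indicator_of_mem (hSO y hy)]
        · rw [indicator_of_notMem hy]
          by_cases hy1 : y ∈ V'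
          · rw [indicator_of_mem hy1, indicator_of_notMem (fun hc => hy ⟨hy1, hc.2⟩), mul_zero]
          · rw [indicator_of_notMem hy1]
    _ = ∫⁻ y in W, ENNReal.ofReal |((fderiv ℝ π (φ' y)).comp (fderiv ℝ φ' y)).det| *
          (ENNReal.ofReal (volDensity g φ (k y)) * f (φ (k y))) := by
        refine setLIntegral_congr_fun hWo.measurableSet fun y hy => ?_
        simp only
        rw [hvd y hy, hφk y hy, ENNReal.ofReal_mul (abs_nonneg _), mul_assoc]
    _ = ∫⁻ z in k '' W, ENNReal.ofReal (volDensity g φ z) * f (φ z) :=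
        (lintegral_image_eq_lintegral_abs_det_fderiv_mul volume hWo.measurableSet
          (fun y hy => (hk y hy).hasFDerivWithinAt) hkinj
          (fun z => ENNReal.ofReal (volDensity g φ z) * f (φ z))).symm
    _ ≤ _ := lintegral_mono_set (image_subset_iff.2 hkV)

/-- A supremum of measures is controlled through its upper bounds. The measure equal to ν plus
infinite mass off B dominates all chart measures, hence the supremum, and its restriction to B is at
most ν. -/
theorem surfMeasure_restrict_le {g : BilinField} {S B : Set R4} (hB : MeasurableSet B)
    {ν : Measure R4}
    (h : ∀ V φ, IsLocalParam S V φ → (chartMeasure g V φ).restrict B ≤ ν) :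
    (surfMeasure g S).restrict B ≤ ν := by
  have h1 : surfMeasure g S ≤ ν + (⊤ : Measure R4).restrict Bᶜ := by
    refine iSup_le fun P => ?_
    change chartMeasure g P.1.1 P.1.2 ≤ _
    rw [← Measure.restrict_add_restrict_compl (μ := chartMeasure g P.1.1 P.1.2) hB]
    exact add_le_add (h _ _ P.2) (Measure.restrict_mono le_rfl le_top)
  refine (Measure.restrict_mono le_rfl h1).trans ?_
  rw [Measure.restrict_add, Measure.restrict_restrict hB, inter_compl_self, Measure.restrict_empty,
    add_zero]
  exact Measure.restrict_le_self

theorem chartMeasure_le_surfMeasure (g : BilinField) {S : Set R4} {V : Set R3} {φ : R3 → R4}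
    (h : IsLocalParam S V φ) : chartMeasure g V φ ≤ surfMeasure g S :=
  le_iSup (fun P : {P : Set R3 × (R3 → R4) // IsLocalParam S P.1 P.2} =>
    chartMeasure g P.1.1 P.1.2) ⟨(V, φ), h⟩

theorem IsChart.measurableSet {S O : Set R4} {V : Set R3} {φ : R3 → R4} {π : R4 → R3}
    (h : IsChart S O V φ π) : MeasurableSet (S ∩ O) := by
  have : S ∩ O = φ '' V := by
    refine subset_antisymm (fun x hx => ⟨π x, h.mapsTo_proj hx, h.param_proj x hx⟩) ?_
    exact image_subset_iff.2 h.mapsTo_param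
  rw [this]
  exact h.isOpen_target.measurableSet.image_of_continuousOn_injOn h.contDiffOn_param.continuousOn
    h.isLocalParam.2.2.1

/-- With `chartMeasure_le_surfMeasure`, a single chart computes the surface measure on its domain,
although that measure is a supremum over all parametrisations. -/
theorem surfMeasure_restrict_chart_le {U : Set R4} {g : BilinField} (hg : ContinuousOn g U)
    {S : Set R4} (hS : S ⊆ U) {O : Set R4} {V : Set R3} {φ : R3 → R4} {π : R4 → R3}
    (h : IsChart S O V φ π) : (surfMeasure g S).restrict (S ∩ O) ≤ chartMeasure g V φ := by
  refine surfMeasure_restrict_le h.measurableSet fun V' φ' h' => Measure.le_iff.2 fun A hA => ?_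
  have := setLIntegral_chartMeasure_le hg hS h h' (A.indicator 1)
  rw [lintegral_indicator_one hA, lintegral_indicator h.measurableSet,
    lintegral_indicator_one hA] at this
  exact this

theorem surfMeasure_compl {g : BilinField} {S : Set R4} (hS : MeasurableSet S) :
    surfMeasure g S Sᶜ = 0 := by
  rw [← Measure.restrict_eq_zero]
  refine le_antisymm (surfMeasure_restrict_le hS.compl fun V φ h => ?_) (Measure.zero_le _)
  refine le_of_eq (Measure.restrict_eq_zero.2 ?_)
  have hae : AEMeasurable φ ((volume.restrict V).withDensity
      fun y => ENNReal.ofReal (volDensity g φ y)) :=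
    (h.2.1.continuousOn.aemeasurable h.1.measurableSet).mono_ac (withDensity_absolutelyContinuous _ _)
  rw [chartMeasure, Measure.map_apply_of_aemeasurable hae hS.compl]
  refine withDensity_absolutelyContinuous _ _ ?_
  refine measure_mono_null (t := Vᶜ) (fun y hy hyV => hy (h.2.2.2.2 hyV)) ?_
  rw [Measure.restrict_apply h.1.measurableSet.compl, compl_inter_self, measure_empty]

/-! ### Transfer of the Euclidean inequality to a chart -/

/-- The bounds hold for each eigenvalue, by evaluation on unit eigenvectors, and the determinant is
the product of the three eigenvalues. -/
theorem det_mem_Icc_of_quadratic_bounds {G : Matrix (Fin 3) (Fin 3) ℝ} (hG : G.IsHermitian)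
    {m M : ℝ} (hm : 0 ≤ m) (h : ∀ v : R3, m * ‖v‖ ^ 2 ≤ v.ofLp ⬝ᵥ G.mulVec v.ofLp ∧
      v.ofLp ⬝ᵥ G.mulVec v.ofLp ≤ M * ‖v‖ ^ 2) : m ^ 3 ≤ G.det ∧ G.det ≤ M ^ 3 := by
  have he : ∀ i, m ≤ hG.eigenvalues i ∧ hG.eigenvalues i ≤ M := by
    intro i
    have h1 := h (hG.eigenvectorBasis i)
    have h2 : ‖hG.eigenvectorBasis i‖ = 1 := hG.eigenvectorBasis.orthonormal.1 i
    have h3 := hG.eigenvalues_eq i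
    rw [h2] at h1
    simp only [one_pow, mul_one, star_trivial, RCLike.re_to_real] at h1 h3
    rw [h3]
    exact h1
  have hdet : G.det = ∏ i, hG.eigenvalues i := by
    simpa using hG.det_eq_prod_eigenvalues
  rw [hdet]
  constructor
  · calc m ^ 3 = ∏ _i : Fin 3, m := by simp
      _ ≤ _ := Finset.prod_le_prod (fun _ _ => hm) fun i _ => (he i).1
  · calc _ ≤ ∏ _i : Fin 3, M :=
        Finset.prod_le_prod (fun i _ => hm.trans (he i).1) fun i _ => (he i).2
      _ = M ^ 3 := by simp

theorem volDensity_bounds {g : BilinField} {φ : R3 → R4} {y : R3}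
    (hsymm : ∀ v w, g (φ y) v w = g (φ y) w v) {m M : ℝ} (hm : 0 ≤ m)
    (h : ∀ v, m * ‖v‖ ^ 2 ≤ -(g (φ y) (fderiv ℝ φ y v) (fderiv ℝ φ y v)) ∧
      -(g (φ y) (fderiv ℝ φ y v) (fderiv ℝ φ y v)) ≤ M * ‖v‖ ^ 2) :
    Real.sqrt (m ^ 3) ≤ volDensity g φ y ∧ volDensity g φ y ≤ Real.sqrt (M ^ 3) := by
  rw [volDensity_eq]
  set b := (EuclideanSpace.basisFun (Fin 3) ℝ).toBasis with hb
  set B := pullbackForm (g (φ y)) (fderiv ℝ φ y) with hB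
  have hBv : ∀ v w, B v w = -(g (φ y) (fderiv ℝ φ y v) (fderiv ℝ φ y w)) := fun v w => rfl
  have hq : ∀ v : R3, v.ofLp ⬝ᵥ (LinearMap.BilinForm.toMatrix b B).mulVec v.ofLp = B v v := by
    intro v
    rw [LinearMap.BilinForm.apply_eq_dotProduct_toMatrix_mulVec b B v v]
    congr 1
  have hH : (LinearMap.BilinForm.toMatrix b B).IsHermitian := by
    ext i j
    simp only [Matrix.conjTranspose_apply, LinearMap.BilinForm.toMatrix_apply, star_trivial, hBv]
    rw [hsymm]
  have := det_mem_Icc_of_quadratic_bounds hH hm (M := M) fun v => by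
    rw [hq, hBv]; exact h v
  exact ⟨Real.sqrt_le_sqrt this.1, Real.sqrt_le_sqrt this.2⟩

/-- Cauchy-Schwarz for a symmetric bilinear form that is nonnegative on a subspace. -/
theorem sq_bilin_le {b : R4 →L[ℝ] R4 →L[ℝ] ℝ} (hsymm : ∀ v w, b v w = b w v) {α : R4 →L[ℝ] ℝ}
    (h : ∀ v, α v = 0 → 0 ≤ -(b v v)) {Y Z : R4} (hY : α Y = 0) (hZ : α Z = 0) :
    (-(b Y Z)) ^ 2 ≤ -(b Y Y) * -(b Z Z) := by
  have h1 : ∀ t : ℝ, 0 ≤ -(b Z Z) * (t * t) + 2 * -(b Y Z) * t + -(b Y Y) := by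
    intro t
    have := h (Y + t • Z) (by simp [hY, hZ])
    simp only [map_add, map_smul, add_apply, smul_apply,
      smul_eq_mul, hsymm Z Y] at this
    linarith
  have := discrim_le_zero h1
  unfold discrim at this
  linarith

/-- Y represents β on ker α, so Cauchy–Schwarz for -b on ker α bounds β(Av) by the lengths of Y and
Av. This compares the Euclidean gradient in a parametrisation with the Riemannian one. -/
theorem norm_fderiv_comp_sq_le {b : R4 →L[ℝ] R4 →L[ℝ] ℝ} (hsymm : ∀ v w, b v w = b w v)
    {α : R4 →L[ℝ] ℝ} (h : ∀ v, α v = 0 → 0 ≤ -(b v v)) {A : R3 →L[ℝ] R4} (hA : ∀ v, α (A v) = 0)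
    {M : ℝ} (hM : 0 ≤ M) (hAM : ∀ v, -(b (A v) (A v)) ≤ M * ‖v‖ ^ 2) {β : R4 →L[ℝ] ℝ} {Y : R4}
    (hY : α Y = 0) (hβ : ∀ v, α v = 0 → -(b Y v) = β v) :
    ‖β.comp A‖ ^ 2 ≤ M * -(b Y Y) := by
  have hQ := h Y hY
  have h1 : ‖β.comp A‖ ≤ Real.sqrt (M * -(b Y Y)) := by
    refine ContinuousLinearMap.opNorm_le_bound _ (Real.sqrt_nonneg _) fun v => ?_
    rw [Real.norm_eq_abs]
    refine abs_le_of_sq_le_sq ?_ (by positivity)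
    rw [ContinuousLinearMap.comp_apply, ← hβ _ (hA v), mul_pow, Real.sq_sqrt (by positivity)]
    calc _ ≤ -(b Y Y) * -(b (A v) (A v)) := sq_bilin_le hsymm h hY (hA v)
      _ ≤ -(b Y Y) * (M * ‖v‖ ^ 2) := by gcongr; exact hAM v
      _ = _ := by ring
  calc ‖β.comp A‖ ^ 2 ≤ Real.sqrt (M * -(b Y Y)) ^ 2 := by gcongr
    _ = _ := Real.sq_sqrt (by positivity)

/-- The Sobolev inequality on a piece of a hypersurface that is parametrised by a domain with the
segment property, with a constant that depends only on the directions of the segments and on bounds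
for the metric in the parametrisation. -/
theorem sobolev_chart {N : ℕ} (e : Fin N → Fin 3 → R3) (he : ∀ j, LinearIndependent ℝ (e j))
    {m M : ℝ} (hm : 0 < m) (hM : 0 < M) :
    ∃ C : ℝ≥0, ∀ (U : Set R4) (g : BilinField) (τ : R4 → ℝ) (S O : Set R4) (V : Set R3)
      (φ : R3 → R4) (π : R4 → R3) (L : ℝ), ContinuousOn g U →
      (∀ x ∈ U, ∀ v w, g x v w = g x w v) → S ⊆ U → IsChart S O V φ π → 0 < L →
      SegmentCover e L V →
      (∀ y ∈ V, ∀ v, fderiv ℝ τ (φ y) (fderiv ℝ φ y v) = 0 ∧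
        m * ‖v‖ ^ 2 ≤ -(g (φ y) (fderiv ℝ φ y v) (fderiv ℝ φ y v)) ∧
        -(g (φ y) (fderiv ℝ φ y v) (fderiv ℝ φ y v)) ≤ M * ‖v‖ ^ 2) →
      (∀ x ∈ S, ∀ v, fderiv ℝ τ x v = 0 → 0 ≤ -(g x v v)) →
      ∀ (w : R4 → ℝ) (Y : R4 → R4) (O' : Set R4), IsOpen O' → S ⊆ O' → ContDiffOn ℝ 1 w O' →
        IsGradientOn g τ S w Y →
        (∫⁻ x in S ∩ O, ENNReal.ofReal (w x ^ 6) ∂(surfMeasure g S)) ^ (1 / 3 : ℝ) ≤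
          C * (gradEnergy g S Y + ENNReal.ofReal (1 / L ^ 2) * massSq g S w) := by
  obtain ⟨c, hc⟩ := sobolev_segmentCover e he
  set a := Real.sqrt (m ^ 3) with ha
  have ha0 : 0 < a := Real.sqrt_pos.2 (by positivity)
  set A := Real.sqrt (M ^ 3) with hA
  have hA0 : 0 < A := Real.sqrt_pos.2 (by positivity)
  -- The factor A^{1/3} comes from the volume density on the left side. On the right the density
  -- costs 1/a, and comparison of gradients a further M; (M + 1)/a covers both the gradient and the
  -- mass term.
  refine ⟨A.toNNReal ^ (1 / 3 : ℝ) * c * ((M + 1) / a).toNNReal, ?_⟩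
  intro U g τ S O V φ π L hg hsymm hSU hch hL hcov hb hpos w Y O' hO' hSO' hw hY
  have hVo := hch.isOpen_target
  have hφS : ∀ y ∈ V, φ y ∈ S := fun y hy => (hch.mapsTo_param hy).1
  have hvd : ∀ y ∈ V, a ≤ volDensity g φ y ∧ volDensity g φ y ≤ A := fun y hy =>
    volDensity_bounds (hsymm _ (hSU (hφS y hy))) hm.le fun v => (hb y hy v).2
  have hupper : ∀ f : R4 → ℝ≥0∞, ∫⁻ x in S ∩ O, f x ∂(surfMeasure g S) ≤
      ENNReal.ofReal A * ∫⁻ y in V, f (φ y) := by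
    intro f
    refine (lintegral_mono' (surfMeasure_restrict_chart_le hg hSU hch) le_rfl).trans ?_
    rw [lintegral_chartMeasure hg hSU hch.isLocalParam,
      ← lintegral_const_mul' _ _ ENNReal.ofReal_ne_top]
    refine setLIntegral_mono' hVo.measurableSet fun y hy => ?_
    gcongr
    exact (hvd y hy).2
  have hlower : ∀ f : R4 → ℝ≥0∞, ∫⁻ y in V, f (φ y) ≤
      ENNReal.ofReal (1 / a) * ∫⁻ x, f x ∂(surfMeasure g S) := by
    intro f
    have h1 := lintegral_mono' (chartMeasure_le_surfMeasure g hch.isLocalParam) (le_refl f)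
    rw [lintegral_chartMeasure hg hSU hch.isLocalParam] at h1
    refine le_trans ?_ (mul_le_mul_right h1 _)
    rw [← lintegral_const_mul' _ _ ENNReal.ofReal_ne_top]
    refine setLIntegral_mono' hVo.measurableSet fun y hy => ?_
    rw [← mul_assoc, ← ENNReal.ofReal_mul (by positivity)]
    refine le_mul_of_one_le_left zero_le ?_
    rw [ENNReal.one_le_ofReal, one_div, inv_mul_eq_div, one_le_div ha0]
    exact (hvd y hy).1
  have hv : ContDiffOn ℝ 1 (fun y => w (φ y)) V :=
    hw.comp hch.contDiffOn_param fun y hy => hSO' (hφS y hy)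
  have hgrad : ∫⁻ y in V, ENNReal.ofReal (‖fderiv ℝ (fun y => w (φ y)) y‖ ^ 2) ≤
      ENNReal.ofReal ((M + 1) / a) * gradEnergy g S Y := by
    calc ∫⁻ y in V, ENNReal.ofReal (‖fderiv ℝ (fun y => w (φ y)) y‖ ^ 2)
        ≤ ∫⁻ y in V, ENNReal.ofReal M * ENNReal.ofReal (-(g (φ y) (Y (φ y)) (Y (φ y)))) := by
          refine setLIntegral_mono' hVo.measurableSet fun y hy => ?_
          rw [← ENNReal.ofReal_mul hM.le]
          refine ENNReal.ofReal_le_ofReal ?_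
          have hd : fderiv ℝ (fun y => w (φ y)) y = (fderiv ℝ w (φ y)).comp (fderiv ℝ φ y) :=
            fderiv_fun_comp y ((hw.differentiableOn one_ne_zero).differentiableAt
              (hO'.mem_nhds (hSO' (hφS y hy))))
              ((hch.contDiffOn_param.differentiableOn one_ne_zero).differentiableAt
                (hVo.mem_nhds hy))
          rw [hd]
          exact norm_fderiv_comp_sq_le (hsymm _ (hSU (hφS y hy))) (hpos _ (hφS y hy))
            (fun v => (hb y hy v).1) hM.le (fun v => (hb y hy v).2.2) (hY _ (hφS y hy)).1
            (hY _ (hφS y hy)).2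
      _ ≤ ENNReal.ofReal M * (ENNReal.ofReal (1 / a) * gradEnergy g S Y) := by
          rw [lintegral_const_mul' _ _ ENNReal.ofReal_ne_top]
          gcongr
          exact hlower fun x => ENNReal.ofReal (-(g x (Y x) (Y x)))
      _ ≤ _ := by
          rw [← mul_assoc, ← ENNReal.ofReal_mul hM.le]
          gcongr
          rw [mul_one_div]
          gcongr
          linarith
  have hmass : ∫⁻ y in V, ENNReal.ofReal (w (φ y) ^ 2) ≤
      ENNReal.ofReal ((M + 1) / a) * massSq g S w := by
    refine (hlower fun x => ENNReal.ofReal (w x ^ 2)).trans ?_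
    unfold massSq
    gcongr
    linarith
  calc (∫⁻ x in S ∩ O, ENNReal.ofReal (w x ^ 6) ∂(surfMeasure g S)) ^ (1 / 3 : ℝ)
      ≤ (ENNReal.ofReal A * ∫⁻ y in V, ENNReal.ofReal (w (φ y) ^ 6)) ^ (1 / 3 : ℝ) := by
        gcongr
        exact hupper _
    _ = ENNReal.ofReal A ^ (1 / 3 : ℝ) * (∫⁻ y in V, ENNReal.ofReal (w (φ y) ^ 6)) ^ (1 / 3 : ℝ) :=
        ENNReal.mul_rpow_of_nonneg _ _ (by norm_num)
    _ ≤ ENNReal.ofReal A ^ (1 / 3 : ℝ) * (c *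
          (ENNReal.ofReal ((M + 1) / a) * gradEnergy g S Y + ENNReal.ofReal (1 / L ^ 2) *
            (ENNReal.ofReal ((M + 1) / a) * massSq g S w))) := by
        gcongr
        refine (hc L hL V hVo hcov _ hv).trans ?_
        gcongr
    _ = _ := by
        rw [ENNReal.coe_mul, ENNReal.coe_mul, ENNReal.coe_rpow_of_nonneg _ (by norm_num)]
        change _ = ENNReal.ofReal A ^ (1 / 3 : ℝ) * c * ENNReal.ofReal ((M + 1) / a) * _
        ring

/-! ### Openness of the chronological past -/

/-- The curve is tilted to c(s) + s(z - y), which keeps the start and moves the end to z. The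
conditions on it are open, and compactness of [0, 1] makes one neighbourhood of y work for all s.
The curve is first extended continuously to ℝ so that continuity can be used without one-sided
limits. -/
theorem eventually_pastTimelikeStep {U : Set R4} {g : BilinField} {T : R4 → R4}
    (hg : IsSpacetime U g T) {x y : R4} (h : PastTimelikeStep U g T x y) :
    ∀ᶠ z in 𝓝 y, PastTimelikeStep U g T x z := by
  obtain ⟨c, c', hc0, hc1, hc'c, hc⟩ := h
  have h01 : (0 : ℝ) ≤ 1 := zero_le_one
  have hcc : ContinuousOn c (Icc 0 1) := fun s hs => (hc s hs).2.1.continuousWithinAt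
  set k : ℝ → R4 := fun s => c (projIcc 0 1 h01 s) with hk
  set k' : ℝ → R4 := fun s => c' (projIcc 0 1 h01 s) with hk'
  have hkc : Continuous k := hcc.comp_continuous
    (continuous_subtype_val.comp continuous_projIcc) fun s => (projIcc 0 1 h01 s).2
  have hk'c : Continuous k' := hc'c.comp_continuous
    (continuous_subtype_val.comp continuous_projIcc) fun s => (projIcc 0 1 h01 s).2
  have hks : ∀ s ∈ Icc (0 : ℝ) 1, k s = c s := fun s hs => by
    simp only [hk]; rw [projIcc_of_mem h01 hs]
  have hks' : ∀ s ∈ Icc (0 : ℝ) 1, k' s = c' s := fun s hs => by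
    simp only [hk']; rw [projIcc_of_mem h01 hs]
  have hev : ∀ᶠ w in 𝓝 (0 : R4), ∀ s ∈ Icc (0 : ℝ) 1, k s + s • w ∈ U ∧
      0 < g (k s + s • w) (k' s + w) (k' s + w) ∧
      g (k s + s • w) (T (k s + s • w)) (k' s + w) < 0 := by
    refine isCompact_Icc.eventually_forall_of_forall_eventually
      (P := fun w s => k s + s • w ∈ U ∧ 0 < g (k s + s • w) (k' s + w) (k' s + w) ∧
        g (k s + s • w) (T (k s + s • w)) (k' s + w) < 0) fun s hs => ?_
    have h1 : ContinuousAt (fun z : R4 × ℝ => k z.2 + z.2 • z.1) (0, s) := by fun_prop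
    have h2 : ContinuousAt (fun z : R4 × ℝ => k' z.2 + z.1) (0, s) := by fun_prop
    have h0 : k s + s • (0 : R4) ∈ U := by
      rw [smul_zero, add_zero, hks s hs]; exact (hc s hs).1
    have hU : U ∈ 𝓝 (k s + s • (0 : R4)) := hg.isOpen.mem_nhds h0
    have hgc : ContinuousAt (fun z : R4 × ℝ => g (k z.2 + z.2 • z.1)) (0, s) :=
      ContinuousAt.comp (g := g) (hg.contDiffOn.continuousOn.continuousAt hU) h1
    have hTc : ContinuousAt (fun z : R4 × ℝ => T (k z.2 + z.2 • z.1)) (0, s) :=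
      ContinuousAt.comp (g := T) (hg.continuousOn_T.continuousAt hU) h1
    have e1 := (hgc.clm_apply h2).clm_apply h2
    have e2 := (hgc.clm_apply hTc).clm_apply h2
    have p := (hc s hs).2.2
    refine (h1.eventually_mem hU).and ((e1.eventually_const_lt ?_).and (e2.eventually_lt_const ?_))
    · simpa [hks s hs, hks' s hs] using p.1
    · simpa [hks s hs, hks' s hs] using p.2
  have hsub : Tendsto (fun z : R4 => z - y) (𝓝 y) (𝓝 0) := by
    have : ContinuousAt (fun z : R4 => z - y) y := by fun_prop
    simpa [ContinuousAt] using this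
  filter_upwards [hsub.eventually hev] with z hz
  refine ⟨fun s => c s + s • (z - y), fun s => c' s + (z - y), by simp [hc0], by simp [hc1],
    hc'c.add continuousOn_const, fun s hs => ?_⟩
  have := hz s hs
  rw [hks s hs, hks' s hs] at this
  refine ⟨this.1, (hc s hs).2.1.add ?_, this.2⟩
  simpa using ((hasDerivAt_id s).smul_const (z - y)).hasDerivWithinAt

theorem isOpen_chronPast {U : Set R4} {g : BilinField} {T : R4 → R4} (hg : IsSpacetime U g T)
    (p : R4) : IsOpen (chronPast U g T p) := by
  refine isOpen_iff_mem_nhds.2 fun q hq => ?_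
  cases hq with
  | single h =>
    filter_upwards [eventually_pastTimelikeStep hg h] with z hz using Relation.TransGen.single hz
  | tail h1 h2 =>
    filter_upwards [eventually_pastTimelikeStep hg h2] with z hz using Relation.TransGen.tail h1 hz

theorem chronPast_subset {U : Set R4} {g : BilinField} {T : R4 → R4} (p : R4) :
    chronPast U g T p ⊆ U := by
  have hstep : ∀ x y, PastTimelikeStep U g T x y → y ∈ U := by
    rintro x y ⟨c, c', -, rfl, -, h⟩
    exact (h 1 (by simp)).1
  intro q hq
  cases hq with
  | single h => exact hstep _ _ h
  | tail _ h => exact hstep _ _ h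

/-! ### Gluing of local Sobolev inequalities -/

/-- The Sobolev inequality, with length scale `L` and constant `C`, on the piece `S ∩ O` of `S`. -/
def SobolevOn (g : BilinField) (τ : R4 → ℝ) (S O : Set R4) (L : ℝ) (C : ℝ≥0) : Prop :=
  ∀ (w : R4 → ℝ) (Y : R4 → R4) (O' : Set R4), IsOpen O' → S ⊆ O' → ContDiffOn ℝ 1 w O' →
    IsGradientOn g τ S w Y →
    (∫⁻ x in S ∩ O, ENNReal.ofReal (w x ^ 6) ∂(surfMeasure g S)) ^ (1 / 3 : ℝ) ≤
      C * (gradEnergy g S Y + ENNReal.ofReal (1 / L ^ 2) * massSq g S w)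

theorem SobolevOn.rescale {g : BilinField} {τ : R4 → ℝ} {S O : Set R4} {L L' k : ℝ} {C : ℝ≥0}
    (h : SobolevOn g τ S O L C) (hL : 0 < L) (hL' : 0 < L') (hk : L' ≤ k * L) :
    SobolevOn g τ S O L' (C * (1 + k ^ 2).toNNReal) := by
  intro w Y O' h1 h2 h3 h4
  refine (h w Y O' h1 h2 h3 h4).trans ?_
  rw [ENNReal.coe_mul, mul_assoc]
  gcongr
  rw [mul_add, ← mul_assoc]
  have hk2 : (((1 + k ^ 2).toNNReal : ℝ≥0) : ℝ≥0∞) = ENNReal.ofReal (1 + k ^ 2) := rfl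
  rw [hk2]
  gcongr
  · refine le_mul_of_one_le_left zero_le ?_
    rw [ENNReal.one_le_ofReal]; nlinarith [sq_nonneg k]
  · rw [← ENNReal.ofReal_mul (by positivity)]
    refine ENNReal.ofReal_le_ofReal ?_
    rw [mul_one_div, div_le_div_iff₀ (by positivity) (by positivity), one_mul]
    nlinarith [sq_nonneg L, pow_le_pow_left₀ hL'.le hk 2]

theorem SobolevOn.mono {g : BilinField} {τ : R4 → ℝ} {S O O₁ : Set R4} {L : ℝ} {C C₁ : ℝ≥0}
    (h : SobolevOn g τ S O L C) (hO : O₁ ⊆ O) (hC : C ≤ C₁) : SobolevOn g τ S O₁ L C₁ := by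
  intro w Y O' h1 h2 h3 h4
  refine le_trans ?_ ((h w Y O' h1 h2 h3 h4).trans (by gcongr))
  gcongr

/-- Subadditivity of the integral and of t ↦ t^{1/3}. Only the left side is localised, so no cut-off
functions are needed. -/
theorem SobolevOn.union {g : BilinField} {τ : R4 → ℝ} {S O₁ O₂ : Set R4} {L : ℝ} {C₁ C₂ : ℝ≥0}
    (h₁ : SobolevOn g τ S O₁ L C₁) (h₂ : SobolevOn g τ S O₂ L C₂) :
    SobolevOn g τ S (O₁ ∪ O₂) L (C₁ + C₂) := by
  intro w Y O' h1 h2 h3 h4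
  rw [inter_union_distrib_left, ENNReal.coe_add, add_mul]
  refine le_trans ?_ (add_le_add (h₁ w Y O' h1 h2 h3 h4) (h₂ w Y O' h1 h2 h3 h4))
  refine le_trans ?_ (ENNReal.rpow_add_le_add_rpow _ _ (by norm_num) (by norm_num))
  gcongr
  exact lintegral_union_le _ _ _

theorem sobolevOn_of_disjoint {g : BilinField} {τ : R4 → ℝ} {S O : Set R4} {L : ℝ} {C : ℝ≥0}
    (h : S ∩ O = ∅) : SobolevOn g τ S O L C := by
  intro w Y O' h1 h2 h3 h4
  rw [h]
  simp

/-! ### Coordinates that flatten the leaves and the cone -/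

/-- The open cube of centre `y₀` and half-width `b`. -/
def cube (y₀ : R3) (b : ℝ) : Set R3 := {y | ∀ i, |y i - y₀ i| < b}

theorem isOpen_cube (y₀ : R3) (b : ℝ) : IsOpen (cube y₀ b) := by
  have : cube y₀ b = ⋂ i, {y : R3 | |y i - y₀ i| < b} := by ext; simp [cube]
  rw [this]
  exact isOpen_iInter_of_finite fun i => isOpen_lt (by fun_prop) continuous_const

theorem cube_subset_ball (y₀ : R3) {b : ℝ} (hb : 0 < b) : cube y₀ b ⊆ Metric.ball y₀ (2 * b) := by
  intro y hy
  rw [mem_ball_iff_norm]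
  refine lt_of_pow_lt_pow_left₀ 2 (by positivity) ?_
  rw [EuclideanSpace.real_norm_sq_eq, Fin.sum_univ_three]
  have : ∀ i, (y - y₀) i ^ 2 < b ^ 2 := fun i => by
    have h := hy i
    rw [← sq_abs]
    exact pow_lt_pow_left₀ h (abs_nonneg _) two_ne_zero
  nlinarith [this 0, this 1, this 2]

theorem cube_segment {y₀ y : R3} {b : ℝ} (i : Fin 3) {y' : R3} (hy : y ∈ cube y₀ b)
    (hy' : ∀ j ≠ i, y' j = y j) (hi : |y' i - y₀ i| < b) : y' ∈ cube y₀ b := by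
  intro j
  by_cases hj : j = i
  · rw [hj]; exact hi
  · rw [hy' j hj]; exact hy j

/-- V is empty, the cube, or made of open sides of the plane y 0 = y₀ 0. In each coordinate
direction a point at distance less than b/2 from the centre moves outwards and a farther one
inwards; over a length b/4 it neither leaves the cube nor crosses the central plane. At distance
exactly b/2 both choices work. -/
theorem segmentCover_of_sides {y₀ : R3} {b : ℝ} (hb : 0 < b) {V : Set R3} (hV : V ⊆ cube y₀ b)
    (h : ∀ y ∈ V, ∀ y' ∈ cube y₀ b,
      (0 < (y' 0 - y₀ 0) * (y 0 - y₀ 0) ∨ y 0 - y₀ 0 = 0) → y' ∈ V) :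
    SegmentCover (N := 1) (fun _ i => EuclideanSpace.single i (1 : ℝ)) (b / 4) V := by
  refine ⟨fun _ => univ, fun _ => MeasurableSet.univ, fun x _ => by simp, fun _ y hy _ i => ?_⟩
  have hyc := hV hy
  have hyi := abs_lt.1 (hyc i)
  have hne : ∀ (s : ℝ) (j : Fin 3), j ≠ i → (y + s • EuclideanSpace.single i (1 : ℝ)) j = y j := by
    intro s j hj; simp [hj]
  have heq : ∀ s : ℝ, (y + s • EuclideanSpace.single i (1 : ℝ)) i = y i + s := by
    intro s; simp
  have key : ∀ s : ℝ, |y i + s - y₀ i| < b →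
      (y i - y₀ i = 0 ∨ 0 < (y i + s - y₀ i) * (y i - y₀ i)) →
      y + s • EuclideanSpace.single i (1 : ℝ) ∈ V := by
    intro s hs hs2
    refine h y hy _ (cube_segment i hyc (hne s) (by rwa [heq])) ?_
    by_cases hi : i = 0
    · subst hi
      rw [heq]
      exact hs2.symm
    · rw [hne s 0 (Ne.symm hi)]
      by_cases h0 : y 0 - y₀ 0 = 0
      · exact Or.inr h0
      · exact Or.inl (mul_self_pos.2 h0)
  have hneg : ∀ s : ℝ, y + s • (-EuclideanSpace.single i (1 : ℝ)) =
      y + (-s) • EuclideanSpace.single i (1 : ℝ) := fun s => by rw [smul_neg, neg_smul]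
  rcases lt_trichotomy (y i - y₀ i) 0 with hd | hd | hd
  · rcases lt_or_ge (y i - y₀ i) (-(b / 2)) with hd2 | hd2
    · left
      intro s hs
      exact key s (abs_lt.2 ⟨by linarith [hs.1], by linarith [hs.2]⟩)
        (Or.inr (mul_pos_of_neg_of_neg (by linarith [hs.2]) hd))
    · right
      intro s hs
      rw [hneg]
      exact key _ (abs_lt.2 ⟨by linarith [hs.2], by linarith [hs.1]⟩)
        (Or.inr (mul_pos_of_neg_of_neg (by linarith [hs.1]) hd))
  · left
    intro s hs
    exact key s (abs_lt.2 ⟨by linarith [hs.1], by linarith [hs.2]⟩) (Or.inl hd)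
  · rcases lt_or_ge (y i - y₀ i) (b / 2) with hd2 | hd2
    · left
      intro s hs
      exact key s (abs_lt.2 ⟨by linarith [hs.1], by linarith [hs.2]⟩)
        (Or.inr (mul_pos (by linarith [hs.1]) hd))
    · right
      intro s hs
      rw [hneg]
      exact key _ (abs_lt.2 ⟨by linarith [hs.2], by linarith [hs.1]⟩)
        (Or.inr (mul_pos (by linarith [hs.2]) hd))

/-- Two independent functionals on `ℝ⁴` are completed to linear coordinates: `α` is the first one and
`β` is the first component of the remaining three. -/
theorem exists_coordinates {α β : R4 →L[ℝ] ℝ} {v₁ : R4} (h1 : α v₁ ≠ 0) (h2 : β v₁ = 0)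
    (hβ : β ≠ 0) : ∃ (Q : R4 →L[ℝ] R3) (Φ : R4 ≃L[ℝ] ℝ × R3), (∀ v, Q v 0 = 0) ∧
      (Φ : R4 →L[ℝ] ℝ × R3) = α.prod (β.smulRight (EuclideanSpace.single 0 1) + Q) := by
  -- The vector v₁ witnesses that α and β are independent, so their common kernel has dimension 2.
  -- An isomorphism of that kernel with ℝ², extended to ℝ⁴, supplies the last two coordinates.
  let P : R4 →ₗ[ℝ] ℝ × ℝ := (α : R4 →ₗ[ℝ] ℝ).prod (β : R4 →ₗ[ℝ] ℝ)
  have hP : Function.Surjective P := by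
    obtain ⟨v₂, hv₂⟩ : ∃ v, β v ≠ 0 := by
      by_contra! h; exact hβ (ContinuousLinearMap.ext h)
    rintro ⟨a, b⟩
    refine ⟨(b / β v₂) • v₂ + ((a - b / β v₂ * α v₂) / α v₁) • v₁, ?_⟩
    ext
    · simp [P]; field_simp; ring
    · simp [P, h2]; field_simp
  have hker : Module.finrank ℝ (LinearMap.ker P) = Module.finrank ℝ (Fin 2 → ℝ) := by
    have := LinearMap.finrank_range_add_finrank_ker P
    rw [LinearMap.range_eq_top.2 hP] at this
    simp at this ⊢
    omega
  let κ : LinearMap.ker P ≃ₗ[ℝ] (Fin 2 → ℝ) := LinearEquiv.ofFinrankEq _ _ hker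
  obtain ⟨q, hq⟩ := LinearMap.exists_extend (κ : LinearMap.ker P →ₗ[ℝ] (Fin 2 → ℝ))
  have hq' : ∀ v (hv : P v = 0), q v = κ ⟨v, hv⟩ := fun v hv => DFunLike.congr_fun hq ⟨v, hv⟩
  let q0 : R4 →L[ℝ] ℝ := LinearMap.toContinuousLinearMap ((LinearMap.proj 0).comp q)
  let q1 : R4 →L[ℝ] ℝ := LinearMap.toContinuousLinearMap ((LinearMap.proj 1).comp q)
  let Q : R4 →L[ℝ] R3 := q0.smulRight (EuclideanSpace.single 1 1) +
    q1.smulRight (EuclideanSpace.single 2 1)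
  let F : R4 →L[ℝ] ℝ × R3 := α.prod (β.smulRight (EuclideanSpace.single 0 1) + Q)
  have hF : LinearMap.ker (F : R4 →ₗ[ℝ] ℝ × R3) = ⊥ := by
    refine LinearMap.ker_eq_bot'.2 fun v hv => ?_
    have ha : α v = 0 := congrArg Prod.fst hv
    have h3 : β v • EuclideanSpace.single (0 : Fin 3) (1 : ℝ) + Q v = 0 := congrArg Prod.snd hv
    have c0 : β v = 0 := by
      have := congrArg (fun y : R3 => y 0) h3
      simpa [Q] using this
    have c1 : q v 0 = 0 := by
      have := congrArg (fun y : R3 => y 1) h3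
      simpa [Q, q0] using this
    have c2 : q v 1 = 0 := by
      have := congrArg (fun y : R3 => y 2) h3
      simpa [Q, q1] using this
    have hPv : P v = 0 := Prod.ext ha c0
    have h4 : κ ⟨v, hPv⟩ = 0 := by
      rw [← hq' v hPv]
      ext i; fin_cases i
      exacts [c1, c2]
    have := (LinearEquiv.map_eq_zero_iff κ).1 h4
    exact congrArg Subtype.val this
  let Φ : R4 ≃ₗ[ℝ] ℝ × R3 := LinearEquiv.ofInjectiveOfFinrankEq (F : R4 →ₗ[ℝ] ℝ × R3)
    (LinearMap.ker_eq_bot.1 hF) (by simp)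
  refine ⟨Q, Φ.toContinuousLinearEquiv, fun v => by simp [Q], ?_⟩
  ext1 v
  rfl

/-- `ψ` is, with the inverse `(τ, π)`, a `C¹` coordinate system on the neighbourhood `O` of `x₀`, with
values in a box of half-width `b`. In it `τ` and `f` are the first two coordinates. The derivatives of
`ψ` and `π` are bounded by `A`. -/
structure IsFlattening (τ f : R4 → ℝ) (x₀ : R4) (O : Set R4) (y₀ : R3) (b A : ℝ)
    (ψ : ℝ × R3 → R4) (π : R4 → R3) : Prop where
  isOpen : IsOpen O
  mem : x₀ ∈ O
  b_pos : 0 < b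
  A_pos : 0 < A
  contDiffOn_param : ContDiffOn ℝ 1 ψ (Ioo (τ x₀ - b) (τ x₀ + b) ×ˢ cube y₀ b)
  contDiffOn_proj : ContDiffOn ℝ 1 π O
  norm_param : ∀ z ∈ Ioo (τ x₀ - b) (τ x₀ + b) ×ˢ cube y₀ b, ‖fderiv ℝ ψ z‖ ≤ A
  norm_proj : ∀ x ∈ O, ‖fderiv ℝ π x‖ ≤ A
  mapsTo_param : MapsTo ψ (Ioo (τ x₀ - b) (τ x₀ + b) ×ˢ cube y₀ b) O
  mapsTo_proj : ∀ x ∈ O, (τ x, π x) ∈ Ioo (τ x₀ - b) (τ x₀ + b) ×ˢ cube y₀ b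
  left : ∀ x ∈ O, ψ (τ x, π x) = x
  right : ∀ z ∈ Ioo (τ x₀ - b) (τ x₀ + b) ×ˢ cube y₀ b, τ (ψ z) = z.1 ∧ π (ψ z) = z.2
  coord : ∀ x ∈ O, π x 0 = f x
  center : y₀ 0 = f x₀

/-- The inverse function theorem for (τ, π), where the first component of π is f and the others are
linear. On a small box the bounds on the derivatives hold by continuity. Since the box is a product,
each slice τ = t is parametrised by the full cube. -/
theorem exists_flattening {τ f : R4 → ℝ} {x₀ v₁ : R4} (hτ : ContDiffAt ℝ 1 τ x₀)
    (hf : ContDiffAt ℝ 1 f x₀) (h1 : fderiv ℝ τ x₀ v₁ ≠ 0) (h2 : fderiv ℝ f x₀ v₁ = 0)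
    (h3 : fderiv ℝ f x₀ ≠ 0) {N : Set R4} (hN : N ∈ 𝓝 x₀) :
    ∃ O y₀ b A ψ π, O ⊆ N ∧ IsFlattening τ f x₀ O y₀ b A ψ π := by
  obtain ⟨Q, Φ', hQ, hΦ'⟩ := exists_coordinates h1 h2 h3
  let π : R4 → R3 := fun x => f x • EuclideanSpace.single 0 1 + Q x
  have hπ : ∀ x, ContDiffAt ℝ 1 f x → ContDiffAt ℝ 1 π x := fun x hx =>
    (hx.smul contDiffAt_const).add Q.contDiff.contDiffAt
  let Φ : R4 → ℝ × R3 := fun x => (τ x, π x)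
  have hΦ : ContDiffAt ℝ 1 Φ x₀ := hτ.prodMk (hπ _ hf)
  have hΦd : HasFDerivAt Φ (Φ' : R4 →L[ℝ] ℝ × R3) x₀ := by
    rw [hΦ']
    refine (hτ.differentiableAt one_ne_zero).hasFDerivAt.prodMk ?_
    exact ((hf.differentiableAt one_ne_zero).hasFDerivAt.smul_const _).add Q.hasFDerivAt
  let e := hΦ.toOpenPartialHomeomorph Φ hΦd one_ne_zero
  have heΦ : ∀ x, e x = Φ x := fun x => rfl
  have hx₀ : x₀ ∈ e.source := hΦ.mem_toOpenPartialHomeomorph_source hΦd one_ne_zero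
  have hψ : ContDiffAt ℝ 1 e.symm (Φ x₀) := hΦ.to_localInverse hΦd one_ne_zero
  have hψx : e.symm (Φ x₀) = x₀ := e.left_inv hx₀
  obtain ⟨A₁, hA₁⟩ : ∃ A₁ : ℝ, ∀ᶠ z in 𝓝 (Φ x₀), ‖fderiv ℝ e.symm z‖ ≤ A₁ := by
    refine ⟨‖fderiv ℝ e.symm (Φ x₀)‖ + 1, ?_⟩
    have : ContinuousAt (fun z => ‖fderiv ℝ e.symm z‖) (Φ x₀) :=
      (hψ.continuousAt_fderiv one_ne_zero).norm
    exact (this.eventually_lt_const (lt_add_one _)).mono fun _ h => h.le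
  obtain ⟨A₂, hA₂⟩ : ∃ A₂ : ℝ, ∀ᶠ x in 𝓝 x₀, ‖fderiv ℝ π x‖ ≤ A₂ := by
    refine ⟨‖fderiv ℝ π x₀‖ + 1, ?_⟩
    have : ContinuousAt (fun z => ‖fderiv ℝ π z‖) x₀ :=
      ((hπ _ hf).continuousAt_fderiv one_ne_zero).norm
    exact (this.eventually_lt_const (lt_add_one _)).mono fun _ h => h.le
  have hgood : ∀ᶠ x in 𝓝 x₀, x ∈ N ∧ ContDiffAt ℝ 1 π x ∧ ‖fderiv ℝ π x‖ ≤ A₂ :=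
    Filter.Eventually.and hN (((hπ _ hf).eventually (by simp)).and hA₂)
  have hev : ∀ᶠ z in 𝓝 (Φ x₀), z ∈ e.target ∧ ContDiffAt ℝ 1 e.symm z ∧
      ‖fderiv ℝ e.symm z‖ ≤ A₁ ∧ (e.symm z ∈ N ∧ ContDiffAt ℝ 1 π (e.symm z) ∧
        ‖fderiv ℝ π (e.symm z)‖ ≤ A₂) := by
    refine Filter.Eventually.and (e.open_target.mem_nhds (e.map_source hx₀))
      ((hψ.eventually (by simp)).and (hA₁.and ?_))
    have : Tendsto e.symm (𝓝 (Φ x₀)) (𝓝 x₀) := by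
      have := hψ.continuousAt
      rwa [ContinuousAt, hψx] at this
    exact this.eventually hgood
  obtain ⟨ε, hε, hball⟩ := Metric.eventually_nhds_iff_ball.1 hev
  set b := ε / 2 with hb
  have hb0 : 0 < b := by positivity
  set Box := Ioo (τ x₀ - b) (τ x₀ + b) ×ˢ cube (π x₀) b with hBox
  have hBoxball : Box ⊆ Metric.ball (Φ x₀) ε := by
    rintro ⟨t, y⟩ ⟨ht, hy⟩
    rw [← ball_prod_same]
    refine ⟨?_, ?_⟩
    · rw [Metric.mem_ball, Real.dist_eq, abs_lt]
      constructor <;> linarith [ht.1, ht.2]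
    · have := cube_subset_ball _ hb0 hy
      rwa [hb, mul_div_cancel₀ _ (two_ne_zero)] at this
  have hz := fun z (hz : z ∈ Box) => hball z (hBoxball hz)
  have hBoxo : IsOpen Box := isOpen_Ioo.prod (isOpen_cube _ _)
  have hright : ∀ z ∈ Box, Φ (e.symm z) = z := fun z h => e.right_inv (hz z h).1
  have hO : ∀ x ∈ e.source ∩ e ⁻¹' Box, e.symm (Φ x) = x ∧ Φ x ∈ Box := fun x hx =>
    ⟨e.left_inv hx.1, hx.2⟩
  refine ⟨e.source ∩ e ⁻¹' Box, π x₀, b, max (max A₁ A₂) 1, e.symm, π, fun x hx => ?_, ?_⟩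
  · have := (hz _ hx.2).2.2.2.1
    rwa [e.left_inv hx.1] at this
  · exact
    { isOpen := e.isOpen_inter_preimage hBoxo
      mem := ⟨hx₀, show (τ x₀, π x₀) ∈ Box from
        ⟨⟨by simpa using hb0, by simpa using hb0⟩, fun i => by simpa using hb0⟩⟩
      b_pos := hb0
      A_pos := lt_max_of_lt_right one_pos
      contDiffOn_param := fun z h => (hz z h).2.1.contDiffWithinAt
      contDiffOn_proj := fun x hx => by
        have := (hz _ hx.2).2.2.2.2.1
        rw [e.left_inv hx.1] at this
        exact this.contDiffWithinAt
      norm_param := fun z h => (hz z h).2.2.1.trans ((le_max_left _ _).trans (le_max_left _ _))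
      norm_proj := fun x hx => by
        have := (hz _ hx.2).2.2.2.2.2
        rw [e.left_inv hx.1] at this
        exact this.trans ((le_max_right _ _).trans (le_max_left _ _))
      mapsTo_param := fun z h => ⟨e.map_target (hz z h).1, by
        rw [mem_preimage, e.right_inv (hz z h).1]; exact h⟩
      mapsTo_proj := fun x hx => hx.2
      left := fun x hx => (hO x hx).1
      right := fun z h => ⟨congrArg Prod.fst (hright z h), congrArg Prod.snd (hright z h)⟩
      coord := fun x _ => by simp [π, hQ]
      center := by simp [π, hQ] }

/-- The local Sobolev inequality, uniform in the leaf, near a point with a coordinate system in which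
each leaf of `I` is made of sides of a coordinate plane. -/
theorem sobolevOn_of_flattening {U I : Set R4} {g : BilinField} {τ f : R4 → ℝ} {R δ : ℝ}
    (hg : ContinuousOn g U) (hsymm : ∀ x ∈ U, ∀ v w, g x v w = g x w v) (hI : IsOpen I) (hIU : I ⊆ U)
    (hδ : 0 < δ) (hsp : ∀ x ∈ I, τ x ≤ R → ∀ v, fderiv ℝ τ x v = 0 → δ * ‖v‖ ^ 2 ≤ -(g x v v))
    {x₀ : R4} {O : Set R4} {y₀ : R3} {b A G : ℝ} {ψ : ℝ × R3 → R4} {π : R4 → R3}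
    (hfl : IsFlattening τ f x₀ O y₀ b A ψ π) (hτO : ∀ x ∈ O, DifferentiableAt ℝ τ x)
    (hG : ∀ x ∈ O, ‖g x‖ ≤ G)
    (hside : ∀ t ∈ Ioo (τ x₀ - b) (τ x₀ + b), t ≤ R → ∀ y ∈ cube y₀ b, ψ (t, y) ∈ I →
      ∀ y' ∈ cube y₀ b, (0 < (y' 0 - y₀ 0) * (y 0 - y₀ 0) ∨ y 0 - y₀ 0 = 0) → ψ (t, y') ∈ I) :
    ∃ C : ℝ≥0, ∀ r ≤ R, SobolevOn g τ {x ∈ I | τ x = r} O 1 C := by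
  have hb := hfl.b_pos
  have hA := hfl.A_pos
  have hG0 : 0 ≤ G := (norm_nonneg (g x₀)).trans (hG x₀ hfl.mem)
  obtain ⟨C, hC⟩ := sobolev_chart (N := 1) (fun _ i => EuclideanSpace.single i (1 : ℝ))
    (fun _ => by
      have h : (fun i : Fin 3 => EuclideanSpace.single i (1 : ℝ)) =
          (EuclideanSpace.basisFun (Fin 3) ℝ).toBasis := by ext1 i; simp
      rw [h]
      exact Module.Basis.linearIndependent _) (m := δ / A ^ 2) (M := G * A ^ 2 + 1) (by positivity) (by positivity)
  -- The cube gives segments of length b/4; the extra factor converts this scale to the scale 1,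
  -- common to all neighbourhoods.
  refine ⟨C * (1 + (4 / b) ^ 2).toNNReal, fun r hr => ?_⟩
  by_cases hrt : r ∈ Ioo (τ x₀ - b) (τ x₀ + b)
  swap
  · refine sobolevOn_of_disjoint (eq_empty_of_forall_notMem ?_)
    rintro x ⟨⟨-, hx⟩, hxO⟩
    exact hrt (hx ▸ (hfl.mapsTo_proj x hxO).1)
  set S := {x ∈ I | τ x = r} with hS
  set V := {y ∈ cube y₀ b | ψ (r, y) ∈ I} with hV
  have hbox : ∀ y ∈ cube y₀ b, (r, y) ∈ Ioo (τ x₀ - b) (τ x₀ + b) ×ˢ cube y₀ b :=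
    fun y hy => ⟨hrt, hy⟩
  have hmk : ContDiff ℝ 1 (fun y : R3 => (r, y)) := contDiff_const.prodMk contDiff_id
  have hφc : ContDiffOn ℝ 1 (fun y => ψ (r, y)) (cube y₀ b) :=
    hfl.contDiffOn_param.comp hmk.contDiffOn hbox
  have hVo : IsOpen V := hφc.continuousOn.isOpen_inter_preimage (isOpen_cube _ _) hI
  have hch : IsChart S O V (fun y => ψ (r, y)) π :=
    { isOpen_source := hfl.isOpen
      isOpen_target := hVo
      contDiffOn_param := hφc.mono fun y hy => hy.1
      contDiffOn_proj := hfl.contDiffOn_proj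
      mapsTo_param := fun y hy =>
        ⟨⟨hy.2, (hfl.right _ (hbox y hy.1)).1⟩, hfl.mapsTo_param (hbox y hy.1)⟩
      mapsTo_proj := fun x hx => by
        have h1 := hfl.left x hx.2
        rw [hx.1.2] at h1
        exact ⟨(hfl.mapsTo_proj x hx.2).2, by rw [h1]; exact hx.1.1⟩
      proj_param := fun y hy => (hfl.right _ (hbox y hy.1)).2
      param_proj := fun x hx => by
        have h1 := hfl.left x hx.2
        rwa [hx.1.2] at h1 }
  have hSO : SobolevOn g τ S O (b / 4) C := by
    intro w Y O' hO' hSO' hw hY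
    refine hC U g τ S O V _ π (b / 4) hg hsymm (fun x hx => hIU hx.1) hch (by positivity)
      (segmentCover_of_sides hb (fun y hy => hy.1) fun y hy y' hy' h =>
        ⟨hy', hside r hrt hr y hy.1 hy.2 y' hy' h⟩) (fun y hy v => ?_) (fun x hx v hv => ?_)
      w Y O' hO' hSO' hw hY
    · have hyO : ψ (r, y) ∈ O := hfl.mapsTo_param (hbox y hy.1)
      have hopen : IsOpen (Ioo (τ x₀ - b) (τ x₀ + b) ×ˢ cube y₀ b) :=
        isOpen_Ioo.prod (isOpen_cube _ _)
      have hφ : HasFDerivAt (fun y => ψ (r, y))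
          ((fderiv ℝ ψ (r, y)).comp (ContinuousLinearMap.inr ℝ ℝ R3)) y := by
        have h1 : HasFDerivAt ψ (fderiv ℝ ψ (r, y)) (r, y) :=
          ((hfl.contDiffOn_param.differentiableOn one_ne_zero).differentiableAt
            (hopen.mem_nhds (hbox y hy.1))).hasFDerivAt
        exact h1.comp y (hasFDerivAt_prodMk_right r y)
      have hπ : HasFDerivAt π (fderiv ℝ π (ψ (r, y))) (ψ (r, y)) :=
        ((hfl.contDiffOn_proj.differentiableOn one_ne_zero).differentiableAt
          (hfl.isOpen.mem_nhds hyO)).hasFDerivAt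
      have hker : fderiv ℝ τ (ψ (r, y)) (fderiv ℝ (fun y => ψ (r, y)) y v) = 0 := by
        have h1 := (hτO _ hyO).hasFDerivAt.comp y hφ
        have h2 : HasFDerivAt (fun _ : R3 => r) (0 : R3 →L[ℝ] ℝ) y := hasFDerivAt_const r y
        have h3 := h1.unique (h2.congr_of_eventuallyEq (by
          filter_upwards [hVo.mem_nhds hy] with z hz
          exact (hfl.right _ (hbox z hz.1)).1))
        rw [hφ.fderiv]
        exact DFunLike.congr_fun h3 v
      have hinv : fderiv ℝ π (ψ (r, y)) (fderiv ℝ (fun y => ψ (r, y)) y v) = v := by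
        have h1 := hπ.comp y hφ
        have h3 := h1.unique ((hasFDerivAt_id y).congr_of_eventuallyEq (by
          filter_upwards [hVo.mem_nhds hy] with z hz
          exact (hfl.right _ (hbox z hz.1)).2))
        rw [hφ.fderiv]
        exact DFunLike.congr_fun h3 v
      set z := fderiv ℝ (fun y => ψ (r, y)) y v with hz
      have hz1 : ‖v‖ ≤ A * ‖z‖ := by
        calc ‖v‖ = ‖fderiv ℝ π (ψ (r, y)) z‖ := by rw [hinv]
          _ ≤ ‖fderiv ℝ π (ψ (r, y))‖ * ‖z‖ := ContinuousLinearMap.le_opNorm _ _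
          _ ≤ _ := by gcongr; exact hfl.norm_proj _ hyO
      have hz2 : ‖z‖ ≤ A * ‖v‖ := by
        rw [hz, hφ.fderiv]
        calc ‖fderiv ℝ ψ (r, y) (0, v)‖ ≤ ‖fderiv ℝ ψ (r, y)‖ * ‖((0, v) : ℝ × R3)‖ :=
              ContinuousLinearMap.le_opNorm _ _
          _ ≤ A * ‖v‖ := by
              gcongr
              · exact hfl.norm_param _ (hbox y hy.1)
              · simp [Prod.norm_def]
      refine ⟨hker, ?_, ?_⟩
      · have hle : τ (ψ (r, y)) ≤ R := by rw [(hfl.right _ (hbox y hy.1)).1]; exact hr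
        refine le_trans ?_ (hsp _ hy.2 hle z hker)
        rw [div_mul_eq_mul_div, div_le_iff₀ (by positivity), mul_assoc]
        gcongr
        rw [← mul_pow, mul_comm]
        gcongr
      · calc -(g (ψ (r, y)) z z) ≤ |g (ψ (r, y)) z z| := neg_le_abs _
          _ ≤ ‖g (ψ (r, y))‖ * ‖z‖ * ‖z‖ := (g (ψ (r, y))).le_opNorm₂ z z
          _ ≤ G * (A * ‖v‖) * (A * ‖v‖) := by gcongr; exact hG _ hyO
          _ ≤ _ := by nlinarith [sq_nonneg ‖v‖]
    · exact le_trans (by positivity) (hsp x hx.1 (hx.2.trans_le hr) v hv)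
  exact hSO.rescale (by positivity) one_pos (by field_simp; exact le_rfl)

/-! ### Leaves away from the vertex -/

section Foliation

variable {U : Set R4} {g : BilinField} {T : R4 → R4} {p : R4} {Ψ : ℝ → R3 → R4} {R₁ R : ℝ}
  {τ : R4 → ℝ}

theorem vertex_notMem_chronPast (hτ : IsUniformlySpacelikeFoliation U g T p Ψ R₁ R τ) :
    p ∉ chronPast U g T p := fun h => by
  have := hτ.interior_pos p h
  rw [hτ.vertex] at this
  exact lt_irrefl _ this

theorem pos_of_mem_lightCone (hτ : IsUniformlySpacelikeFoliation U g T p Ψ R₁ R τ) {x : R4}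
    (hx : x ∈ lightCone Ψ R₁) : 0 < τ x := by
  obtain ⟨r, hr, ω, hω, rfl⟩ := hx
  rw [hτ.cone r hr ω hω]; exact hr.1

theorem lightCone_subset (hcone : IsPastLightCone U g T p Ψ R₁) : lightCone Ψ R₁ ⊆ U := by
  rintro x ⟨r, hr, ω, hω, rfl⟩
  obtain ⟨e, a, -, -, -, h⟩ := hcone.generators
  obtain ⟨c', c'', -, -, hc⟩ := (h ω hω).2
  exact (hc r ⟨hr.1.le, hr.2⟩).1

theorem fderiv_ne_zero_of_mem_chronPast
    (hτ : IsUniformlySpacelikeFoliation U g T p Ψ R₁ R τ) {x : R4} (hx : x ∈ chronPast U g T p)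
    (hxR : τ x ≤ R) {v : R4} (hv : 0 < g x v v) : fderiv ℝ τ x v ≠ 0 := by
  intro h
  obtain ⟨δ, hδ, hsp⟩ := hτ.spacelike
  have := hsp (τ x) ⟨hτ.interior_pos x hx, hxR⟩ x ⟨hx, rfl⟩ v h
  have h2 : 0 ≤ δ * ‖v‖ ^ 2 := by positivity
  linarith

/-- The local Sobolev inequality away from the vertex, uniform in the leaf. -/
theorem exists_nhds_sobolevOn (hg : IsSpacetime U g T) (hcone : IsPastLightCone U g T p Ψ R₁)
    (hτ : IsUniformlySpacelikeFoliation U g T p Ψ R₁ R τ) {x₀ : R4}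
    (hx₀ : x₀ ∈ chronPast U g T p ∪ lightCone Ψ R₁) (hx₀R : τ x₀ ≤ R) :
    ∃ O ∈ 𝓝 x₀, ∃ C : ℝ≥0, ∀ r ∈ Ioc 0 R, SobolevOn g τ (leaf U g T p τ r) O 1 C := by
  set I := chronPast U g T p with hI
  have hIo : IsOpen I := isOpen_chronPast hg p
  have hpI : p ∉ I := vertex_notMem_chronPast hτ
  have hx₀U : x₀ ∈ U := hx₀.elim (fun h => chronPast_subset p h) fun h => lightCone_subset hcone h
  have hx₀p : x₀ ≠ p := by
    rintro rfl
    rcases hx₀ with h | h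
    · exact hpI h
    · have := pos_of_mem_lightCone hτ h
      rw [hτ.vertex] at this
      exact lt_irrefl _ this
  have hUp : IsOpen (U \ {p}) := hg.isOpen.sdiff isClosed_singleton
  have hτat : ∀ x ∈ U \ {p}, ContDiffAt ℝ 1 τ x := fun x hx =>
    hτ.contDiffOn.contDiffAt (hUp.mem_nhds hx)
  obtain ⟨δ, hδ, hsp⟩ := hτ.spacelike
  have hsp' : ∀ x ∈ I, τ x ≤ R → ∀ v, fderiv ℝ τ x v = 0 → δ * ‖v‖ ^ 2 ≤ -(g x v v) :=
    fun x hx hxR v hv => hsp (τ x) ⟨hτ.interior_pos x hx, hxR⟩ x ⟨hx, rfl⟩ v hv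
  have hgc := hg.contDiffOn.continuousOn
  have hgn : ContinuousAt (fun x => ‖g x‖) x₀ :=
    (continuous_norm (E := R4 →L[ℝ] R4 →L[ℝ] ℝ)).continuousAt.comp
      (hgc.continuousAt (hg.isOpen.mem_nhds hx₀U))
  have hGev : ∀ᶠ x in 𝓝 x₀, ‖g x‖ ≤ ‖g x₀‖ + 1 :=
    (hgn.eventually_lt_const (lt_add_one _)).mono fun _ h => h.le
  have hNev : U \ {p} ∈ 𝓝 x₀ := hUp.mem_nhds ⟨hx₀U, hx₀p⟩
  -- One statement for both kinds of points. In the interior f is an auxiliary linear functional and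
  -- v₁ is timelike, hence transversal to the leaf. On the cone f is a local defining function and
  -- v₁ is the velocity of the generator, so that dτ(v₁) = 1 and df(v₁) = 0.
  suffices h : ∃ (f : R4 → ℝ) (v₁ : R4), ContDiffAt ℝ 1 f x₀ ∧ fderiv ℝ τ x₀ v₁ ≠ 0 ∧ fderiv ℝ f x₀ v₁ = 0 ∧
      fderiv ℝ f x₀ ≠ 0 ∧ ∃ N ∈ 𝓝 x₀, (N ⊆ I ∨ (f x₀ = 0 ∧
        ∀ x ∈ N, f x = 0 ↔ x ∈ lightCone Ψ R₁)) by
    obtain ⟨f, v₁, hf, h1, h2, h3, N, hN, hcase⟩ := h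
    obtain ⟨O, y₀, b, A, ψ, π, hO, hfl⟩ := exists_flattening (hτat x₀ ⟨hx₀U, hx₀p⟩) hf h1 h2 h3
      (inter_mem hN (inter_mem hGev hNev))
    suffices hside : ∀ t ∈ Ioo (τ x₀ - b) (τ x₀ + b), t ≤ R → ∀ y ∈ cube y₀ b, ψ (t, y) ∈ I →
        ∀ y' ∈ cube y₀ b, (0 < (y' 0 - y₀ 0) * (y 0 - y₀ 0) ∨ y 0 - y₀ 0 = 0) →
          ψ (t, y') ∈ I by
      obtain ⟨C, hC⟩ := sobolevOn_of_flattening hgc hg.symm hIo (chronPast_subset p) hδ hsp' hfl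
        (fun x hx => (hτat x (hO hx).2.2).differentiableAt one_ne_zero)
        (fun x hx => (hO hx).2.1) hside
      exact ⟨O, hfl.isOpen.mem_nhds hfl.mem, C, fun r hr => hC r hr.2⟩
    intro t ht htR y hy hyI y' hy' hsides
    have hbox : ∀ z ∈ cube y₀ b, (t, z) ∈ Ioo (τ x₀ - b) (τ x₀ + b) ×ˢ cube y₀ b :=
      fun z hz => ⟨ht, hz⟩
    rcases hcase with hNI | ⟨hf0, hNf⟩
    · exact hNI (hO (hfl.mapsTo_param (hbox y' hy'))).1
    have hcoord : ∀ z ∈ cube y₀ b, f (ψ (t, z)) = z 0 - y₀ 0 := by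
      intro z hz
      rw [← hfl.coord _ (hfl.mapsTo_param (hbox z hz)), (hfl.right _ (hbox z hz)).2, hfl.center, hf0,
        sub_zero]
    have hnotcone : ∀ z ∈ cube y₀ b, z 0 - y₀ 0 ≠ 0 → ψ (t, z) ∉ lightCone Ψ R₁ := by
      intro z hz hz0 hmem
      rw [← hNf _ (hO (hfl.mapsTo_param (hbox z hz))).1, hcoord z hz] at hmem
      exact hz0 hmem
    have hy0 : y 0 - y₀ 0 ≠ 0 := by
      intro h0
      rw [← hcoord y hy, hNf _ (hO (hfl.mapsTo_param (hbox y hy))).1] at h0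
      exact disjoint_left.1 hcone.disjoint h0 hyI
    have hprod : 0 < (y' 0 - y₀ 0) * (y 0 - y₀ 0) := hsides.resolve_right hy0
    set K := {x ∈ insert p (I ∪ lightCone Ψ R₁) | τ x ≤ R} with hK
    have hKc : IsClosed K := hτ.compact.isClosed
    have hseg : ∀ z ∈ segment ℝ y y', z ∈ cube y₀ b ∧ z 0 - y₀ 0 ≠ 0 := by
      rintro z ⟨s, s', hs, hs', hss, rfl⟩
      have hcoe : ∀ i, (s • y + s' • y') i - y₀ i = s * (y i - y₀ i) + s' * (y' i - y₀ i) := by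
        intro i
        have : y₀ i = (s + s') * y₀ i := by rw [hss, one_mul]
        simp only [PiLp.add_apply, PiLp.smul_apply, smul_eq_mul]
        linear_combination -this
      constructor
      · intro i
        rw [hcoe]
        have h1 := abs_lt.1 (hy i)
        have h2 := abs_lt.1 (hy' i)
        rw [abs_lt]
        exact convex_Ioo (-b) b h1 h2 hs hs' hss
      · rw [hcoe]
        intro h0
        have h1 : (s * (y 0 - y₀ 0) + s' * (y' 0 - y₀ 0)) * (y 0 - y₀ 0) = 0 := by rw [h0, zero_mul]
        have h2 : 0 < (y 0 - y₀ 0) ^ 2 := by positivity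
        rcases hs.eq_or_lt with rfl | hs
        · have : s' = 1 := by linarith
          subst this
          nlinarith
        · nlinarith [mul_nonneg hs' hprod.le, mul_pos hs h2]
    have hcontseg : ContinuousOn (fun z => ψ (t, z)) (segment ℝ y y') :=
      hfl.contDiffOn_param.continuousOn.comp (by fun_prop) fun z hz => hbox z (hseg z hz).1
    have hpre : IsPreconnected ((fun z => ψ (t, z)) '' segment ℝ y y') :=
      (convex_segment y y').isPreconnected.image _ hcontseg
    have hIK : ∀ z ∈ segment ℝ y y', ψ (t, z) ∈ K ↔ ψ (t, z) ∈ I := by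
      intro z hz
      have hzc := (hseg z hz).1
      have hzτ : τ (ψ (t, z)) = t := (hfl.right _ (hbox z hzc)).1
      constructor
      · rintro ⟨hm, -⟩
        rcases hm with hm | hm | hm
        · exact absurd hm (hO (hfl.mapsTo_param (hbox z hzc))).2.2.2
        · exact hm
        · exact absurd hm (hnotcone z hzc (hseg z hz).2)
      · intro hm
        exact ⟨Or.inr (Or.inl hm), hzτ.trans_le htR⟩
    -- The segment from y to y' avoids the cone and the vertex and has τ = t ≤ R, so along it
    -- membership in the closed set K is membership in the open set I. By connectedness it lies
    -- entirely in I once y does.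
    rcases isPreconnected_iff_subset_of_disjoint.1 hpre I Kᶜ hIo hKc.isOpen_compl
      (by
        rintro _ ⟨z, hz, rfl⟩
        by_cases hzI : ψ (t, z) ∈ I
        · exact Or.inl hzI
        · exact Or.inr fun hzK => hzI ((hIK z hz).1 hzK))
      (by
        refine eq_empty_of_forall_notMem ?_
        rintro _ ⟨⟨z, hz, rfl⟩, hzI, hzK⟩
        exact hzK ((hIK z hz).2 hzI)) with h | h
    · exact h ⟨y', right_mem_segment ℝ y y', rfl⟩
    · exact absurd ((hIK y (left_mem_segment ℝ y y')).2 hyI) (h ⟨y, left_mem_segment ℝ y y', rfl⟩)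
  rcases hx₀ with hxI | hxH
  · obtain ⟨e, he⟩ := hg.lorentz x₀ hx₀U
    have h00 : g x₀ (e 0) (e 0) = 1 := by simpa using he 0 0
    have h10 : g x₀ (e 1) (e 0) = 0 := by simpa using he 1 0
    have h11 : g x₀ (e 1) (e 1) = -1 := by simpa using he 1 1
    refine ⟨g x₀ (e 1), e 0, (g x₀ (e 1)).contDiff.contDiffAt,
      fderiv_ne_zero_of_mem_chronPast hτ hxI hx₀R (by rw [h00]; exact one_pos), ?_, ?_,
      I, hIo.mem_nhds hxI, Or.inl le_rfl⟩
    · rw [ContinuousLinearMap.fderiv, h10]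
    · rw [ContinuousLinearMap.fderiv]
      intro h
      rw [h] at h11
      simp at h11
  · obtain ⟨O, hO, hxO, f, hf, hf0, hHO⟩ := hcone.hypersurface x₀ hxH
    have hiff : ∀ x ∈ O, f x = 0 ↔ x ∈ lightCone Ψ R₁ := fun x hx => by
      have := Set.ext_iff.1 hHO x
      simp only [mem_inter_iff, hx, and_true, mem_sep_iff, true_and] at this
      exact this.symm
    have hfat : ContDiffAt ℝ 1 f x₀ := hf.contDiffAt (hO.mem_nhds hxO)
    obtain ⟨r, hr, ω, hω, hxr⟩ := hxH
    obtain ⟨e, a, -, -, -, hgen⟩ := hcone.generators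
    obtain ⟨c', c'', -, -, hc⟩ := (hgen ω hω).2
    have hder : HasDerivAt (fun s => Ψ s ω) (c' r) r :=
      (hc r ⟨hr.1.le, hr.2⟩).2.1.hasDerivAt (Ico_mem_nhds hr.1 hr.2)
    have hIoo : Ioo 0 R₁ ∈ 𝓝 r := Ioo_mem_nhds hr.1 hr.2
    refine ⟨f, c' r, hfat, ?_, ?_, hf0, O, hO.mem_nhds hxO, Or.inr ⟨?_, hiff⟩⟩
    · have h1 : HasDerivAt (fun s => τ (Ψ s ω)) (fderiv ℝ τ x₀ (c' r)) r := by
        have := ((hτat x₀ ⟨hx₀U, hx₀p⟩).differentiableAt one_ne_zero).hasFDerivAt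
        rw [hxr] at this ⊢
        exact this.comp_hasDerivAt r hder
      have h2 : HasDerivAt (fun s => τ (Ψ s ω)) 1 r := by
        refine (hasDerivAt_id r).congr_of_eventuallyEq ?_
        filter_upwards [hIoo] with s hs using hτ.cone s hs ω hω
      rw [h1.unique h2]
      exact one_ne_zero
    · have h1 : HasDerivAt (fun s => f (Ψ s ω)) (fderiv ℝ f x₀ (c' r)) r := by
        have := (hfat.differentiableAt one_ne_zero).hasFDerivAt
        rw [hxr] at this ⊢
        exact this.comp_hasDerivAt r hder
      have h2 : HasDerivAt (fun s => f (Ψ s ω)) 0 r := by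
        refine (hasDerivAt_const r (0 : ℝ)).congr_of_eventuallyEq ?_
        have hO' : ∀ᶠ s in 𝓝 r, Ψ s ω ∈ O :=
          hder.continuousAt.eventually_mem (by rw [← hxr]; exact hO.mem_nhds hxO)
        filter_upwards [hIoo, hO'] with s hs hsO
        exact (hiff _ hsO).2 ⟨s, hs, ω, hω, rfl⟩
      exact h1.unique h2
    · exact (hiff x₀ hxO).2 ⟨r, hr, ω, hω, hxr⟩

/-- The Sobolev inequality on the leaves `Σ_r` with `r ≥ r₀ > 0`. -/
theorem sobolevOn_leaf_of_ge (hg : IsSpacetime U g T) (hcone : IsPastLightCone U g T p Ψ R₁)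
    (hτ : IsUniformlySpacelikeFoliation U g T p Ψ R₁ R τ) {r₀ : ℝ} (hr₀ : 0 < r₀) :
    ∃ C : ℝ≥0, ∀ r ∈ Icc r₀ R, SobolevOn g τ (leaf U g T p τ r) univ r C := by
  set K := {x ∈ insert p (chronPast U g T p ∪ lightCone Ψ R₁) | τ x ≤ R} with hK
  have hK₀ : IsCompact (K ∩ τ ⁻¹' Ici r₀) :=
    hτ.compact.of_isClosed_subset
      ((hτ.continuousOn.mono fun x hx => hx.1).preimage_isClosed_of_isClosed hτ.compact.isClosed
        isClosed_Ici) inter_subset_left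
  -- Passage from local to global: the region r₀ ≤ τ ≤ R of the interior with the cone is compact
  -- and misses the vertex, so finitely many neighbourhoods cover it, with one constant for all
  -- leaves.
  have hP := hK₀.induction_on
    (p := fun O => ∃ C : ℝ≥0, ∀ r ∈ Ioc 0 R, SobolevOn g τ (leaf U g T p τ r) O 1 C)
    ⟨0, fun r _ => sobolevOn_of_disjoint (inter_empty _)⟩
    (fun s t hst ⟨C, hC⟩ => ⟨C, fun r hr => (hC r hr).mono hst le_rfl⟩)
    (fun s t ⟨C, hC⟩ ⟨C', hC'⟩ => ⟨C + C', fun r hr => (hC r hr).union (hC' r hr)⟩)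
    (fun x hx => by
      have hx' : x ∈ chronPast U g T p ∪ lightCone Ψ R₁ := by
        refine hx.1.1.resolve_left ?_
        rintro rfl
        have := hx.2
        rw [mem_preimage, hτ.vertex] at this
        exact absurd this (not_le.2 hr₀)
      obtain ⟨O, hO, C, hC⟩ := exists_nhds_sobolevOn hg hcone hτ hx' hx.1.2
      exact ⟨O, mem_nhdsWithin_of_mem_nhds hO, C, hC⟩)
  obtain ⟨C, hC⟩ := hP
  refine ⟨C * (1 + R ^ 2).toNNReal, fun r hr => ?_⟩
  have hr0 : 0 < r := hr₀.trans_le hr.1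
  have h1 := (hC r ⟨hr0, hr.2⟩).rescale (k := R) one_pos hr0 (by linarith [hr.2])
  intro w Y O' h2 h3 h4 h5
  have h6 : leaf U g T p τ r ∩ univ = leaf U g T p τ r ∩ (K ∩ τ ⁻¹' Ici r₀) := by
    rw [inter_univ, eq_comm, inter_eq_left]
    rintro x ⟨hx, hxr⟩
    exact ⟨⟨Or.inr (Or.inl hx), hxr.trans_le hr.2⟩, hr.1.trans_eq hxr.symm⟩
  rw [h6]
  exact h1 w Y O' h2 h3 h4 h5

end Foliation

/-! ### Leaves near the vertex as graphs -/

/-- Near the vertex `p`, in linear coordinates with time component `tm` and space component `sp`: the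
open set `I` contains the past narrow cones of its points, its part `τ ≤ r₀` lies close to `p`, and
the slope of the level sets of `τ` is at most `κ`. -/
structure IsNearVertex (I : Set R4) (τ : R4 → ℝ) (p e₀ : R4) (tm : R4 →L[ℝ] ℝ) (sp : R4 →L[ℝ] R3)
    (κ ρ r₀ : ℝ) : Prop where
  isOpen : IsOpen I
  ρ_pos : 0 < ρ
  step : ∀ x ∈ I, ∀ z, ‖x - p‖ < 4 * ρ → ‖z - p‖ < 4 * ρ → tm (z - x) < 0 →
    ‖sp (z - x)‖ ≤ -tm (z - x) / 2 → z ∈ I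
  near : ∀ x ∈ I, τ x ≤ r₀ → ‖x - p‖ < ρ
  contDiffAt : ∀ x ∈ I, ContDiffAt ℝ 1 τ x
  slope : ∀ x ∈ I, τ x ≤ r₀ → ∀ v, fderiv ℝ τ x v = 0 → |tm v| ≤ κ * ‖sp v‖
  tm_e₀ : tm e₀ = 1
  sp_e₀ : sp e₀ = 0
  eq_smul : ∀ v, sp v = 0 → v = tm v • e₀

namespace IsNearVertex

variable {I : Set R4} {τ : R4 → ℝ} {p e₀ : R4} {tm : R4 →L[ℝ] ℝ} {sp : R4 →L[ℝ] R3} {κ ρ r₀ : ℝ}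

theorem e₀_ne_zero (h : IsNearVertex I τ p e₀ tm sp κ ρ r₀) : e₀ ≠ 0 := by
  intro h0
  have := h.tm_e₀
  rw [h0, map_zero] at this
  exact zero_ne_one this

/-- The axis e₀ has time component 1 and no space component, so it violates the slope bound and
cannot be tangent to a leaf. -/
theorem fderiv_e₀_ne_zero (h : IsNearVertex I τ p e₀ tm sp κ ρ r₀) {x : R4} (hx : x ∈ I)
    (hxr : τ x ≤ r₀) : fderiv ℝ τ x e₀ ≠ 0 := by
  intro h0
  have := h.slope x hx hxr e₀ h0
  rw [h.tm_e₀, h.sp_e₀] at this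
  norm_num at this

theorem ray_mem (h : IsNearVertex I τ p e₀ tm sp κ ρ r₀) {x : R4} (hx : x ∈ I)
    (hxp : ‖x - p‖ < 4 * ρ) {s : ℝ} (hs : 0 ≤ s) (hsp : ‖x - s • e₀ - p‖ < 4 * ρ) :
    x - s • e₀ ∈ I := by
  rcases hs.eq_or_lt with rfl | hs
  · simpa using hx
  · refine h.step x hx _ hxp hsp ?_ ?_
    · simp [h.tm_e₀, hs]
    · simpa [h.tm_e₀, h.sp_e₀] using (half_pos hs).le

theorem hasDerivAt_ray (h : IsNearVertex I τ p e₀ tm sp κ ρ r₀) {x : R4} {s : ℝ}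
    (hs : x - s • e₀ ∈ I) :
    HasDerivAt (fun s : ℝ => τ (x - s • e₀)) (-(fderiv ℝ τ (x - s • e₀) e₀)) s := by
  have h1 : HasDerivAt (fun s : ℝ => x - s • e₀) (-e₀) s := by
    simpa using ((hasDerivAt_id s).smul_const e₀).const_sub x
  have h2 := ((h.contDiffAt _ hs).differentiableAt one_ne_zero).hasFDerivAt.comp_hasDerivAt s h1
  rwa [map_neg] at h2

/-- `τ` has no interior minimum with value at most `r₀` along a past directed ray. -/
theorem ray_no_min (h : IsNearVertex I τ p e₀ tm sp κ ρ r₀) {x : R4} (hx : x ∈ I) {s₁ : ℝ}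
    (hball : ∀ s ∈ Icc 0 s₁, ‖x - s • e₀ - p‖ < 4 * ρ) {s : ℝ} (hs : s ∈ Ioo 0 s₁)
    (h0 : τ (x - s • e₀) < τ x) (h1 : τ (x - s • e₀) < τ (x - s₁ • e₀))
    (hr : τ (x - s • e₀) ≤ r₀) : False := by
  have hs₁ : 0 ≤ s₁ := hs.1.le.trans hs.2.le
  have hxp : ‖x - p‖ < 4 * ρ := by simpa using hball 0 ⟨le_rfl, hs₁⟩
  have hI : ∀ s ∈ Icc 0 s₁, x - s • e₀ ∈ I := fun s hs => h.ray_mem hx hxp hs.1 (hball s hs)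
  have hc : ContinuousOn (fun s : ℝ => τ (x - s • e₀)) (Icc 0 s₁) := fun s hs =>
    (h.hasDerivAt_ray (hI s hs)).continuousAt.continuousWithinAt
  obtain ⟨m, hm, hmin⟩ := isCompact_Icc.exists_isMinOn ⟨0, le_rfl, hs₁⟩ hc
  have hms : τ (x - m • e₀) ≤ τ (x - s • e₀) := hmin ⟨hs.1.le, hs.2.le⟩
  have hm0 : m ≠ 0 := by
    rintro rfl
    simp at hms
    linarith
  have hm1 : m ≠ s₁ := by
    rintro rfl
    linarith
  have hmo : m ∈ Ioo 0 s₁ := ⟨lt_of_le_of_ne hm.1 hm0.symm, lt_of_le_of_ne hm.2 hm1⟩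
  have hloc : IsLocalMin (fun s : ℝ => τ (x - s • e₀)) m :=
    hmin.isLocalMin (Icc_mem_nhds hmo.1 hmo.2)
  have h2 := hloc.hasDerivAt_eq_zero (h.hasDerivAt_ray (hI m hm))
  exact h.fderiv_e₀_ne_zero (hI m hm) (hms.trans hr) (neg_eq_zero.1 h2)

/-- If τ increased towards the future at x, it would first decrease along the past ray from x. That
ray stays in I, and after a displacement of length 2ρ it is too far from p for τ ≤ r₀. So τ would
have an interior minimum of value at most r₀, which `ray_no_min` excludes. -/
theorem fderiv_e₀_neg (h : IsNearVertex I τ p e₀ tm sp κ ρ r₀) {x : R4} (hx : x ∈ I)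
    (hxr : τ x ≤ r₀) : fderiv ℝ τ x e₀ < 0 := by
  by_contra! hge
  have hpos : 0 < fderiv ℝ τ x e₀ := lt_of_le_of_ne hge (h.fderiv_e₀_ne_zero hx hxr).symm
  have hρ := h.ρ_pos
  have he : 0 < ‖e₀‖ := norm_pos_iff.2 h.e₀_ne_zero
  have hxp := h.near x hx hxr
  set s₁ := 2 * ρ / ‖e₀‖ with hs₁
  have hs₁0 : 0 < s₁ := by positivity
  have hs₁e : s₁ * ‖e₀‖ = 2 * ρ := by rw [hs₁]; field_simp
  have hball : ∀ s ∈ Icc 0 s₁, ‖x - s • e₀ - p‖ < 4 * ρ := by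
    intro s hs
    calc ‖x - s • e₀ - p‖ = ‖(x - p) - s • e₀‖ := by congr 1; abel
      _ ≤ ‖x - p‖ + ‖s • e₀‖ := norm_sub_le _ _
      _ = ‖x - p‖ + s * ‖e₀‖ := by rw [norm_smul, Real.norm_of_nonneg hs.1]
      _ ≤ ‖x - p‖ + s₁ * ‖e₀‖ := by gcongr; exact hs.2
      _ < 4 * ρ := by rw [hs₁e]; linarith
  have hend : r₀ < τ (x - s₁ • e₀) := by
    by_contra! hle
    have h1 := h.near _ (h.ray_mem hx (by linarith) hs₁0.le (hball s₁ ⟨hs₁0.le, le_rfl⟩)) hle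
    have h2 : ‖s₁ • e₀‖ = 2 * ρ := by rw [norm_smul, Real.norm_of_nonneg hs₁0.le, hs₁e]
    have h3 : ‖s₁ • e₀‖ ≤ ‖x - p‖ + ‖x - s₁ • e₀ - p‖ := by
      calc ‖s₁ • e₀‖ = ‖(x - p) - (x - s₁ • e₀ - p)‖ := by congr 1; abel
        _ ≤ _ := norm_sub_le _ _
    linarith
  have hd := h.hasDerivAt_ray (x := x) (s := 0) (by simpa using hx)
  have hev : ∀ᶠ s in 𝓝[>] (0 : ℝ), τ (x - s • e₀) < τ x := by
    have h1 := (hd.tendsto_slope.mono_left (nhdsGT_le_nhdsNE 0)).eventually_lt_const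
      (u := 0) (by simpa using hpos)
    filter_upwards [h1, self_mem_nhdsWithin] with s hs hs0
    rw [slope_def_field, sub_zero] at hs
    have h3 := (div_neg_iff.1 hs).resolve_left (fun hc => absurd hs0 (not_lt.2 hc.2.le))
    have h4 := h3.1
    rw [zero_smul, sub_zero] at h4
    linarith
  obtain ⟨s, hs1, hs2⟩ := (hev.and (Ioo_mem_nhdsGT hs₁0)).exists
  exact h.ray_no_min hx hball hs2 hs1 (by linarith) (by linarith)

/-- Two points of one leaf on the same vertical line would bound a segment on which τ has equal end
values. Since τ increases towards the past at the lower end, τ would be smaller just above it, which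
again forces an excluded interior minimum. -/
theorem eq_of_sp_eq (h : IsNearVertex I τ p e₀ tm sp κ ρ r₀) {x x' : R4} (hx : x ∈ I) (hx' : x' ∈ I)
    (hxr : τ x ≤ r₀) (hτ : τ x' = τ x) (hsp : sp x = sp x') : x = x' := by
  suffices H : ∀ x x' : R4, x ∈ I → x' ∈ I → τ x ≤ r₀ → τ x' = τ x → sp x = sp x' →
      ¬ 0 < tm (x - x') by
    have h0 : sp (x - x') = 0 := by rw [map_sub, hsp, sub_self]
    have h1 := H x x' hx hx' hxr hτ hsp
    have h2 := H x' x hx' hx (by rwa [hτ]) hτ.symm hsp.symm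
    rw [← neg_sub, map_neg] at h2
    have h3 : tm (x - x') = 0 := by linarith
    have h4 := h.eq_smul _ h0
    rw [h3, zero_smul] at h4
    exact sub_eq_zero.1 h4
  intro x x' hx hx' hxr hτ hsp hpos
  set s₁ := tm (x - x') with hs₁
  have hx'eq : x' = x - s₁ • e₀ := by
    have := h.eq_smul (x - x') (by rw [map_sub, hsp, sub_self])
    rw [hs₁, ← this]; abel
  have hxp := h.near x hx hxr
  have hxp' := h.near x' hx' (by rwa [hτ])
  have hρ := h.ρ_pos
  have hball : ∀ s ∈ Icc 0 s₁, ‖x - s • e₀ - p‖ < 4 * ρ := by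
    intro s hs
    have h1 : x - s • e₀ ∈ Metric.ball p (4 * ρ) := by
      refine (convex_ball p (4 * ρ)).segment_subset (x := x) (y := x') ?_ ?_ ?_
      · rw [mem_ball_iff_norm]; linarith
      · rw [mem_ball_iff_norm]; linarith
      · refine ⟨1 - s / s₁, s / s₁, ?_, div_nonneg hs.1 hpos.le, by ring, ?_⟩
        · rw [sub_nonneg, div_le_one hpos]; exact hs.2
        · rw [hx'eq, smul_sub, smul_smul, div_mul_cancel₀ _ hpos.ne', sub_smul, one_smul]; abel
    rwa [mem_ball_iff_norm] at h1
  have hd := h.hasDerivAt_ray (x := x) (s := s₁) (by rwa [← hx'eq])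
  have hev : ∀ᶠ s in 𝓝[<] s₁, τ (x - s • e₀) < τ (x - s₁ • e₀) := by
    have h0 : 0 < -(fderiv ℝ τ (x - s₁ • e₀) e₀) := by
      rw [← hx'eq, neg_pos]; exact h.fderiv_e₀_neg hx' (by rwa [hτ])
    have h1 := (hd.tendsto_slope.mono_left (nhdsLT_le_nhdsNE s₁)).eventually_const_lt h0
    filter_upwards [h1, self_mem_nhdsWithin] with s hs hs0
    rw [slope_def_field] at hs
    have h2 : s - s₁ < 0 := sub_neg.2 hs0
    have h3 := (div_pos_iff.1 hs).resolve_left (fun hc => by linarith [hc.2])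
    linarith [h3.1]
  obtain ⟨s, hs1, hs2⟩ := (hev.and (Ioo_mem_nhdsLT hpos)).exists
  have hτ' : τ (x - s₁ • e₀) = τ x := by rw [← hx'eq, hτ]
  exact h.ray_no_min hx hball hs2 (by linarith) hs1 (by linarith)

/-- Space components are injective on the leaf, so an inverse exists globally. The inverse function
theorem for (τ, space components) shows that its domain is open and that it is C¹. -/
theorem exists_chart (h : IsNearVertex I τ p e₀ tm sp κ ρ r₀) {r : ℝ} (hr : r ≤ r₀) :
    ∃ (D : Set R3) (φ : R3 → R4), IsChart {x ∈ I | τ x = r} univ D φ (fun x => sp (x - p)) ∧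
      ∀ y ∈ D, ∀ v, fderiv ℝ τ (φ y) (fderiv ℝ φ y v) = 0 ∧ sp (fderiv ℝ φ y v) = v := by
  classical
  set S := {x ∈ I | τ x = r} with hS
  set P : R4 → R3 := fun x => sp (x - p) with hP
  have hPc : ContDiff ℝ 1 P := sp.contDiff.comp (contDiff_id.sub contDiff_const)
  have hPd : ∀ x, HasFDerivAt P sp x := fun x =>
    sp.hasFDerivAt.comp x ((hasFDerivAt_id x).sub_const p)
  have hinj : InjOn P S := by
    intro x hx x' hx' hxx
    refine h.eq_of_sp_eq hx.1 hx'.1 (hx.2.trans_le hr) (hx'.2.trans hx.2.symm) ?_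
    simpa [hP] using hxx
  set φ : R3 → R4 := Function.invFunOn P S with hφ
  have hφP : ∀ x ∈ S, φ (P x) = x := fun x hx => hinj.leftInvOn_invFunOn hx
  have hkey : ∀ q ∈ S, P '' S ∈ 𝓝 (P q) ∧ ContDiffAt ℝ 1 φ (P q) := by
    intro q hq
    have hτq := h.contDiffAt q hq.1
    let F : R4 →L[ℝ] ℝ × R3 := (fderiv ℝ τ q).prod sp
    have hF : LinearMap.ker (F : R4 →ₗ[ℝ] ℝ × R3) = ⊥ := by
      refine LinearMap.ker_eq_bot'.2 fun v hv => ?_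
      have h1 : fderiv ℝ τ q v = 0 := congrArg Prod.fst hv
      have h2 : sp v = 0 := congrArg Prod.snd hv
      have h3 := h.eq_smul v h2
      rw [h3, map_smul, smul_eq_mul] at h1
      have h4 := (mul_eq_zero.1 h1).resolve_right (h.fderiv_e₀_ne_zero hq.1 (hq.2.trans_le hr))
      rw [h3, h4, zero_smul]
    let F' : R4 ≃L[ℝ] ℝ × R3 := (LinearEquiv.ofInjectiveOfFinrankEq (F : R4 →ₗ[ℝ] ℝ × R3)
      (LinearMap.ker_eq_bot.1 hF) (by simp)).toContinuousLinearEquiv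
    let Φ : R4 → ℝ × R3 := fun x => (τ x, P x)
    have hΦ : ContDiffAt ℝ 1 Φ q := hτq.prodMk hPc.contDiffAt
    have hΦd : HasFDerivAt Φ (F' : R4 →L[ℝ] ℝ × R3) q :=
      (hτq.differentiableAt one_ne_zero).hasFDerivAt.prodMk (hPd q)
    let E := hΦ.toOpenPartialHomeomorph Φ hΦd one_ne_zero
    have hqE : q ∈ E.source := hΦ.mem_toOpenPartialHomeomorph_source hΦd one_ne_zero
    have hψ : ContDiffAt ℝ 1 E.symm (Φ q) := hΦ.to_localInverse hΦd one_ne_zero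
    have hψq : E.symm (Φ q) = q := E.left_inv hqE
    have hev : ∀ᶠ z in 𝓝 (Φ q), Φ (E.symm z) = z ∧ E.symm z ∈ I := by
      refine Filter.Eventually.and ?_ ?_
      · filter_upwards [E.open_target.mem_nhds (E.map_source hqE)] with z hz using E.right_inv hz
      · refine hψ.continuousAt.eventually_mem ?_
        rw [hψq]
        exact h.isOpen.mem_nhds hq.1
    have hΦq : Φ q = (r, P q) := Prod.ext hq.2 rfl
    rw [hΦq] at hev hψ
    have hmk : ContDiffAt ℝ 1 (fun y : R3 => (r, y)) (P q) := contDiffAt_const.prodMk contDiffAt_id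
    have hev2 : ∀ᶠ y in 𝓝 (P q), E.symm (r, y) ∈ S ∧ P (E.symm (r, y)) = y := by
      filter_upwards [hmk.continuousAt.eventually hev] with y hy
      exact ⟨⟨hy.2, congrArg Prod.fst hy.1⟩, congrArg Prod.snd hy.1⟩
    constructor
    · filter_upwards [hev2] with y hy using ⟨_, hy.1, hy.2⟩
    · refine (hψ.comp (P q) hmk).congr_of_eventuallyEq ?_
      filter_upwards [hev2] with y hy
      have := hφP _ hy.1
      rwa [hy.2] at this
  have hch : IsChart S univ (P '' S) φ P :=
    { isOpen_source := isOpen_univ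
      isOpen_target := by
        refine isOpen_iff_mem_nhds.2 ?_
        rintro _ ⟨q, hq, rfl⟩
        exact (hkey q hq).1
      contDiffOn_param := by
        rintro _ ⟨q, hq, rfl⟩
        exact (hkey q hq).2.contDiffWithinAt
      contDiffOn_proj := hPc.contDiffOn
      mapsTo_param := by
        rintro _ ⟨q, hq, rfl⟩
        rw [hφP q hq]
        exact ⟨hq, mem_univ _⟩
      mapsTo_proj := fun x hx => ⟨x, hx.1, rfl⟩
      proj_param := by
        rintro _ ⟨q, hq, rfl⟩
        rw [hφP q hq]
      param_proj := fun x hx => hφP x hx.1 }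
  refine ⟨P '' S, φ, hch, fun y hy v => ?_⟩
  have hφd : HasFDerivAt φ (fderiv ℝ φ y) y :=
    ((hch.contDiffOn_param.differentiableOn one_ne_zero).differentiableAt
      (hch.isOpen_target.mem_nhds hy)).hasFDerivAt
  have hyS : φ y ∈ S := (hch.mapsTo_param hy).1
  constructor
  · have h1 := ((h.contDiffAt _ hyS.1).differentiableAt one_ne_zero).hasFDerivAt.comp y hφd
    have h2 : HasFDerivAt (fun _ : R3 => r) (0 : R3 →L[ℝ] ℝ) y := hasFDerivAt_const r y
    have h3 := h1.unique (h2.congr_of_eventuallyEq (by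
      filter_upwards [hch.isOpen_target.mem_nhds hy] with z hz
      exact (hch.mapsTo_param hz).1.2))
    exact DFunLike.congr_fun h3 v
  · have h1 := (hPd (φ y)).comp y hφd
    have h3 := h1.unique ((hasFDerivAt_id y).congr_of_eventuallyEq (by
      filter_upwards [hch.isOpen_target.mem_nhds hy] with z hz
      exact hch.proj_param z hz))
    exact DFunLike.congr_fun h3 v

/-- If a segment leaves the domain of the graph, then its first exit point lies under a point of the
closure of the leaf, outside the leaf, and the graph has slope at most `κ` up to there. -/
theorem exists_exit (h : IsNearVertex I τ p e₀ tm sp κ ρ r₀) {r : ℝ} (hr : r ≤ r₀) {D : Set R3}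
    {φ : R3 → R4} (hch : IsChart {x ∈ I | τ x = r} univ D φ (fun x => sp (x - p)))
    (hφ : ∀ y ∈ D, ∀ v, fderiv ℝ τ (φ y) (fderiv ℝ φ y v) = 0 ∧ sp (fderiv ℝ φ y v) = v)
    {K : Set R4} (hK : IsCompact K) (hSK : {x ∈ I | τ x = r} ⊆ K) (hKτ : ∀ x ∈ K, τ x = r)
    {y w : R3} (hy : y ∈ D) {l : ℝ} (hl : ¬ ∀ s ∈ Icc 0 l, y + s • w ∈ D) :
    ∃ s ∈ Ioc 0 l, ∃ z ∈ K, z ∉ I ∧ sp (z - p) = y + s • w ∧ |tm (z - φ y)| ≤ κ * ‖w‖ * s := by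
  have hline : Continuous fun s : ℝ => y + s • w := by fun_prop
  set E := Icc 0 l ∩ (fun s : ℝ => y + s • w) ⁻¹' Dᶜ with hE
  have hEc : IsCompact E := isCompact_Icc.inter_right (hch.isOpen_target.isClosed_compl.preimage hline)
  have hEn : E.Nonempty := by
    push Not at hl
    obtain ⟨s, hs, hsD⟩ := hl
    exact ⟨s, hs, hsD⟩
  obtain ⟨s, hsE, hsmin⟩ := hEc.exists_isLeast hEn
  have hs0 : 0 < s := by
    refine lt_of_le_of_ne hsE.1.1 ?_
    rintro rfl
    have := hsE.2
    simp [hy] at this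
  have hbefore : ∀ t ∈ Ico 0 s, y + t • w ∈ D := by
    intro t ht
    by_contra hD
    exact absurd (hsmin ⟨⟨ht.1, ht.2.le.trans hsE.1.2⟩, hD⟩) (not_le.2 ht.2)
  have hbound : ∀ t ∈ Ico 0 s, |tm (φ (y + t • w) - φ y)| ≤ κ * ‖w‖ * t := by
    intro t ht
    have hd : ∀ a ∈ Icc 0 t, HasDerivWithinAt (fun a : ℝ => tm (φ (y + a • w)))
        (tm (fderiv ℝ φ (y + a • w) w)) (Icc 0 t) a := by
      intro a ha
      have haD := hbefore a ⟨ha.1, ha.2.trans_lt ht.2⟩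
      have h1 : HasFDerivAt φ (fderiv ℝ φ (y + a • w)) (y + a • w) :=
        ((hch.contDiffOn_param.differentiableOn one_ne_zero).differentiableAt
          (hch.isOpen_target.mem_nhds haD)).hasFDerivAt
      have h2 : HasDerivAt (fun a : ℝ => y + a • w) w a := by
        simpa using ((hasDerivAt_id a).smul_const w).const_add y
      exact (tm.hasFDerivAt.comp_hasDerivAt a (h1.comp_hasDerivAt a h2)).hasDerivWithinAt
    have h1 := (convex_Icc 0 t).norm_image_sub_le_of_norm_hasDerivWithin_le (C := κ * ‖w‖) hd
      (fun a ha => by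
        have haD := hbefore a ⟨ha.1, ha.2.trans_lt ht.2⟩
        have haS := (hch.mapsTo_param haD).1
        have h3 := h.slope _ haS.1 (haS.2.trans_le hr) _ (hφ _ haD w).1
        rwa [(hφ _ haD w).2] at h3) (x := 0) (y := t) ⟨le_rfl, ht.1⟩ ⟨ht.1, le_rfl⟩
    simpa [abs_of_nonneg ht.1, map_sub] using h1
  -- Parameters increasing to the exit time s. The graph points over them lie in the compact K and
  -- accumulate at a point z over y + s • w. If z were in I it would be on the leaf, and y + s • w
  -- would be in the domain.
  let t : ℕ → ℝ := fun n => s * (1 - 1 / ((n : ℝ) + 1))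
  have ht : ∀ n, t n ∈ Ico 0 s := by
    intro n
    have h1 : (0 : ℝ) < 1 / ((n : ℝ) + 1) := by positivity
    have h2 : 1 / ((n : ℝ) + 1) ≤ 1 := by
      rw [div_le_one (by positivity)]; linarith [n.cast_nonneg (α := ℝ)]
    refine ⟨mul_nonneg hs0.le (by linarith), ?_⟩
    simp only [t]
    nlinarith
  have htlim : Tendsto t atTop (𝓝 s) := by
    have := ((tendsto_one_div_add_atTop_nhds_zero_nat (𝕜 := ℝ)).const_sub 1).const_mul s
    rw [sub_zero, mul_one] at this
    exact this
  have hqS : ∀ n, φ (y + t n • w) ∈ {x ∈ I | τ x = r} := fun n =>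
    (hch.mapsTo_param (hbefore _ (ht n))).1
  obtain ⟨z, hz, ν, hν, hlim⟩ := hK.tendsto_subseq fun n => hSK (hqS n)
  have htν : Tendsto (t ∘ ν) atTop (𝓝 s) := htlim.comp hν.tendsto_atTop
  have hspz : sp (z - p) = y + s • w := by
    have h1 : Tendsto (fun n => sp (φ (y + t (ν n) • w) - p)) atTop (𝓝 (sp (z - p))) :=
      (sp.continuous.tendsto _).comp (hlim.sub_const p)
    have h2 : Tendsto (fun n => y + t (ν n) • w) atTop (𝓝 (y + s • w)) :=
      (hline.tendsto s).comp htν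
    refine tendsto_nhds_unique h1 (h2.congr fun n => ?_)
    exact (hch.proj_param _ (hbefore _ (ht _))).symm
  refine ⟨s, ⟨hs0, hsE.1.2⟩, z, hz, fun hzI => hsE.2 ?_, hspz, ?_⟩
  · have := hch.mapsTo_proj (x := z) ⟨⟨hzI, hKτ z hz⟩, mem_univ _⟩
    rwa [hspz] at this
  · have h1 : Tendsto (fun n => |tm (φ (y + t (ν n) • w) - φ y)|) atTop (𝓝 |tm (z - φ y)|) :=
      ((tm.continuous.tendsto _).comp (hlim.sub_const (φ y))).abs
    have h2 : Tendsto (fun n => κ * ‖w‖ * t (ν n)) atTop (𝓝 (κ * ‖w‖ * s)) := htν.const_mul _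
    exact le_of_tendsto_of_tendsto' h1 h2 fun n => hbound _ (ht _)

end IsNearVertex

/-! ### Sectors and segments towards the axis -/

/-- The vectors -θ + η·(standard basis) have determinant η²(η - Σθᵢ), so they are independent as
soon as η avoids 0 and Σθᵢ; η is α, or α/2 if α is the forbidden value. -/
theorem exists_independent_near (θ : R3) {α : ℝ} (hα : 0 < α) :
    ∃ e : Fin 3 → R3, LinearIndependent ℝ e ∧ ∀ i, ‖e i + θ‖ ≤ α := by
  obtain ⟨η, hη0, hηα, hηθ⟩ : ∃ η, 0 < η ∧ η ≤ α ∧ η ≠ ∑ i, θ i := by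
    by_cases h : α = ∑ i, θ i
    · exact ⟨α / 2, by positivity, by linarith, by rw [← h]; linarith⟩
    · exact ⟨α, hα, le_rfl, h⟩
  refine ⟨fun i => -θ + η • EuclideanSpace.single i 1, ?_, fun i => ?_⟩
  · rw [Fintype.linearIndependent_iff]
    intro c hc
    have h1 : ∀ j, η * c j = (∑ i, c i) * θ j := by
      intro j
      have := congrArg (fun y : R3 => y j) hc
      simp only [Fin.sum_univ_three, PiLp.add_apply, PiLp.smul_apply, PiLp.neg_apply, smul_eq_mul,
        PiLp.zero_apply, PiLp.single_apply] at this ⊢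
      fin_cases j <;> simp at this ⊢ <;> linarith
    have h2 : η * ∑ i, c i = (∑ i, c i) * ∑ i, θ i := by
      rw [Finset.mul_sum, Finset.mul_sum]
      exact Finset.sum_congr rfl fun j _ => h1 j
    have h3 : (∑ i, c i) * (η - ∑ i, θ i) = 0 := by linear_combination h2
    have h4 : ∑ i, c i = 0 := (mul_eq_zero.1 h3).resolve_right (sub_ne_zero.2 hηθ)
    intro j
    have := h1 j
    rw [h4, zero_mul] at this
    exact (mul_eq_zero.1 this).resolve_left hη0.ne'
  · have : -θ + η • EuclideanSpace.single i (1 : ℝ) + θ = η • EuclideanSpace.single i (1 : ℝ) := by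
      abel
    rw [this, norm_smul, Real.norm_of_nonneg hη0.le]
    simpa using hηα

/-- Finitely many sectors cover `ℝ³`, each with an independent triple of directions opposite to it. -/
theorem exists_sectors {α : ℝ} (hα : 0 < α) :
    ∃ (N : ℕ) (θ : Fin N → R3) (e : Fin N → Fin 3 → R3), (∀ j, ‖θ j‖ = 1) ∧
      (∀ j, LinearIndependent ℝ (e j)) ∧ (∀ j i, ‖e j i + θ j‖ ≤ α) ∧
      ∀ y : R3, ∃ j, ‖y - ‖y‖ • θ j‖ ≤ α * ‖y‖ := by
  obtain ⟨t, ht, hfin, hcov⟩ := (isCompact_sphere (0 : R3) 1).finite_cover_balls hα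
  have := hfin.fintype
  let q := (Fintype.equivFin t).symm
  choose e he1 he2 using fun j : Fin (Fintype.card t) =>
    exists_independent_near (q j : R3) hα
  have hunit : ∀ u : R3, ‖u‖ = 1 → ∃ j, ‖u - q j‖ ≤ α := by
    intro u hu
    have := hcov (show u ∈ Metric.sphere (0 : R3) 1 by simpa using hu)
    simp only [mem_iUnion] at this
    obtain ⟨x, hx, hux⟩ := this
    refine ⟨q.symm ⟨x, hx⟩, ?_⟩
    rw [mem_ball_iff_norm] at hux
    simpa using hux.le
  refine ⟨_, fun j => q j, e, fun j => by simpa using ht (q j).2, he1, he2, fun y => ?_⟩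
  by_cases hy : y = 0
  · obtain ⟨j, -⟩ := hunit (EuclideanSpace.single 0 1) (by simp)
    exact ⟨j, by simp [hy]⟩
  · have hy0 : ‖y‖ ≠ 0 := norm_ne_zero_iff.2 hy
    obtain ⟨j, hj⟩ := hunit (‖y‖⁻¹ • y) (by rw [norm_smul, norm_inv, norm_norm, inv_mul_cancel₀ hy0])
    refine ⟨j, ?_⟩
    have h1 : y - ‖y‖ • (q j : R3) = ‖y‖ • (‖y‖⁻¹ • y - q j) := by
      rw [smul_sub, smul_smul, mul_inv_cancel₀ hy0, one_smul]
    rw [h1, norm_smul, norm_norm, mul_comm]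
    gcongr

/-- A point `y` close to `r a ω` in the sector of `θ`: a direction opposite to `θ` is opposite to
`ω`. -/
theorem norm_add_le_of_sector {y w θ ω : R3} {a r α d A : ℝ} (hω : ‖ω‖ = 1) (hr : 0 < r)
    (hA : 0 < A) (hAa : A ≤ a) (hd : ‖y - (r * a) • ω‖ ≤ d * r) (hdA : 4 * d ≤ α * A) (hα : α ≤ 1)
    (hθ : ‖y - ‖y‖ • θ‖ ≤ α * ‖y‖) (hw : ‖w + θ‖ ≤ α) : ‖w + ω‖ ≤ 3 * α := by
  have ha : 0 < a := hA.trans_le hAa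
  have hd0 : 0 ≤ d := by
    have : 0 ≤ d * r := (norm_nonneg _).trans hd
    exact nonneg_of_mul_nonneg_left this hr
  have h1 : ‖(r * a) • ω‖ = r * a := by
    rw [norm_smul, hω, mul_one, Real.norm_of_nonneg (by positivity)]
  have h2 : |‖y‖ - r * a| ≤ d * r := by
    have := abs_norm_sub_norm_le y ((r * a) • ω)
    rw [h1] at this
    exact this.trans hd
  have h3 : ‖y - ‖y‖ • ω‖ ≤ 2 * (d * r) := by
    calc ‖y - ‖y‖ • ω‖ = ‖(y - (r * a) • ω) - (‖y‖ - r * a) • ω‖ := by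
          rw [sub_smul]; congr 1; abel
      _ ≤ ‖y - (r * a) • ω‖ + ‖(‖y‖ - r * a) • ω‖ := norm_sub_le _ _
      _ ≤ d * r + d * r := by
          refine add_le_add hd ?_
          rw [norm_smul, hω, mul_one, Real.norm_eq_abs]; exact h2
      _ = _ := by ring
  have hrA : r * A ≤ r * a := by gcongr
  have hαA : α * A ≤ A := mul_le_of_le_one_left hA.le hα
  have hyA : r * A / 2 ≤ ‖y‖ := by
    have := (abs_le.1 h2).1
    nlinarith
  have hypos : 0 < ‖y‖ := lt_of_lt_of_le (by positivity) hyA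
  have hα0 : 0 ≤ α := (norm_nonneg _).trans hw
  have h4 : ‖y‖ * ‖θ - ω‖ ≤ ‖y‖ * (2 * α) := by
    calc ‖y‖ * ‖θ - ω‖ = ‖(y - ‖y‖ • ω) - (y - ‖y‖ • θ)‖ := by
          rw [← norm_norm y, ← norm_smul, norm_norm, smul_sub]; congr 1; abel
      _ ≤ ‖y - ‖y‖ • ω‖ + ‖y - ‖y‖ • θ‖ := norm_sub_le _ _
      _ ≤ 2 * (d * r) + α * ‖y‖ := add_le_add h3 hθ
      _ ≤ ‖y‖ * (2 * α) := by
          have : 2 * (d * r) ≤ α * (r * A / 2) := by nlinarith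
          nlinarith [mul_le_mul_of_nonneg_left hyA hα0]
  have h5 : ‖θ - ω‖ ≤ 2 * α := le_of_mul_le_mul_left h4 hypos
  calc ‖w + ω‖ = ‖(w + θ) - (θ - ω)‖ := by congr 1; abel
    _ ≤ ‖w + θ‖ + ‖θ - ω‖ := norm_sub_le _ _
    _ ≤ 3 * α := by linarith

namespace IsNearVertex

variable {I : Set R4} {τ : R4 → ℝ} {p e₀ : R4} {tm : R4 →L[ℝ] ℝ} {sp : R4 →L[ℝ] R3} {κ ρ r₀ : ℝ}

set_option maxHeartbeats 1000000 in
/-- Segments of length proportional to `r`, towards the axis, stay in the domain of the leaf `Σ_r`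
as a graph: otherwise a narrow cone of a point of the leaf would contain a point of the light cone. -/
theorem segment_subset (h : IsNearVertex I τ p e₀ tm sp κ ρ r₀) {r : ℝ} (hr0 : 0 < r) (hr : r ≤ r₀)
    {D : Set R3} {φ : R3 → R4} (hch : IsChart {x ∈ I | τ x = r} univ D φ (fun x => sp (x - p)))
    (hφ : ∀ y ∈ D, ∀ v, fderiv ℝ τ (φ y) (fderiv ℝ φ y v) = 0 ∧ sp (fderiv ℝ φ y v) = v)
    {K : Set R4} (hK : IsCompact K) (hSK : {x ∈ I | τ x = r} ⊆ K) (hKτ : ∀ x ∈ K, τ x = r)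
    {Ψ : ℝ → R3 → R4} (hKΨ : ∀ x ∈ K, x ∉ I → ∃ ω : R3, ‖ω‖ = 1 ∧ x = Ψ r ω)
    {a : R3 → ℝ} {n : R3 → R4} {A L k : ℝ} (hA : 0 < A) (hL : 0 ≤ L) (hk : 0 ≤ k)
    (htm : ∀ v, |tm v| ≤ k * ‖v‖) (hsp : ∀ v, ‖sp v‖ ≤ k * ‖v‖)
    (ha : ∀ ω : R3, ‖ω‖ = 1 → A ≤ a ω)
    (hn : ∀ ω : R3, ‖ω‖ = 1 → tm (n ω) = -a ω ∧ sp (n ω) = a ω • ω)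
    (hΨp : ∀ ω : R3, ‖ω‖ = 1 → Ψ 0 ω = p)
    (hΨ : ∀ ω : R3, ‖ω‖ = 1 → ∀ s s', 0 ≤ s → s ≤ s' → s' ≤ 2 * r →
      ‖Ψ s' ω - Ψ s ω - (s' - s) • n ω‖ ≤ L * s' * (s' - s) ∧ ‖Ψ s' ω - p‖ < 4 * ρ)
    (hΨI : ∀ ω : R3, ‖ω‖ = 1 → ∀ s, 0 < s → s ≤ 2 * r → Ψ s ω ∉ I)
    (hκ0 : 0 ≤ κ) (hκ : κ < 1) {α c : ℝ} (hα : α = (1 - κ) / 12) (hc : c = α * A / 12)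
    (hr1 : k * L * r ≤ c) (hr2 : 2 * (k * L) * r ≤ (1 - κ) / 8 * A)
    {y w θ : R3} (hθ : ‖θ‖ = 1) (hy : y ∈ D) (hyθ : ‖y - ‖y‖ • θ‖ ≤ α * ‖y‖) (hw : ‖w + θ‖ ≤ α) :
    ∀ s ∈ Icc 0 (c * r), y + s • w ∈ D := by
  by_contra hne
  obtain ⟨s, ⟨hs0, hsl⟩, z, hzK, hzI, hspz, hzt⟩ := h.exists_exit hr hch hφ hK hSK hKτ hy hne
  obtain ⟨ω, hω, rfl⟩ := hKΨ z hzK hzI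
  have hα0 : 0 < α := by rw [hα]; linarith
  have hα1 : α ≤ 1 := by rw [hα]; linarith
  have hc0 : 0 < c := by rw [hc]; positivity
  have hwn : ‖w‖ ≤ 1 + α := by
    calc ‖w‖ = ‖(w + θ) - θ‖ := by congr 1; abel
      _ ≤ ‖w + θ‖ + ‖θ‖ := norm_sub_le _ _
      _ ≤ 1 + α := by rw [hθ]; linarith
  have haω := ha ω hω
  have haω0 : 0 < a ω := hA.trans_le haω
  obtain ⟨hn1, hn2⟩ := hn ω hω
  -- The cone point differs in space from r·a(ω)·ω by at most c·r, and the segment has length at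
  -- most c·r(1 + α) ≤ 2c·r. With d = 3c, the choice c = αA/12 is exactly what
  -- `norm_add_le_of_sector` requires.
  have hd : ‖y - (r * a ω) • ω‖ ≤ (3 * c) * r := by
    have h1 := (hΨ ω hω 0 r le_rfl hr0.le (by linarith)).1
    rw [hΨp ω hω, sub_zero] at h1
    have h2 := hsp (Ψ r ω - p - r • n ω)
    rw [map_sub, map_smul, hspz, hn2, smul_smul] at h2
    have h3 : ‖s • w‖ ≤ c * r * (1 + α) := by
      rw [norm_smul, Real.norm_of_nonneg hs0.le]; gcongr
    have h4 : ‖y + s • w - (r * a ω) • ω‖ ≤ c * r := by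
      calc _ ≤ k * (L * r * r) := h2.trans (by gcongr)
        _ = (k * L * r) * r := by ring
        _ ≤ c * r := by gcongr
    calc ‖y - (r * a ω) • ω‖ = ‖(y + s • w - (r * a ω) • ω) - s • w‖ := by congr 1; abel
      _ ≤ ‖y + s • w - (r * a ω) • ω‖ + ‖s • w‖ := norm_sub_le _ _
      _ ≤ c * r + c * r * (1 + α) := add_le_add h4 h3
      _ ≤ (3 * c) * r := by nlinarith [mul_pos hc0 hr0]
  have hwω : ‖w + ω‖ ≤ 3 * α :=
    norm_add_le_of_sector hω hr0 hA haω hd (by rw [hc]; linarith) hα1 hyθ hw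
  -- To first order the generator, followed for the parameter σ, moves by s·ω in space and by -s in
  -- time. Together with the displacement s·w up to the exit, the total in space is s(w + ω), which
  -- is small because w is nearly -ω.
  set σ := s / a ω with hσ
  have hσ0 : 0 < σ := by positivity
  have hσa : σ * a ω = s := by rw [hσ]; field_simp
  have hσA : σ * A ≤ s := by rw [← hσa]; gcongr
  have hσr : σ ≤ r := by
    have h1 : σ * A ≤ r * A := by
      refine hσA.trans (hsl.trans ?_)
      rw [hc, mul_comm r A]
      gcongr
      nlinarith
    exact le_of_mul_le_mul_right h1 hA
  obtain ⟨hE, hball⟩ := hΨ ω hω r (r + σ) hr0.le (by linarith) (by linarith)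
  rw [add_sub_cancel_left] at hE
  set E := Ψ (r + σ) ω - Ψ r ω - σ • n ω with hEdef
  have hEs : k * ‖E‖ ≤ (1 - κ) / 8 * s := by
    calc k * ‖E‖ ≤ k * (L * (r + σ) * σ) := by gcongr
      _ ≤ k * (L * (2 * r) * σ) := by gcongr; linarith
      _ = 2 * (k * L) * r * σ := by ring
      _ ≤ (1 - κ) / 8 * A * σ := by gcongr
      _ = (1 - κ) / 8 * (σ * A) := by ring
      _ ≤ _ := by gcongr
  have hqS := (hch.mapsTo_param hy).1
  have hspq : sp (φ y - p) = y := hch.proj_param y hy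
  have hdec : Ψ (r + σ) ω - φ y = E + σ • n ω + (Ψ r ω - φ y) := by rw [hEdef]; abel
  have htmd : tm (Ψ (r + σ) ω - φ y) = tm E - s + tm (Ψ r ω - φ y) := by
    rw [hdec, map_add, map_add, map_smul, hn1, smul_eq_mul, ← hσa]; ring
  have hspd : sp (Ψ (r + σ) ω - φ y) = sp E + s • (w + ω) := by
    have h1 : sp (Ψ r ω - φ y) = s • w := by
      have : Ψ r ω - φ y = (Ψ r ω - p) - (φ y - p) := by abel
      rw [this, map_sub, hspz, hspq]; abel
    rw [hdec, map_add, map_add, map_smul, hn2, h1, smul_smul, hσa, smul_add]; abel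
  -- The time drop s loses κ‖w‖s ≤ (κ + α)s to the slope of the leaf and (1 - κ)s/8 to the Taylor
  -- error: 1 - 1/12 - 1/8 = 19/24. The space displacement below is at most 1/8 + 3/12 = 3/8 of (1 -
  -- κ)s, which is less than half of 19/24, as the narrow cone requires.
  have ht1 : -tm (Ψ (r + σ) ω - φ y) ≥ 19 / 24 * ((1 - κ) * s) := by
    have h1 := (abs_le.1 ((htm E).trans hEs)).2
    have h2 := (abs_le.1 hzt).2
    have h3 : κ * ‖w‖ * s ≤ (κ + α) * s := by
      gcongr
      nlinarith
    rw [htmd]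
    rw [hα] at h3
    nlinarith
  have hs1 : ‖sp (Ψ (r + σ) ω - φ y)‖ ≤ 3 / 8 * ((1 - κ) * s) := by
    rw [hspd]
    calc ‖sp E + s • (w + ω)‖ ≤ ‖sp E‖ + ‖s • (w + ω)‖ := norm_add_le _ _
      _ ≤ (1 - κ) / 8 * s + s * (3 * α) := by
          refine add_le_add ((hsp E).trans hEs) ?_
          rw [norm_smul, Real.norm_of_nonneg hs0.le]
          gcongr
      _ = _ := by rw [hα]; ring
  have hpos : 0 < (1 - κ) * s := mul_pos (by linarith) hs0
  refine hΨI ω hω (r + σ) (by linarith) (by linarith)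
    (h.step (φ y) hqS.1 _ ?_ hball (by linarith) (by linarith))
  have := h.near _ hqS.1 (hqS.2.trans_le hr)
  linarith [h.ρ_pos]

end IsNearVertex

/-! ### Lorentz coordinates and geodesics at the vertex -/

/-- The time and space components of vectors in a Lorentz frame. -/
theorem exists_lorentz_coordinates {B : R4 →L[ℝ] R4 →L[ℝ] ℝ} {e : Fin 4 → R4}
    (he : IsLorentzFrame B e) : ∃ (tm : R4 →L[ℝ] ℝ) (sp : R4 →L[ℝ] R3) (k : ℝ), 0 < k ∧
      (∀ v, tm v = B (e 0) v) ∧ tm (e 0) = 1 ∧ sp (e 0) = 0 ∧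
      (∀ v w, B v w = tm v * tm w - inner ℝ (sp v) (sp w)) ∧ (∀ v, |tm v| ≤ k * ‖v‖) ∧
      (∀ v, ‖sp v‖ ≤ k * ‖v‖) ∧ (∀ v, ‖v‖ ≤ k * (|tm v| + ‖sp v‖)) ∧
      ∀ ω : R3, tm (-e 0 + ω 0 • e 1 + ω 1 • e 2 + ω 2 • e 3) = -1 ∧
        sp (-e 0 + ω 0 • e 1 + ω 1 • e 2 + ω 2 • e 3) = ω := by
  have hli : LinearIndependent ℝ e := by
    rw [Fintype.linearIndependent_iff]
    intro c hc i
    have h1 := congrArg (B (e i)) hc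
    rw [map_sum, map_zero] at h1
    simp only [map_smul, he i, smul_eq_mul, mul_ite, mul_zero, Finset.sum_ite_eq, Finset.mem_univ,
      if_true] at h1
    by_cases hi : i = 0 <;> simpa [hi] using h1
  let b := basisOfLinearIndependentOfCardEqFinrank hli (by simp)
  have hb : ∀ j, b j = e j := fun j => by simp [b]
  let tm : R4 →L[ℝ] ℝ := B (e 0)
  let sp : R4 →L[ℝ] R3 := -((B (e 1)).smulRight (EuclideanSpace.single 0 1) +
    (B (e 2)).smulRight (EuclideanSpace.single 1 1) +
    (B (e 3)).smulRight (EuclideanSpace.single 2 1))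
  have hsp0 : ∀ v, sp v 0 = -(B (e 1) v) := fun v => by simp [sp]
  have hsp1 : ∀ v, sp v 1 = -(B (e 2) v) := fun v => by simp [sp]
  have hsp2 : ∀ v, sp v 2 = -(B (e 3) v) := fun v => by simp [sp]
  have hdec : ∀ v, v = tm v • e 0 + sp v 0 • e 1 + sp v 1 • e 2 + sp v 2 • e 3 := by
    intro v
    have hv : v = ∑ j, b.repr v j • e j := by
      conv_lhs => rw [← b.sum_repr v]
      simp [hb]
    have hc : ∀ i, B (e i) v = b.repr v i * (if i = 0 then 1 else -1) := by
      intro i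
      conv_lhs => rw [hv]
      simp only [map_sum, map_smul, he i, smul_eq_mul, mul_ite, mul_zero, Finset.sum_ite_eq,
        Finset.mem_univ, if_true]
    have c0 : tm v = b.repr v 0 := by simpa using hc 0
    have c1 : sp v 0 = b.repr v 1 := by rw [hsp0, hc 1]; simp
    have c2 : sp v 1 = b.repr v 2 := by rw [hsp1, hc 2]; simp
    have c3 : sp v 2 = b.repr v 3 := by rw [hsp2, hc 3]; simp
    rw [c0, c1, c2, c3]
    conv_lhs => rw [hv, Fin.sum_univ_four]
  have hB : ∀ v w, B v w = tm v * tm w - inner ℝ (sp v) (sp w) := by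
    intro v w
    conv_lhs => rw [hdec v]
    simp only [map_add, map_smul, add_apply, smul_apply, smul_eq_mul, PiLp.inner_apply,
      Fin.sum_univ_three, hsp0 w, hsp1 w, hsp2 w, RCLike.inner_apply, conj_trivial]
    simp only [tm]
    ring
  have h00 : ∀ i j, B (e i) (e j) = if i = j then (if i = 0 then 1 else -1) else 0 := he
  refine ⟨tm, sp, ‖tm‖ + ‖sp‖ + ∑ j, ‖e j‖ + 1, by positivity, fun v => rfl, by simp [tm, h00], ?_,
    hB, fun v => ?_, fun v => ?_, fun v => ?_, fun ω => ⟨by simp [tm, h00], ?_⟩⟩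
  · ext i
    fin_cases i
    · simpa [h00] using hsp0 (e 0)
    · simpa [h00] using hsp1 (e 0)
    · simpa [h00] using hsp2 (e 0)
  · refine (tm.le_opNorm v).trans ?_
    gcongr
    have : 0 ≤ ‖sp‖ + ∑ j, ‖e j‖ := by positivity
    linarith
  · refine (sp.le_opNorm v).trans ?_
    gcongr
    have : 0 ≤ ‖tm‖ + ∑ j, ‖e j‖ := by positivity
    linarith
  · have hle : ∀ i, |sp v i| ≤ ‖sp v‖ := fun i => PiLp.norm_apply_le (sp v) i
    calc ‖v‖ = ‖tm v • e 0 + sp v 0 • e 1 + sp v 1 • e 2 + sp v 2 • e 3‖ := by rw [← hdec v]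
      _ ≤ ‖tm v • e 0‖ + ‖sp v 0 • e 1‖ + ‖sp v 1 • e 2‖ + ‖sp v 2 • e 3‖ := norm_add₄_le
      _ = |tm v| * ‖e 0‖ + |sp v 0| * ‖e 1‖ + |sp v 1| * ‖e 2‖ + |sp v 2| * ‖e 3‖ := by
          simp only [norm_smul, Real.norm_eq_abs]
      _ ≤ (|tm v| + ‖sp v‖) * ‖e 0‖ + (|tm v| + ‖sp v‖) * ‖e 1‖ + (|tm v| + ‖sp v‖) * ‖e 2‖ +
            (|tm v| + ‖sp v‖) * ‖e 3‖ := by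
          have h1 := abs_nonneg (tm v)
          gcongr
          · linarith [norm_nonneg (sp v)]
          · linarith [hle 0]
          · linarith [hle 1]
          · linarith [hle 2]
      _ = (∑ j, ‖e j‖) * (|tm v| + ‖sp v‖) := by rw [Fin.sum_univ_four]; ring
      _ ≤ _ := by
          gcongr
          have : 0 ≤ ‖tm‖ + ‖sp‖ := by positivity
          linarith
  · ext i
    fin_cases i
    · simpa [h00] using hsp0 (-e 0 + ω 0 • e 1 + ω 1 • e 2 + ω 2 • e 3)
    · simpa [h00] using hsp1 (-e 0 + ω 0 • e 1 + ω 1 • e 2 + ω 2 • e 3)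
    · simpa [h00] using hsp2 (-e 0 + ω 0 • e 1 + ω 1 • e 2 + ω 2 • e 3)

theorem exists_eventually_fderiv_le {F : Type*} [NormedAddCommGroup F] [NormedSpace ℝ F]
    {f : R4 → F} {p : R4} (hf : ContDiffAt ℝ 1 f p) :
    ∃ G : ℝ, 0 ≤ G ∧ ∀ᶠ x in 𝓝 p, ∀ u, ‖fderiv ℝ f x u‖ ≤ G * ‖u‖ := by
  refine ⟨‖fderiv ℝ f p‖ + 1, by positivity, ?_⟩
  have : ContinuousAt (fun z => ‖fderiv ℝ f z‖) p := (hf.continuousAt_fderiv one_ne_zero).norm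
  exact (this.eventually_lt_const (lt_add_one _)).mono fun _ h u =>
    (ContinuousLinearMap.le_opNorm _ u).trans (by gcongr)

/-- Uniform first order Taylor bounds for geodesics issued from a point. -/
theorem geodesic_bounds {U : Set R4} {g : BilinField} {p : R4} {ρ G k A R₁ : ℝ} (hρ : 0 < ρ)
    (hG : 0 ≤ G) (hk : 0 ≤ k) (hA : 0 ≤ A) (hR₁ : 0 < R₁)
    (hfd : ∀ x, ‖x - p‖ < ρ → ∀ u, ‖fderiv ℝ g x u‖ ≤ G * ‖u‖)
    (hnd : ∀ x, ‖x - p‖ < ρ → ∀ v, ‖v‖ ≤ k * ‖g x v‖) :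
    ∃ L s₁ : ℝ, 0 ≤ L ∧ 0 < s₁ ∧ s₁ < R₁ ∧ ∀ n c, ‖n‖ ≤ A → IsGeodesicFrom U g p n R₁ c →
      ∀ s s', 0 ≤ s → s ≤ s' → s' ≤ s₁ →
        ‖c s' - p‖ ≤ L * s' ∧ ‖c s' - c s - (s' - s) • n‖ ≤ L * s' * (s' - s) := by
  set M := k * (2 * G * (A + 1) ^ 2) with hM
  have hM0 : 0 ≤ M := by positivity
  set L := A + 1 + M + 1 with hL
  have hL0 : 0 < L := by positivity
  set s₁ := min (R₁ / 2) (min (ρ / 2) 1 / L) with hs₁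
  have hs₁0 : 0 < s₁ := by positivity
  have hs₁R : s₁ < R₁ := lt_of_le_of_lt (min_le_left _ _) (by linarith)
  have hLs : L * s₁ ≤ min (ρ / 2) 1 := by
    calc L * s₁ ≤ L * (min (ρ / 2) 1 / L) := by gcongr; exact min_le_right _ _
      _ = _ := by field_simp
  refine ⟨L, s₁, hL0.le, hs₁0, hs₁R, fun n c hn hgeo => ?_⟩
  obtain ⟨c', c'', hc0, hc'0, hc⟩ := hgeo
  have hmem : ∀ s ∈ Icc 0 s₁, s ∈ Ico 0 R₁ := fun s hs => ⟨hs.1, hs.2.trans_lt hs₁R⟩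
  have hder : ∀ s ∈ Ico 0 s₁, HasDerivWithinAt (fun s => (c s - p, c' s - n)) (c' s, c'' s)
      (Ici s) s := by
    intro s hs
    obtain ⟨-, h1, h2, -⟩ := hc s (hmem s ⟨hs.1, hs.2.le⟩)
    have hnhds : Ico 0 R₁ ∈ 𝓝[≥] s :=
      mem_of_superset (Ico_mem_nhdsGE (hs.2.trans hs₁R)) (Ico_subset_Ico_left hs.1)
    exact ((h1.mono_of_mem_nhdsWithin hnhds).sub_const p).prodMk
      ((h2.mono_of_mem_nhdsWithin hnhds).sub_const n)
  have hcont : ContinuousOn (fun s => (c s - p, c' s - n)) (Icc 0 s₁) := by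
    intro s hs
    obtain ⟨-, h1, h2, -⟩ := hc s (hmem s hs)
    exact (((h1.continuousWithinAt.sub continuousWithinAt_const).prodMk
      (h2.continuousWithinAt.sub continuousWithinAt_const)).mono hmem)
  -- A continuity argument: as long as position and velocity have changed by at most L·s, the
  -- geodesic stays in the ball and its velocity is at most A + 1. The geodesic equation and
  -- nondegeneracy of g then bound the acceleration by M, so the rate of change is less than L and
  -- the bound cannot be crossed.
  have hbound : ∀ s ∈ Icc 0 s₁, ‖(c s - p, c' s - n)‖ ≤ L * s := by
    refine image_norm_le_of_norm_deriv_right_lt_deriv_boundary hcont hder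
      (B := fun s => L * s) (B' := fun _ => L) (by simp [hc0, hc'0])
      (fun s => by simpa using (hasDerivAt_id s).const_mul L) fun s hs heq => ?_
    have hle : L * s ≤ min (ρ / 2) 1 := by
      refine le_trans ?_ hLs
      gcongr
      exact hs.2.le
    have h1 : ‖c s - p‖ < ρ := by
      have := (norm_fst_le (c s - p, c' s - n)).trans (heq.trans_le (hle.trans (min_le_left _ _)))
      simp only at this
      linarith
    have h2 : ‖c' s‖ ≤ A + 1 := by
      have := (norm_snd_le (c s - p, c' s - n)).trans (heq.trans_le (hle.trans (min_le_right _ _)))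
      simp only at this
      calc ‖c' s‖ = ‖n + (c' s - n)‖ := by congr 1; abel
        _ ≤ ‖n‖ + ‖c' s - n‖ := norm_add_le _ _
        _ ≤ A + 1 := by linarith
    obtain ⟨-, -, -, heqn⟩ := hc s (hmem s ⟨hs.1, hs.2.le⟩)
    have hGx := hfd _ h1
    have htri : ∀ u v w : R4, |fderiv ℝ g (c s) u v w| ≤ G * ‖u‖ * ‖v‖ * ‖w‖ := by
      intro u v w
      calc |fderiv ℝ g (c s) u v w| ≤ ‖fderiv ℝ g (c s) u‖ * ‖v‖ * ‖w‖ :=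
            (fderiv ℝ g (c s) u).le_opNorm₂ v w
        _ ≤ G * ‖u‖ * ‖v‖ * ‖w‖ := by gcongr; exact hGx u
    have h3 : ‖g (c s) (c'' s)‖ ≤ 2 * G * (A + 1) ^ 2 := by
      refine ContinuousLinearMap.opNorm_le_bound _ (by positivity) fun w => ?_
      have e1 : g (c s) (c'' s) w = -(fderiv ℝ g (c s) (c' s) (c' s) w) +
          1 / 2 * fderiv ℝ g (c s) w (c' s) (c' s) := by linarith [heqn w]
      have e2 := htri (c' s) (c' s) w
      have e3 := htri w (c' s) (c' s)
      rw [Real.norm_eq_abs, e1]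
      have e4 : G * ‖c' s‖ * ‖c' s‖ * ‖w‖ ≤ G * (A + 1) * (A + 1) * ‖w‖ := by gcongr
      have e5 : G * ‖w‖ * ‖c' s‖ * ‖c' s‖ = G * ‖c' s‖ * ‖c' s‖ * ‖w‖ := by ring
      rw [e5] at e3
      rw [abs_le] at e2 e3 ⊢
      constructor <;> nlinarith [e2.1, e2.2, e3.1, e3.2]
    have h4 : ‖c'' s‖ ≤ M := (hnd _ h1 _).trans (by rw [hM]; gcongr)
    rw [Prod.norm_def]
    exact max_lt (by simp only; linarith) (by simp only; linarith)
  intro s s' hs hss hs'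
  have hs'1 : s' ∈ Icc 0 s₁ := ⟨hs.trans hss, hs'⟩
  refine ⟨(norm_fst_le (c s' - p, c' s' - n)).trans (hbound s' hs'1), ?_⟩
  have hd : ∀ u ∈ Icc s s', HasDerivWithinAt (fun u => c u - u • n) (c' u - n) (Icc s s') u := by
    intro u hu
    have hu1 : Icc s s' ⊆ Ico 0 R₁ := fun v hv => hmem v ⟨hs.trans hv.1, hv.2.trans hs'⟩
    have h1 := (hc u (hu1 hu)).2.1.mono hu1
    have h2 : HasDerivWithinAt (fun u : ℝ => u • n) n (Icc s s') u := by
      simpa using ((hasDerivAt_id u).smul_const n).hasDerivWithinAt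
    exact h1.sub h2
  have h1 := (convex_Icc s s').norm_image_sub_le_of_norm_hasDerivWithin_le (C := L * s') hd
    (fun u hu => by
      have hu1 : u ∈ Icc 0 s₁ := ⟨hs.trans hu.1, hu.2.trans hs'⟩
      refine ((norm_snd_le (c u - p, c' u - n)).trans (hbound u hu1)).trans ?_
      gcongr
      exact hu.2) (x := s) (y := s') ⟨le_rfl, hss⟩ ⟨hss, le_rfl⟩
  rw [Real.norm_of_nonneg (sub_nonneg.2 hss)] at h1
  have h2 : c s' - c s - (s' - s) • n = c s' - s' • n - (c s - s • n) := by
    rw [sub_smul]; abel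
  rw [h2]
  exact h1

/-- Components of vectors for a Lorentz form `B`, with bounds for the change of components. -/
structure IsLorentzCoords (B : R4 →L[ℝ] R4 →L[ℝ] ℝ) (e₀ : R4) (tm : R4 →L[ℝ] ℝ) (sp : R4 →L[ℝ] R3)
    (k : ℝ) : Prop where
  k_pos : 0 < k
  tm_e₀ : tm e₀ = 1
  sp_e₀ : sp e₀ = 0
  form : ∀ v w, B v w = tm v * tm w - inner ℝ (sp v) (sp w)
  tm_le : ∀ v, |tm v| ≤ k * ‖v‖
  sp_le : ∀ v, ‖sp v‖ ≤ k * ‖v‖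
  norm_le : ∀ v, ‖v‖ ≤ k * (|tm v| + ‖sp v‖)

namespace IsLorentzCoords

variable {B : R4 →L[ℝ] R4 →L[ℝ] ℝ} {e₀ : R4} {tm : R4 →L[ℝ] ℝ} {sp : R4 →L[ℝ] R3} {k : ℝ}

theorem form_self (h : IsLorentzCoords B e₀ tm sp k) (v : R4) :
    B v v = tm v ^ 2 - ‖sp v‖ ^ 2 := by
  rw [h.form, real_inner_self_eq_norm_sq]; ring

theorem eq_smul (h : IsLorentzCoords B e₀ tm sp k) {v : R4} (hv : sp v = 0) : v = tm v • e₀ := by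
  have h1 := h.norm_le (v - tm v • e₀)
  rw [map_sub, map_sub, map_smul, map_smul, h.tm_e₀, h.sp_e₀, hv] at h1
  simp at h1
  exact sub_eq_zero.1 h1

/-- Nondegeneracy, with a bound that is stable under perturbations. -/
theorem norm_le_apply (h : IsLorentzCoords B e₀ tm sp k) (v : R4) :
    ‖v‖ ≤ 2 * k ^ 2 * (2 * k * ‖e₀‖ + 1) * ‖B v‖ := by
  have hk := h.k_pos
  rcases eq_or_ne v 0 with rfl | hv
  · simp
  have hv0 : 0 < ‖v‖ := norm_pos_iff.2 hv
  -- The time-reflected vector: it has the time component of v and the opposite space component, so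
  -- B v w is the positive definite square of v.
  set w := (2 * tm v) • e₀ - v with hw
  have h1 : B v w = tm v ^ 2 + ‖sp v‖ ^ 2 := by
    rw [h.form, hw, map_sub, map_sub, map_smul, map_smul, h.tm_e₀, h.sp_e₀, smul_zero, zero_sub,
      inner_neg_right, real_inner_self_eq_norm_sq, smul_eq_mul]
    ring
  have h2 : ‖w‖ ≤ (2 * k * ‖e₀‖ + 1) * ‖v‖ := by
    calc ‖w‖ ≤ ‖(2 * tm v) • e₀‖ + ‖v‖ := norm_sub_le _ _
      _ = 2 * |tm v| * ‖e₀‖ + ‖v‖ := by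
          rw [norm_smul, norm_mul, Real.norm_eq_abs, Real.norm_eq_abs, abs_two]
      _ ≤ 2 * (k * ‖v‖) * ‖e₀‖ + ‖v‖ := by gcongr; exact h.tm_le v
      _ = _ := by ring
  have h3 : ‖v‖ ^ 2 ≤ 2 * k ^ 2 * (B v w) := by
    rw [h1]
    calc ‖v‖ ^ 2 ≤ (k * (|tm v| + ‖sp v‖)) ^ 2 := by gcongr; exact h.norm_le v
      _ = k ^ 2 * (|tm v| + ‖sp v‖) ^ 2 := by ring
      _ ≤ k ^ 2 * (2 * (|tm v| ^ 2 + ‖sp v‖ ^ 2)) := by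
          gcongr
          nlinarith [sq_nonneg (|tm v| - ‖sp v‖)]
      _ = _ := by rw [sq_abs]; ring
  have h4 : B v w ≤ ‖B v‖ * ((2 * k * ‖e₀‖ + 1) * ‖v‖) := by
    calc B v w ≤ |B v w| := le_abs_self _
      _ ≤ ‖B v‖ * ‖w‖ := (B v).le_opNorm w
      _ ≤ _ := by gcongr
  have h5 : ‖v‖ * ‖v‖ ≤ (2 * k ^ 2 * (2 * k * ‖e₀‖ + 1) * ‖B v‖) * ‖v‖ := by
    calc ‖v‖ * ‖v‖ = ‖v‖ ^ 2 := by ring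
      _ ≤ 2 * k ^ 2 * (B v w) := h3
      _ ≤ 2 * k ^ 2 * (‖B v‖ * ((2 * k * ‖e₀‖ + 1) * ‖v‖)) := by gcongr
      _ = _ := by ring
  exact le_of_mul_le_mul_right h5 hv0

theorem abs_sub_le {b : R4 →L[ℝ] R4 →L[ℝ] ℝ} {ε : ℝ} (hb : ‖b - B‖ ≤ ε) (v : R4) :
    |b v v - B v v| ≤ ε * ‖v‖ ^ 2 := by
  calc |b v v - B v v| = |(b - B) v v| := rfl
    _ ≤ ‖b - B‖ * ‖v‖ * ‖v‖ := (b - B).le_opNorm₂ v v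
    _ ≤ ε * ‖v‖ * ‖v‖ := by gcongr
    _ = _ := by ring

theorem norm_le_apply_of_near (h : IsLorentzCoords B e₀ tm sp k) {b : R4 →L[ℝ] R4 →L[ℝ] ℝ} {ε : ℝ}
    (hb : ‖b - B‖ ≤ ε) (hε : 2 * k ^ 2 * (2 * k * ‖e₀‖ + 1) * ε ≤ 1 / 2) (v : R4) :
    ‖v‖ ≤ 2 * (2 * k ^ 2 * (2 * k * ‖e₀‖ + 1)) * ‖b v‖ := by
  have hk := h.k_pos
  have h1 := h.norm_le_apply v
  have h2 : ‖B v‖ ≤ ‖b v‖ + ε * ‖v‖ := by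
    calc ‖B v‖ = ‖b v - (b - B) v‖ := by congr 1; simp
      _ ≤ ‖b v‖ + ‖(b - B) v‖ := norm_sub_le _ _
      _ ≤ ‖b v‖ + ε * ‖v‖ := by gcongr; exact (b - B).le_of_opNorm_le hb v
  set M := 2 * k ^ 2 * (2 * k * ‖e₀‖ + 1) with hM
  have hM0 : 0 ≤ M := by positivity
  have h3 : M * ‖B v‖ ≤ M * (‖b v‖ + ε * ‖v‖) := by gcongr
  have h4 : M * ε * ‖v‖ ≤ 1 / 2 * ‖v‖ := by gcongr
  linarith

/-- Vectors of the narrow past cone are timelike and past directed for nearby forms. -/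
theorem narrow_cone (h : IsLorentzCoords B e₀ tm sp k) {b : R4 →L[ℝ] R4 →L[ℝ] ℝ} {ε : ℝ} {t : R4}
    {β : R4 →L[ℝ] ℝ} (hb : ‖b - B‖ ≤ ε) (hβ : ‖β - B t‖ ≤ ε) (ht0 : 0 < tm t) (ht : 0 < B t t)
    (hε1 : 3 * (ε * k ^ 2) < 1) (hε2 : 3 * (ε * k) < tm t) {v : R4} (hv : tm v < 0)
    (hsv : ‖sp v‖ ≤ -tm v / 2) : 0 < b v v ∧ β v < 0 := by
  have hk := h.k_pos
  have hε : 0 ≤ ε := (norm_nonneg (b - B)).trans hb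
  -- Aperture 1/2 leaves room for perturbation: B v v is at least 3/4 of the square of the time
  -- component, while ‖v‖ is at most 3k/2 times it.
  have hvn : ‖v‖ ≤ k * (3 / 2 * -tm v) := by
    refine (h.norm_le v).trans ?_
    gcongr
    rw [abs_of_neg hv]
    linarith
  set x := -tm v with hx
  have hx0 : 0 < x := by rw [hx]; linarith
  constructor
  · have h1 := (abs_le.1 (abs_sub_le hb v)).1
    have h2 : B v v ≥ 3 / 4 * x ^ 2 := by
      rw [h.form_self]
      have : ‖sp v‖ ^ 2 ≤ (x / 2) ^ 2 := by gcongr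
      have e : tm v ^ 2 = x ^ 2 := by rw [hx]; ring
      rw [e]
      linarith
    have h3 : ε * ‖v‖ ^ 2 ≤ ε * (k * (3 / 2 * x)) ^ 2 := by gcongr
    have h4 : ε * (k * (3 / 2 * x)) ^ 2 = (3 * (ε * k ^ 2)) * (3 / 4 * x ^ 2) := by ring
    have h5 : (3 * (ε * k ^ 2)) * (3 / 4 * x ^ 2) < 1 * (3 / 4 * x ^ 2) :=
      mul_lt_mul_of_pos_right hε1 (by positivity)
    linarith
  · have h1 : |β v - B t v| ≤ ε * ‖v‖ := by
      calc |β v - B t v| = ‖(β - B t) v‖ := rfl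
        _ ≤ ε * ‖v‖ := (β - B t).le_of_opNorm_le hβ v
    have h2 : ‖sp t‖ ≤ tm t := by
      rw [h.form_self] at ht
      nlinarith [norm_nonneg (sp t)]
    have h3 : B t v ≤ -(tm t * x / 2) := by
      rw [h.form]
      have h4 : |inner ℝ (sp t) (sp v)| ≤ tm t * (x / 2) :=
        (abs_real_inner_le_norm _ _).trans (by gcongr)
      have := (abs_le.1 h4).1
      have e : tm t * tm v = -(tm t * x) := by rw [hx]; ring
      rw [e]
      linarith
    have h5 : ε * ‖v‖ ≤ ε * (k * (3 / 2 * x)) := by gcongr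
    have h6 : ε * (k * (3 / 2 * x)) = (3 * (ε * k)) * (x / 2) := by ring
    have h7 : (3 * (ε * k)) * (x / 2) < tm t * (x / 2) :=
      mul_lt_mul_of_pos_right hε2 (by positivity)
    have := (abs_le.1 h1).2
    linarith

/-- Vectors that are uniformly spacelike for a nearby form have slope less than one. -/
theorem exists_slope (h : IsLorentzCoords B e₀ tm sp k) {δ : ℝ} (hδ : 0 < δ) :
    ∃ κ, 0 ≤ κ ∧ κ < 1 ∧ ∀ (b : R4 →L[ℝ] R4 →L[ℝ] ℝ), ‖b - B‖ ≤ δ / 2 → ∀ v,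
      δ * ‖v‖ ^ 2 ≤ -(b v v) → |tm v| ≤ κ * ‖sp v‖ := by
  have hk := h.k_pos
  -- Half of δ absorbs the change from b to B. The other half gives tm² ≤ (1 - θ)‖sp‖² ≤ (1 -
  -- θ/2)²‖sp‖².
  set θ := min (δ / (2 * k ^ 2)) 1 with hθ
  have hθ0 : 0 < θ := by positivity
  have hθ1 : θ ≤ 1 := min_le_right _ _
  have hθk : θ * k ^ 2 ≤ δ / 2 := by
    calc θ * k ^ 2 ≤ δ / (2 * k ^ 2) * k ^ 2 := by gcongr; exact min_le_left _ _
      _ = δ / 2 := by field_simp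
  refine ⟨1 - θ / 2, by linarith, by linarith, fun b hb v hv => ?_⟩
  have h0 : 0 ≤ (1 - θ / 2) * ‖sp v‖ := mul_nonneg (by linarith) (norm_nonneg _)
  refine abs_le_of_sq_le_sq ?_ h0
  have h1 := (abs_le.1 (abs_sub_le hb v)).1
  rw [h.form_self] at h1
  have h2 : θ * ‖sp v‖ ^ 2 ≤ δ / 2 * ‖v‖ ^ 2 := by
    calc θ * ‖sp v‖ ^ 2 ≤ θ * (k * ‖v‖) ^ 2 := by gcongr; exact h.sp_le v
      _ = (θ * k ^ 2) * ‖v‖ ^ 2 := by ring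
      _ ≤ _ := by gcongr
  have h3 : ((1 - θ / 2) * ‖sp v‖) ^ 2 = ‖sp v‖ ^ 2 - θ * ‖sp v‖ ^ 2 + (θ / 2 * ‖sp v‖) ^ 2 := by
    ring
  rw [h3]
  nlinarith [sq_nonneg (θ / 2 * ‖sp v‖)]

end IsLorentzCoords

theorem pastTimelikeStep_segment {U : Set R4} {g : BilinField} {T : R4 → R4} {N : Set R4}
    (hN : Convex ℝ N) {x z : R4} (hx : x ∈ N) (hz : z ∈ N)
    (h : ∀ y ∈ N, y ∈ U ∧ 0 < g y (z - x) (z - x) ∧ g y (T y) (z - x) < 0) :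
    PastTimelikeStep U g T x z := by
  refine ⟨fun s => x + s • (z - x), fun _ => z - x, by simp, by simp, continuousOn_const,
    fun s hs => ?_⟩
  have hy : x + s • (z - x) ∈ N := hN.add_smul_sub_mem hx hz hs
  refine ⟨(h _ hy).1, ?_, (h _ hy).2⟩
  simpa using (((hasDerivAt_id s).smul_const (z - x)).const_add x).hasDerivWithinAt

/-! ### The Sobolev inequality on leaves close to the vertex -/

section Foliation

variable {U : Set R4} {g : BilinField} {T : R4 → R4} {p : R4} {Ψ : ℝ → R3 → R4} {R₁ R : ℝ}
  {τ : R4 → ℝ}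

/-- The part `τ ≤ r` of the interior shrinks to the vertex as `r → 0`. -/
theorem exists_near_vertex (hτ : IsUniformlySpacelikeFoliation U g T p Ψ R₁ R τ) {ρ : ℝ}
    (hρ : 0 < ρ) : ∃ r > 0, r ≤ R ∧ ∀ x ∈ chronPast U g T p, τ x ≤ r → ‖x - p‖ < ρ := by
  set K := {x ∈ insert p (chronPast U g T p ∪ lightCone Ψ R₁) | τ x ≤ R} with hK
  have hc : IsCompact (K \ Metric.ball p ρ) := hτ.compact.diff Metric.isOpen_ball
  have hpos : ∀ x ∈ K \ Metric.ball p ρ, 0 < τ x := by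
    rintro x ⟨⟨hx, -⟩, hxb⟩
    rcases hx with rfl | hx | hx
    · exact absurd (Metric.mem_ball_self hρ) hxb
    · exact hτ.interior_pos x hx
    · exact pos_of_mem_lightCone hτ hx
  have hcont : ContinuousOn τ (K \ Metric.ball p ρ) := hτ.continuousOn.mono fun x hx => hx.1.1
  rcases (K \ Metric.ball p ρ).eq_empty_or_nonempty with he | hne
  · refine ⟨R, hτ.pos, le_rfl, fun x hx hxR => ?_⟩
    by_contra hnot
    have : x ∈ K \ Metric.ball p ρ :=
      ⟨⟨Or.inr (Or.inl hx), hxR⟩, by rwa [mem_ball_iff_norm]⟩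
    rw [he] at this
    exact this
  -- Outside the ball τ has a positive minimum by compactness, so half of it is a level below which
  -- the leaves lie in the ball.
  · obtain ⟨m, hm, hmin⟩ := hc.exists_isMinOn hne hcont
    refine ⟨min R (τ m / 2), lt_min hτ.pos (half_pos (hpos m hm)), min_le_left _ _,
      fun x hx hxr => ?_⟩
    by_contra hnot
    have h1 : τ m ≤ τ x := hmin
      ⟨⟨Or.inr (Or.inl hx), hxr.trans (min_le_left _ _)⟩, by rwa [mem_ball_iff_norm]⟩
    have h2 := hxr.trans (min_le_right _ _)
    linarith [hpos m hm]

end Foliation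

section Foliation

variable {U : Set R4} {g : BilinField} {T : R4 → R4} {p : R4} {Ψ : ℝ → R3 → R4} {R₁ R : ℝ}
  {τ : R4 → ℝ}

/-- Uniform bounds for the metric in a ball about `p`. -/
theorem IsLorentzCoords.exists_ball (hg : IsSpacetime U g T) (hp : p ∈ U) {e₀ : R4}
    {tm : R4 →L[ℝ] ℝ} {sp : R4 →L[ℝ] R3} {k : ℝ} (h : IsLorentzCoords (g p) e₀ tm sp k)
    (hT : 0 < tm (T p)) {δ : ℝ} (hδ : 0 < δ) :
    ∃ ρ G k' : ℝ, 0 < ρ ∧ 0 ≤ G ∧ 0 ≤ k' ∧ ∀ x, ‖x - p‖ < 4 * ρ → x ∈ U ∧ ‖g x - g p‖ ≤ δ ∧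
      (∀ u, ‖fderiv ℝ g x u‖ ≤ G * ‖u‖) ∧ (∀ v, ‖v‖ ≤ k' * ‖g x v‖) ∧
      ∀ v, tm v < 0 → ‖sp v‖ ≤ -tm v / 2 → 0 < g x v v ∧ g x (T x) v < 0 := by
  have hk := h.k_pos
  have hU : U ∈ 𝓝 p := hg.isOpen.mem_nhds hp
  have hgc : ContinuousAt g p := hg.contDiffOn.continuousOn.continuousAt hU
  have hTc : ContinuousAt T p := hg.continuousOn_T.continuousAt hU
  obtain ⟨G, hG, hGe⟩ := exists_eventually_fderiv_le (F := R4 →L[ℝ] R4 →L[ℝ] ℝ)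
    ((hg.contDiffOn.contDiffAt hU).of_le one_le_two)
  set M := 2 * k ^ 2 * (2 * k * ‖e₀‖ + 1) with hM
  have hM0 : 0 < M := by positivity
  obtain ⟨ε, hε0, hεδ, hε1, hε2, hε3⟩ : ∃ ε : ℝ, 0 < ε ∧ ε ≤ δ ∧ 3 * (ε * k ^ 2) < 1 ∧
      3 * (ε * k) < tm (T p) ∧ M * ε ≤ 1 / 2 := by
    have e1 : ∀ᶠ ε : ℝ in 𝓝 0, 3 * (ε * k ^ 2) < 1 :=
      (Continuous.tendsto' (by fun_prop) 0 0 (by simp)).eventually_lt_const one_pos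
    have e2 : ∀ᶠ ε : ℝ in 𝓝 0, 3 * (ε * k) < tm (T p) :=
      (Continuous.tendsto' (by fun_prop) 0 0 (by simp)).eventually_lt_const hT
    have e3 : ∀ᶠ ε : ℝ in 𝓝 0, M * ε < 1 / 2 :=
      (Continuous.tendsto' (by fun_prop) 0 0 (by simp)).eventually_lt_const one_half_pos
    have e4 : ∀ᶠ ε : ℝ in 𝓝[>] 0, ε < δ ∧ 3 * (ε * k ^ 2) < 1 ∧ 3 * (ε * k) < tm (T p) ∧
        M * ε < 1 / 2 :=
      ((eventually_lt_nhds hδ).and (e1.and (e2.and e3))).filter_mono nhdsWithin_le_nhds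
    obtain ⟨ε, ⟨h1, h2, h3, h4⟩, h0⟩ := (e4.and self_mem_nhdsWithin).exists
    exact ⟨ε, h0, h1.le, h2, h3, h4.le⟩
  have c1 : ∀ᶠ x in 𝓝 p, ‖g x - g p‖ < ε := by
    have := hgc.eventually (Metric.ball_mem_nhds (g p) hε0)
    filter_upwards [this] with x hx
    exact (dist_eq_norm (g x) (g p)).symm.trans_lt hx
  have c2 : ∀ᶠ x in 𝓝 p, ‖g x (T x) - g p (T p)‖ < ε := by
    have := (hgc.clm_apply hTc).eventually (Metric.ball_mem_nhds (g p (T p)) hε0)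
    filter_upwards [this] with x hx
    rwa [dist_eq_norm] at hx
  obtain ⟨ρ, hρ, hb⟩ := Metric.eventually_nhds_iff_ball.1
    ((eventually_mem_set.2 hU).and (c1.and (c2.and hGe)))
  refine ⟨ρ / 4, G, 2 * M, by positivity, hG, by positivity, fun x hx => ?_⟩
  obtain ⟨hxU, h1, h2, h3⟩ := hb x (mem_ball_iff_norm.2 (by linarith))
  exact ⟨hxU, h1.le.trans hεδ, h3, h.norm_le_apply_of_near h1.le hε3, fun v hv hsv =>
    h.narrow_cone h1.le h2.le hT (hg.timelike_T p hp) hε1 hε2 hv hsv⟩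

/-- The Sobolev inequality on the leaves close to the vertex. -/
theorem sobolevOn_leaf_of_le (hg : IsSpacetime U g T) (hcone : IsPastLightCone U g T p Ψ R₁)
    (hτ : IsUniformlySpacelikeFoliation U g T p Ψ R₁ R τ) :
    ∃ r₀ > 0, ∃ C : ℝ≥0, ∀ r ∈ Ioc 0 r₀, SobolevOn g τ (leaf U g T p τ r) univ r C := by
  obtain ⟨e, a, he, he₀, hac, hgen⟩ := hcone.generators
  have hp := hcone.mem
  obtain ⟨tm, sp, k, hk, htm, htm₀, hsp₀, hform, htmle, hsple, hnle, hnull⟩ :=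
    exists_lorentz_coordinates he
  have hco : IsLorentzCoords (g p) (e 0) tm sp k := ⟨hk, htm₀, hsp₀, hform, htmle, hsple, hnle⟩
  have hT : 0 < tm (T p) := by rw [htm, hg.symm p hp]; exact he₀
  obtain ⟨δ, hδ, hspace⟩ := hτ.spacelike
  obtain ⟨κ, hκ0, hκ1, hslope⟩ := hco.exists_slope hδ
  obtain ⟨ρ, G, k', hρ, hG, hk', hball⟩ := hco.exists_ball hg hp hT (half_pos hδ)
  -- bounds for the initial velocities
  have hcs := isCompact_sphere (0 : R3) 1
  have hacs : ContinuousOn a (Metric.sphere (0 : R3) 1) :=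
    hac.continuousOn.mono fun ω hω => by
      rintro rfl
      simp at hω
  have hsphere : ∀ ω : R3, ‖ω‖ = 1 → ω ∈ Metric.sphere (0 : R3) 1 := fun ω hω => by simpa using hω
  have hne : (Metric.sphere (0 : R3) 1).Nonempty := NormedSpace.sphere_nonempty.2 zero_le_one
  obtain ⟨ω₁, hω₁, hmin⟩ := hcs.exists_isMinOn hne hacs
  obtain ⟨ω₂, hω₂, hmax⟩ := hcs.exists_isMaxOn hne hacs
  set A := a ω₁ with hA
  have hA0 : 0 < A := (hgen ω₁ hω₁).1
  have haA : ∀ ω : R3, ‖ω‖ = 1 → A ≤ a ω := fun ω hω => hmin (hsphere ω hω)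
  set n : R3 → R4 := fun ω => a ω • (-e 0 + ω 0 • e 1 + ω 1 • e 2 + ω 2 • e 3) with hn
  have hnc : ∀ ω : R3, ‖ω‖ = 1 → tm (n ω) = -a ω ∧ sp (n ω) = a ω • ω := fun ω _ => by
    simp only [hn]
    rw [map_smul, map_smul, (hnull ω).1, (hnull ω).2]
    simp
  have hnA : ∀ ω : R3, ‖ω‖ = 1 → ‖n ω‖ ≤ k * (2 * a ω₂) := fun ω hω => by
    have h1 := hnle (n ω)
    have h2 : a ω ≤ a ω₂ := hmax (hsphere ω hω)
    have h3 := (hgen ω (hsphere ω hω)).1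
    have h4 : ‖a ω • ω‖ = a ω := by rw [norm_smul, hω, Real.norm_of_nonneg h3.le, mul_one]
    rw [(hnc ω hω).1, (hnc ω hω).2, abs_neg, abs_of_pos h3, h4] at h1
    refine h1.trans ?_
    gcongr
    linarith
  have ha₂ : 0 < a ω₂ := (hgen ω₂ hω₂).1
  obtain ⟨L, s₁, hL, hs₁, hs₁R, hgeo⟩ := geodesic_bounds (U := U) (g := g) (p := p) (R₁ := R₁)
    (A := k * (2 * a ω₂)) (mul_pos four_pos hρ) hG hk' (by positivity) (hτ.pos.trans hτ.lt)
    (fun x hx => (hball x hx).2.2.1) (fun x hx => (hball x hx).2.2.2.1)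
  obtain ⟨r₁, hr₁, hr₁R, hnear⟩ := exists_near_vertex hτ hρ
  set α := (1 - κ) / 12 with hα
  have hα0 : 0 < α := by rw [hα]; linarith
  set c := α * A / 12 with hc
  have hc0 : 0 < c := by positivity
  obtain ⟨N, θ, E, hθ, hE, hEθ, hcov⟩ := exists_sectors hα0
  -- For w tangent to the graph over v, the space component of w is v, so ‖v‖ ≤ k‖w‖; and ‖w‖ ≤
  -- 2k‖v‖ since the slope is below 1. These give the two metric bounds, independent of r.
  obtain ⟨C, hC⟩ := sobolev_chart E hE (m := δ / k ^ 2) (M := (‖g p‖ + δ / 2) * (2 * k) ^ 2)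
    (by positivity) (by positivity)
  -- the size of the leaves
  obtain ⟨r₀, hr₀, hr₀1, hr₀s, hr₀c, hr₀κ, hr₀ρ⟩ : ∃ r₀ : ℝ, 0 < r₀ ∧ r₀ ≤ r₁ ∧ 2 * r₀ ≤ s₁ ∧
      k * L * r₀ ≤ c ∧ 2 * (k * L) * r₀ ≤ (1 - κ) / 8 * A ∧ L * (2 * r₀) < 4 * ρ := by
    have hz : ∀ {f : ℝ → ℝ} {y : ℝ}, Continuous f → f 0 = 0 → 0 < y → ∀ᶠ r in 𝓝 0, f r < y :=
      fun hf h0 hy => (hf.tendsto' 0 0 h0).eventually_lt_const hy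
    have hκA : 0 < (1 - κ) / 8 * A := mul_pos (by linarith) hA0
    have ev : ∀ᶠ r : ℝ in 𝓝[>] 0, r < r₁ ∧ 2 * r < s₁ ∧ k * L * r < c ∧
        2 * (k * L) * r < (1 - κ) / 8 * A ∧ L * (2 * r) < 4 * ρ :=
      ((eventually_lt_nhds hr₁).and ((hz (by fun_prop) (by simp) hs₁).and
        ((hz (by fun_prop) (by simp) hc0).and ((hz (by fun_prop) (by simp) hκA).and
          (hz (by fun_prop) (by simp) (mul_pos four_pos hρ)))))).filter_mono nhdsWithin_le_nhds
    obtain ⟨r, ⟨h1, h2, h3, h4, h5⟩, h0⟩ := (ev.and self_mem_nhdsWithin).exists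
    exact ⟨r, h0, h1.le, h2.le, h3.le, h4.le, h5⟩
  have hIτ : ∀ x ∈ chronPast U g T p, τ x ≤ r₀ → ‖x - p‖ < 4 * ρ ∧ τ x ∈ Ioc 0 R := fun x hx hxr =>
    ⟨by linarith [hnear x hx (hxr.trans hr₀1)],
      hτ.interior_pos x hx, hxr.trans (hr₀1.trans hr₁R)⟩
  have hNV : IsNearVertex (chronPast U g T p) τ p (e 0) tm sp κ ρ r₀ := by
    refine ⟨isOpen_chronPast hg p, hρ, fun x hx z hxp hzp hz1 hz2 => ?_,
      fun x hx hxr => hnear x hx (hxr.trans hr₀1), fun x hx => ?_, fun x hx hxr v hv => ?_,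
      htm₀, hsp₀, fun v => hco.eq_smul⟩
    · refine Relation.TransGen.tail hx (pastTimelikeStep_segment (convex_ball p (4 * ρ))
        (mem_ball_iff_norm.2 hxp) (mem_ball_iff_norm.2 hzp) fun y hy => ?_)
      have := hball y (mem_ball_iff_norm.1 hy)
      exact ⟨this.1, this.2.2.2.2 _ hz1 hz2⟩
    · refine hτ.contDiffOn.contDiffAt ((hg.isOpen.sdiff isClosed_singleton).mem_nhds
        ⟨chronPast_subset p hx, ?_⟩)
      rintro rfl
      exact vertex_notMem_chronPast hτ hx
    · obtain ⟨h1, h2⟩ := hIτ x hx hxr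
      exact hslope (g x) (hball x h1).2.1 v (hspace _ h2 x ⟨hx, rfl⟩ v hv)
  refine ⟨r₀, hr₀, C * (1 + (1 / c) ^ 2).toNNReal, fun r hr => ?_⟩
  have hcr : 0 < c * r := mul_pos hc0 hr.1
  -- Segments have length c·r; the passage to the scale r costs a factor depending on c alone.
  refine SobolevOn.rescale (L := c * r) ?_ hcr hr.1 (by field_simp; exact le_rfl)
  obtain ⟨D, φ, hch, hφ⟩ := hNV.exists_chart hr.2
  have hSU : leaf U g T p τ r ⊆ U := fun x hx => chronPast_subset p hx.1
  have hrR : r ∈ Ioc 0 R := ⟨hr.1, hr.2.trans (hr₀1.trans hr₁R)⟩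
  have hbound : ∀ y ∈ D, ∀ v, fderiv ℝ τ (φ y) (fderiv ℝ φ y v) = 0 ∧
      δ / k ^ 2 * ‖v‖ ^ 2 ≤ -(g (φ y) (fderiv ℝ φ y v) (fderiv ℝ φ y v)) ∧
      -(g (φ y) (fderiv ℝ φ y v) (fderiv ℝ φ y v)) ≤
        (‖g p‖ + δ / 2) * (2 * k) ^ 2 * ‖v‖ ^ 2 := by
    intro y hy v
    obtain ⟨h1, h2⟩ := hφ y hy v
    obtain ⟨hxI, hxr⟩ := (hch.mapsTo_param hy).1
    have hxr₀ : τ (φ y) ≤ r₀ := hxr.trans_le hr.2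
    have hx := hball _ (hIτ _ hxI hxr₀).1
    set w := fderiv ℝ φ y v with hw
    refine ⟨h1, ?_, ?_⟩
    · have h3 := hspace r hrR (φ y) ⟨hxI, hxr⟩ w h1
      have h4 : ‖v‖ ≤ k * ‖w‖ := by rw [← h2]; exact hsple w
      calc δ / k ^ 2 * ‖v‖ ^ 2 ≤ δ / k ^ 2 * (k * ‖w‖) ^ 2 := by gcongr
        _ = δ * ‖w‖ ^ 2 := by field_simp
        _ ≤ _ := h3
    · have h3 : ‖w‖ ≤ 2 * k * ‖v‖ := by
        have h4 := hNV.slope _ hxI hxr₀ w h1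
        rw [h2] at h4
        calc ‖w‖ ≤ k * (|tm w| + ‖sp w‖) := hnle w
          _ ≤ k * (‖v‖ + ‖v‖) := by
              rw [h2]
              gcongr
              exact h4.trans (mul_le_of_le_one_left (norm_nonneg _) hκ1.le)
          _ = _ := by ring
      have h5 : ‖g (φ y)‖ ≤ ‖g p‖ + δ / 2 := by
        calc ‖g (φ y)‖ = ‖g p + (g (φ y) - g p)‖ := by congr 1; abel
          _ ≤ ‖g p‖ + ‖g (φ y) - g p‖ := norm_add_le (g p) (g (φ y) - g p)
          _ ≤ _ := by gcongr; exact hx.2.1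
      calc -(g (φ y) w w) ≤ ‖g (φ y) w w‖ := neg_le_abs _
        _ ≤ ‖g (φ y)‖ * ‖w‖ * ‖w‖ := (g (φ y)).le_opNorm₂ w w
        _ ≤ (‖g p‖ + δ / 2) * (2 * k * ‖v‖) * (2 * k * ‖v‖) := by gcongr
        _ = _ := by ring
  -- the compact closure of the leaf
  set K₀ := {x ∈ insert p (chronPast U g T p ∪ lightCone Ψ R₁) | τ x ≤ R} with hK₀
  have hK : IsCompact (K₀ ∩ τ ⁻¹' {r}) := hτ.compact.of_isClosed_subset
    ((hτ.continuousOn.mono fun x hx => hx.1).preimage_isClosed_of_isClosed hτ.compact.isClosed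
      isClosed_singleton) inter_subset_left
  have hsub : {x ∈ chronPast U g T p | τ x = r} ⊆ K₀ ∩ τ ⁻¹' {r} := fun x hx =>
    ⟨⟨Or.inr (Or.inl hx.1), hx.2.trans_le hrR.2⟩, hx.2⟩
  have hKΨ : ∀ x ∈ K₀ ∩ τ ⁻¹' {r}, x ∉ chronPast U g T p → ∃ ω : R3, ‖ω‖ = 1 ∧ x = Ψ r ω := by
    rintro x ⟨⟨hx, -⟩, hxr⟩ hxI
    rw [mem_preimage, mem_singleton_iff] at hxr
    rcases hx with rfl | hx | ⟨s, hs, ω, hω, rfl⟩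
    · rw [hτ.vertex] at hxr
      exact absurd hxr hr.1.ne
    · exact absurd hx hxI
    · rw [hτ.cone s hs ω hω] at hxr
      subst hxr
      exact ⟨ω, by simpa using hω, rfl⟩
  have hΨp : ∀ ω : R3, ‖ω‖ = 1 → Ψ 0 ω = p := fun ω hω => by
    obtain ⟨_, _, h, -⟩ := (hgen ω (hsphere ω hω)).2
    exact h
  have hΨ : ∀ ω : R3, ‖ω‖ = 1 → ∀ s s', 0 ≤ s → s ≤ s' → s' ≤ 2 * r →
      ‖Ψ s' ω - Ψ s ω - (s' - s) • n ω‖ ≤ L * s' * (s' - s) ∧ ‖Ψ s' ω - p‖ < 4 * ρ := by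
    intro ω hω s s' hs hss hs'
    obtain ⟨h1, h2⟩ := hgeo (n ω) (fun r => Ψ r ω) (hnA ω hω) (hgen ω (hsphere ω hω)).2 s s' hs hss
      (by linarith [hr.2])
    refine ⟨h2, h1.trans_lt (lt_of_le_of_lt ?_ hr₀ρ)⟩
    gcongr
    linarith [hr.2]
  have hΨI : ∀ ω : R3, ‖ω‖ = 1 → ∀ s, 0 < s → s ≤ 2 * r → Ψ s ω ∉ chronPast U g T p :=
    fun ω hω s hs hsr => disjoint_left.1 hcone.disjoint
      ⟨s, ⟨hs, by linarith [hr.2]⟩, ω, hsphere ω hω, rfl⟩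
  have hkr : k * L * r ≤ c := le_trans (by gcongr; exact hr.2) hr₀c
  have hkr2 : 2 * (k * L) * r ≤ (1 - κ) / 8 * A := le_trans (by gcongr; exact hr.2) hr₀κ
  have hseg : SegmentCover E (c * r) D := by
    -- The pieces are the closed sectors about θ j. The directions E j i already point inwards, so
    -- the positive sign is always taken.
    refine ⟨fun j => {y | ‖y - ‖y‖ • θ j‖ ≤ α * ‖y‖}, fun j => ?_, fun y _ => ?_,
      fun j y hy hyj i => Or.inl ?_⟩
    · exact (isClosed_le (by fun_prop) (by fun_prop)).measurableSet
    · obtain ⟨j, hj⟩ := hcov y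
      exact mem_iUnion.2 ⟨j, hj⟩
    · exact hNV.segment_subset hr.1 hr.2 hch hφ hK hsub (fun x hx => hx.2) hKΨ hA0 hL hk.le htmle
        hsple haA hnc hΨp hΨ hΨI hκ0 hκ1 hα hc hkr hkr2 (hθ j) hy hyj (hEθ j i)
  exact hC U g τ (leaf U g T p τ r) univ D φ _ (c * r) hg.contDiffOn.continuousOn hg.symm hSU hch
    hcr hseg hbound fun x hx v hv =>
      (mul_nonneg hδ.le (sq_nonneg ‖v‖)).trans (hspace r hrR x hx v hv)

end Foliation

/-! ### From C¹ functions to H¹ -/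

section Limit

variable {U S : Set R4} {g : BilinField} {τ : R4 → ℝ}

theorem ae_mem_surfMeasure (hS : MeasurableSet S) : ∀ᵐ x ∂(surfMeasure g S), x ∈ S :=
  measure_eq_zero_iff_ae_notMem.1 (surfMeasure_compl hS) |>.mono fun _ h => not_not.1 h

theorem aestronglyMeasurable_surfMeasure {F : Type*} [TopologicalSpace F]
    [TopologicalSpace.PseudoMetrizableSpace F] (hS : MeasurableSet S) {O : Set R4} (hO : IsOpen O)
    (hSO : S ⊆ O) {f : R4 → F} (hf : ContinuousOn f O) :
    AEStronglyMeasurable f (surfMeasure g S) := by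
  have h := hf.aestronglyMeasurable (μ := surfMeasure g S) hO.measurableSet
  rwa [Measure.restrict_eq_self_of_ae_mem
    ((ae_mem_surfMeasure hS).mono fun _ h => hSO h)] at h

theorem ofReal_le_two_mul_add {a b c : ℝ} (ha : 0 ≤ a) (hb : 0 ≤ b) (h : c ≤ 2 * a + 2 * b) :
    ENNReal.ofReal c ≤ 2 * ENNReal.ofReal a + 2 * ENNReal.ofReal b := by
  rw [← ENNReal.ofReal_ofNat, ← ENNReal.ofReal_mul zero_le_two, ← ENNReal.ofReal_mul zero_le_two,
    ← ENNReal.ofReal_add (by positivity) (by positivity)]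
  exact ENNReal.ofReal_le_ofReal h

theorem massSq_le {u w : R4 → ℝ} (hu : AEMeasurable u (surfMeasure g S)) :
    massSq g S w ≤ 2 * massSq g S u + 2 * massSq g S (u - w) := by
  unfold massSq
  rw [← lintegral_const_mul' _ _ ENNReal.ofNat_ne_top,
    ← lintegral_const_mul' _ _ ENNReal.ofNat_ne_top, ← lintegral_add_left' (by fun_prop)]
  refine lintegral_mono fun x => ofReal_le_two_mul_add (sq_nonneg _) (sq_nonneg _) ?_
  rw [Pi.sub_apply]
  nlinarith [sq_nonneg (2 * u x - w x)]

/-- With q = -g on the tangent space, 2q(X) + 2q(X - Y) - q(Y) = q(2X - Y) ≥ 0. To split the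
integral of the sum, measurability of the X term is enough, so none is needed for Y. -/
theorem gradEnergy_le (hU : IsOpen U) (hg : ContinuousOn g U)
    (hsymm : ∀ x ∈ U, ∀ v w, g x v w = g x w v) (hS : MeasurableSet S) (hSU : S ⊆ U)
    (hpos : ∀ x ∈ S, ∀ v, fderiv ℝ τ x v = 0 → 0 ≤ -(g x v v)) {X Y : R4 → R4}
    (hXm : AEMeasurable X (surfMeasure g S))
    (hX : ∀ᵐ x ∂(surfMeasure g S), fderiv ℝ τ x (X x) = 0)
    (hY : ∀ x ∈ S, fderiv ℝ τ x (Y x) = 0) :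
    gradEnergy g S Y ≤ 2 * gradEnergy g S X + 2 * gradEnergy g S (X - Y) := by
  unfold gradEnergy
  have hgm : AEStronglyMeasurable g (surfMeasure g S) :=
    aestronglyMeasurable_surfMeasure hS hU hSU hg
  have hqm : AEMeasurable (fun x => -(g x (X x) (X x))) (surfMeasure g S) := by
    have hc : Continuous fun z : (R4 →L[ℝ] R4 →L[ℝ] ℝ) × R4 => -(z.1 z.2 z.2) := by fun_prop
    exact (hc.comp_aestronglyMeasurable (hgm.prodMk hXm.aestronglyMeasurable)).aemeasurable
  rw [← lintegral_const_mul' _ _ ENNReal.ofNat_ne_top,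
    ← lintegral_const_mul' _ _ ENNReal.ofNat_ne_top,
    ← lintegral_add_left' (hqm.ennreal_ofReal.const_mul _)]
  refine lintegral_mono_ae ?_
  filter_upwards [hX, ae_mem_surfMeasure hS] with x hx hxS
  have hy := hY x hxS
  have h1 : fderiv ℝ τ x (X x - Y x) = 0 := by rw [map_sub, hx, hy, sub_zero]
  have h2 : fderiv ℝ τ x (X x + (X x - Y x)) = 0 := by rw [map_add, hx, h1, add_zero]
  refine ofReal_le_two_mul_add (hpos x hxS _ hx) (hpos x hxS _ h1) ?_
  have h3 := hpos x hxS _ h2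
  have h4 := hsymm x (hSU hxS) (X x) (Y x)
  simp only [map_add, map_sub, add_apply, sub_apply, Pi.sub_apply] at h3 ⊢
  linarith

/-- Passage to the limit: a Sobolev inequality for `C¹` functions extends to `H¹`. -/
theorem SobolevOn.memH1 (hU : IsOpen U) (hg : ContinuousOn g U)
    (hsymm : ∀ x ∈ U, ∀ v w, g x v w = g x w v) (hS : MeasurableSet S) (hSU : S ⊆ U)
    (hpos : ∀ x ∈ S, ∀ v, fderiv ℝ τ x v = 0 → 0 ≤ -(g x v v)) {L : ℝ} {C : ℝ≥0}
    (h : SobolevOn g τ S univ L C) {u : R4 → ℝ} {X : R4 → R4} (hu : MemH1 g τ S u X) :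
    (∫⁻ x, ENNReal.ofReal (u x ^ 6) ∂(surfMeasure g S)) ^ (1 / 3 : ℝ) ≤
      (C * 2 : ℝ≥0) * (gradEnergy g S X + ENNReal.ofReal (1 / L ^ 2) * massSq g S u) := by
  obtain ⟨w, Y, hw, hY, -, hlim⟩ := hu.approx
  set μ := surfMeasure g S with hμ
  set κ := ENNReal.ofReal (1 / L ^ 2) with hκ
  have hum : AEStronglyMeasurable u μ := hu.aemeasurable_fun.aestronglyMeasurable
  have hwm : ∀ k, AEStronglyMeasurable (w k) μ := fun k => by
    obtain ⟨O, hO, hSO, hc⟩ := hw k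
    exact aestronglyMeasurable_surfMeasure hS hO hSO hc.continuousOn
  have hmass : Tendsto (fun k => massSq g S (u - w k)) atTop (𝓝 0) :=
    tendsto_of_tendsto_of_tendsto_of_le_of_le tendsto_const_nhds hlim (fun _ => zero_le)
      fun _ => le_add_self
  have hL2 : Tendsto (fun k => eLpNorm (w k - u) 2 μ) atTop (𝓝 0) := by
    have he : ∀ k, eLpNorm (w k - u) 2 μ = massSq g S (u - w k) ^ (1 / 2 : ℝ) := fun k => by
      rw [eLpNorm_eq_lintegral_rpow_enorm_toReal two_ne_zero ENNReal.ofNat_ne_top]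
      unfold massSq
      congr 1
      refine lintegral_congr fun x => ?_
      rw [ENNReal.toReal_ofNat, ENNReal.rpow_ofNat, Real.enorm_eq_ofReal_abs,
        ← ENNReal.ofReal_pow (abs_nonneg _), sq_abs, Pi.sub_apply, Pi.sub_apply, sub_sq_comm]
    simp only [he]
    have := hmass.ennrpow_const (1 / 2 : ℝ)
    rwa [ENNReal.zero_rpow_of_pos one_half_pos] at this
  -- L² convergence gives almost everywhere convergence along a subsequence, which is what Fatou's
  -- lemma needs.
  obtain ⟨ns, hns, hae⟩ := (tendstoInMeasure_of_tendsto_eLpNorm two_ne_zero hwm hum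
    hL2).exists_seq_tendsto_ae
  set Q := gradEnergy g S X + κ * massSq g S u with hQ
  set ε : ℕ → ℝ≥0∞ := fun k => gradEnergy g S (X - Y k) + massSq g S (u - w k) with hε
  -- The cube of the inequality for w k, with its energy replaced by twice that of the limit plus an
  -- error tending to 0. This is the source of the factor 2 in the final constant.
  have hk : ∀ k, ∫⁻ x, ENNReal.ofReal (w k x ^ 6) ∂μ ≤
      (C * (2 * Q + 2 * ((1 + κ) * ε k))) ^ (3 : ℝ) := by
    intro k
    obtain ⟨O, hO, hSO, hc⟩ := hw k
    have h1 := h (w k) (Y k) O hO hSO hc (hY k)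
    rw [inter_univ, Measure.restrict_eq_self_of_ae_mem (ae_mem_surfMeasure hS)] at h1
    have h2 := gradEnergy_le hU hg hsymm hS hSU hpos hu.aemeasurable_grad hu.tangent
      fun x hx => (hY k x hx).1
    have h3 := massSq_le (w := w k) hu.aemeasurable_fun
    have h4 : gradEnergy g S (Y k) + κ * massSq g S (w k) ≤ 2 * Q + 2 * ((1 + κ) * ε k) := by
      calc gradEnergy g S (Y k) + κ * massSq g S (w k)
          ≤ (2 * gradEnergy g S X + 2 * gradEnergy g S (X - Y k)) +
            κ * (2 * massSq g S u + 2 * massSq g S (u - w k)) := by gcongr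
        _ = 2 * Q + 2 * (1 * gradEnergy g S (X - Y k) + κ * massSq g S (u - w k)) := by
            rw [hQ]; ring
        _ ≤ 2 * Q + 2 * ((1 + κ) * gradEnergy g S (X - Y k) +
            (1 + κ) * massSq g S (u - w k)) := by
            gcongr
            · exact le_self_add
            · exact le_add_self
        _ = _ := by rw [hε, mul_add (1 + κ)]
    have h5 := ENNReal.rpow_le_rpow (h1.trans (by gcongr)) (zero_le_three (α := ℝ))
      (y := C * (2 * Q + 2 * ((1 + κ) * ε k)))
    rwa [← ENNReal.rpow_mul, one_div, inv_mul_cancel₀ three_ne_zero, ENNReal.rpow_one] at h5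
  have hfatou : ∫⁻ x, ENNReal.ofReal (u x ^ 6) ∂μ ≤ (C * (2 * Q)) ^ (3 : ℝ) := by
    calc ∫⁻ x, ENNReal.ofReal (u x ^ 6) ∂μ
        = ∫⁻ x, liminf (fun i => ENNReal.ofReal (w (ns i) x ^ 6)) atTop ∂μ := by
          refine lintegral_congr_ae (hae.mono fun x hx => ?_)
          exact (ENNReal.tendsto_ofReal (hx.pow 6)).liminf_eq.symm
      _ ≤ liminf (fun i => ∫⁻ x, ENNReal.ofReal (w (ns i) x ^ 6) ∂μ) atTop :=
          lintegral_liminf_le' fun i => ((hwm (ns i)).aemeasurable.pow_const 6).ennreal_ofReal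
      _ ≤ liminf (fun i => (C * (2 * Q + 2 * ((1 + κ) * ε (ns i)))) ^ (3 : ℝ)) atTop :=
          liminf_le_liminf (Eventually.of_forall fun i => hk (ns i))
      _ = (C * (2 * Q + 2 * ((1 + κ) * 0))) ^ (3 : ℝ) := by
          refine Tendsto.liminf_eq (Tendsto.ennrpow_const _ ?_)
          refine ENNReal.Tendsto.const_mul (tendsto_const_nhds.add ?_) (Or.inr ENNReal.coe_ne_top)
          refine ENNReal.Tendsto.const_mul ?_ (Or.inr ENNReal.ofNat_ne_top)
          refine ENNReal.Tendsto.const_mul (hlim.comp hns.tendsto_atTop) (Or.inr ?_)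
          exact ENNReal.add_ne_top.2 ⟨ENNReal.one_ne_top, ENNReal.ofReal_ne_top⟩
      _ = _ := by rw [mul_zero, mul_zero, add_zero]
  calc _ ≤ ((C * (2 * Q)) ^ (3 : ℝ)) ^ (1 / 3 : ℝ) :=
        ENNReal.rpow_le_rpow hfatou (by norm_num)
    _ = C * (2 * Q) := by
        rw [← ENNReal.rpow_mul, mul_one_div_cancel three_ne_zero, ENNReal.rpow_one]
    _ = _ := by rw [ENNReal.coe_mul, ENNReal.coe_ofNat, mul_assoc]

end Limit

/-! ### The uniform inequality on all leaves -/

theorem mainTheorem6 (U : Set R4) (g : BilinField) (T : R4 → R4) (hg : IsSpacetime U g T)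
    (p : R4) (Ψ : ℝ → R3 → R4) (R₁ : ℝ) (hcone : IsPastLightCone U g T p Ψ R₁)
    (R : ℝ) (τ : R4 → ℝ) (hτ : IsUniformlySpacelikeFoliation U g T p Ψ R₁ R τ) :
    ∃ C : ℝ≥0, ∀ r ∈ Ioc 0 R, ∀ (u : R4 → ℝ) (X : R4 → R4),
      MemH1 g τ (leaf U g T p τ r) u X →
        (∫⁻ x, ENNReal.ofReal (u x ^ 6) ∂(surfMeasure g (leaf U g T p τ r))) ^ (1 / 3 : ℝ) ≤
          C * (gradEnergy g (leaf U g T p τ r) X +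
            ENNReal.ofReal (1 / r ^ 2) * massSq g (leaf U g T p τ r) u) := by
  obtain ⟨r₀, hr₀, C₁, hC₁⟩ := sobolevOn_leaf_of_le hg hcone hτ
  obtain ⟨C₂, hC₂⟩ := sobolevOn_leaf_of_ge hg hcone hτ hr₀
  obtain ⟨δ, hδ, hspace⟩ := hτ.spacelike
  refine ⟨max C₁ C₂ * 2, fun r hr u X hu => ?_⟩
  have h : SobolevOn g τ (leaf U g T p τ r) univ r (max C₁ C₂) := by
    rcases le_total r r₀ with hrr | hrr
    · exact (hC₁ r ⟨hr.1, hrr⟩).mono Subset.rfl (le_max_left _ _)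
    · exact (hC₂ r ⟨hrr, hr.2⟩).mono Subset.rfl (le_max_right _ _)
  have hI := isOpen_chronPast hg p
  have hIτ : ContinuousOn τ (chronPast U g T p) :=
    hτ.continuousOn.mono (subset_union_left.trans (subset_insert _ _))
  have hS : MeasurableSet (leaf U g T p τ r) := by
    have h1 := (hIτ.isOpen_inter_preimage hI isClosed_singleton.isOpen_compl (t := {r}ᶜ))
    have h2 : leaf U g T p τ r = chronPast U g T p \ (chronPast U g T p ∩ τ ⁻¹' {r}ᶜ) := by
      ext x
      simp only [leaf, mem_ofPred_eq, Set.mem_sdiff, mem_inter_iff, mem_preimage, mem_compl_iff,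
        mem_singleton_iff]
      tauto
    rw [h2]
    exact hI.measurableSet.diff h1.measurableSet
  exact h.memH1 hg.isOpen hg.contDiffOn.continuousOn hg.symm hS
    (fun x hx => chronPast_subset p hx.1)
    (fun x hx v hv => (mul_nonneg hδ.le (sq_nonneg ‖v‖)).trans (hspace r hr x hx v hv)) hu
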